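/- Let $\mathcal O_{\mathcal F}=\prod_{n\ge 1}\mathbb Q[c_n]$ be the product, taken in graded rings, of the polynomial rings $\mathbb Q[c_n]$ with $c_n$ of degree $-2$. Let $$\mathcal E^{-1}\mathcal O_{\mathcal F}=\operatorname{colim}_{m\ge 1}\mathcal O_{\mathcal F}[c_1^{-1},\dots,c_m^{-1}],$$ where $c_n$ is inverted in the factor $n$ only, and let $j\colon \mathcal O_{\mathcal F}\to\mathcal E^{-1}\mathcal O_{\mathcal F}$ be the inclusion. Regard both rings as commutative differential graded rings with zero differential. Write $\mathcal O_{\mathcal F}\text{-mod}$ and $\mathcal E^{-1}\mathcal O_{\mathcal F}\text{-mod}$ for their categories of (unbounded, homologically graded) differential graded modules, with the tensor product over the ring, the symmetry given by the Koszul sign rule, and the projective model structure: weak equivalences are the quasi-isomorphisms, fibrations are the surjections, and cofibrations are the maps with the left lifting property with respect to surjective quasi-isomorphisms. Let $\Sigma^*j=\{\Sigma^k j : k\in\mathbb Z\}$ be the set of all shifts of $j$, regarded as a map of differential graded $\mathcal O_{\mathcal F}$-modules. For differential graded $\mathcal O_{\mathcal F}$-modules $X$, $Z$ let $[X,Z]_k$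 be the set of maps $\Sigma^kX\to Z$ in the homotopy category, $k\in\mathbb Z$. An object $Z$ is *local* if $s^*\colon[Y,Z]_*\to[X,Z]_*$ is an isomorphism for every $s\colon X\to Y$ in $\Sigma^*j$, and a map $f\colon X\to Y$ is a *local equivalence* if $f^*\colon[Y,Z]_*\to[X,Z]_*$ is an isomorphism for every local $Z$. Let $L_{\Sigma^*j}(\mathcal O_{\mathcal F}\text{-mod})$ be the left Bousfield localization: the category $\mathcal O_{\mathcal F}\text{-mod}$ with the same cofibrations, with the local equivalences as weak equivalences, and with fibrations the maps with the right lifting property with respect to the cofibrations that are local equivalences. Then $\mathcal O_{\mathcal F}\text{-mod}$, $L_{\Sigma^*j}(\mathcal O_{\mathcal F}\text{-mod})$ and $\mathcal E^{-1}\mathcal O_{\mathcal F}\text{-mod}$ are symmetric monoidal model categories (closed symmetric monoidal, satisfying the pushout product axiom and the unit axiom), and the adjunction $$\mathcal E^{-1}\mathcal O_{\mathcal F}\otimes_{\mathcal O_{\mathcal F}}-\;:\; L_{\Sigma^*j}(\mathcal O_{\mathcal F}\text{-mod})\;\rightleftarrows\;\mathcal E^{-1}\mathcal O_{\mathcal F}\text{-mod}\;:\;j^*$$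 of extension and restriction of scalars along $j$ is a symmetric monoidal Quillen equivalence: it is a Quillen equivalence, the left adjoint is strong symmetric monoidal, and the left adjoint sends each weak equivalence $Q\to\mathcal O_{\mathcal F}$ of the localized model structure with $Q$ cofibrant to a weak equivalence, after composition with the isomorphism $\mathcal E^{-1}\mathcal O_{\mathcal F}\otimes_{\mathcal O_{\mathcal F}}\mathcal O_{\mathcal F}\cong\mathcal E^{-1}\mathcal O_{\mathcal F}$. -/

import Mathlib

open CategoryTheory Limits MonoidalCategory HomotopicalAlgebra
open scoped TensorProduct

noncomputable section

/-! ### Evenly graded commutative rings and their differential graded modules -/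

/-- A `ℤ`-grading concentrated in even degrees. A commutative ring with such a grading is
graded-commutative, and with zero differential it is a commutative differential graded ring. -/
class EvenlyGraded {A : Type} [CommRing A] (𝒜 : ℤ → AddSubgroup A) : Prop where
  eq_zero_of_odd : ∀ (i : ℤ), Odd i → ∀ a ∈ 𝒜 i, a = 0

/-- A differential graded module (homologically graded, unbounded) over the graded ring `(A, 𝒜)`
regarded as a differential graded ring with zero differential. The underlying graded module is
given as an `A`-module with a direct sum decomposition. As `A` is concentrated in even degrees, the
Leibniz rule `d (a • m) = (-1)^|a| a • d m` says that `d` is `A`-linear. -/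
structure DGMod {A : Type} [CommRing A] (𝒜 : ℤ → AddSubgroup A) where
  carrier : Type
  [addCommGroup : AddCommGroup carrier]
  [module : Module A carrier]
  /-- the homogeneous elements of degree `i` -/
  deg : ℤ → AddSubgroup carrier
  [decomposition : DirectSum.Decomposition deg]
  smul_mem : ∀ {i j : ℤ} {a : A} {m : carrier}, a ∈ 𝒜 i → m ∈ deg j → a • m ∈ deg (i + j)
  /-- the differential -/
  d : carrier →ₗ[A] carrier
  d_mem : ∀ {i : ℤ} {m : carrier}, m ∈ deg i → d m ∈ deg (i - 1)
  d_d : ∀ m : carrier, d (d m) = 0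

namespace DGMod

attribute [instance] addCommGroup module decomposition

variable {A : Type} [CommRing A] {𝒜 : ℤ → AddSubgroup A}

/-- A morphism of differential graded modules: a linear map of degree `0` commuting with the
differentials. -/
@[ext]
structure Hom (M N : DGMod 𝒜) where
  toLin : M.carrier →ₗ[A] N.carrier
  map_mem : ∀ {i : ℤ} {m : M.carrier}, m ∈ M.deg i → toLin m ∈ N.deg i
  comm : ∀ m : M.carrier, toLin (M.d m) = N.d (toLin m)

instance : Category (DGMod 𝒜) where
  Hom M N := Hom M N
  id M := ⟨LinearMap.id, fun h => h, fun _ => rfl⟩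
  comp f g := ⟨g.toLin ∘ₗ f.toLin, fun h => g.map_mem (f.map_mem h), fun m => by
    simp [f.comm, g.comm]⟩

@[ext]
theorem hom_ext {M N : DGMod 𝒜} {f g : M ⟶ N} (h : f.toLin = g.toLin) : f = g := Hom.ext h

@[simp] theorem id_toLin (M : DGMod 𝒜) : Hom.toLin (𝟙 M) = LinearMap.id := rfl

@[simp] theorem comp_toLin {M N P : DGMod 𝒜} (f : M ⟶ N) (g : N ⟶ P) :
    Hom.toLin (f ≫ g) = g.toLin ∘ₗ f.toLin := rfl

/-- A morphism from its underlying function. -/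
@[simps]
def mkHom {M N : DGMod 𝒜} (f : M.carrier → N.carrier) (hadd : ∀ x y, f (x + y) = f x + f y)
    (hsmul : ∀ (a : A) x, f (a • x) = a • f x)
    (h : ∀ {i : ℤ} {m : M.carrier}, m ∈ M.deg i → f m ∈ N.deg i)
    (hd : ∀ m : M.carrier, f (M.d m) = N.d (f m)) : M ⟶ N :=
  ⟨⟨⟨f, hadd⟩, hsmul⟩, h, hd⟩

/-- An isomorphism from a linear equivalence which respects degrees and differentials. -/
@[simps]
def mkIso {M N : DGMod 𝒜} (e : M.carrier ≃ₗ[A] N.carrier)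
    (h : ∀ {i : ℤ} {m : M.carrier}, m ∈ M.deg i → e m ∈ N.deg i)
    (h' : ∀ {i : ℤ} {n : N.carrier}, n ∈ N.deg i → e.symm n ∈ M.deg i)
    (hd : ∀ m : M.carrier, e (M.d m) = N.d (e m)) : M ≅ N where
  hom := ⟨e.toLinearMap, h, hd⟩
  inv := ⟨e.symm.toLinearMap, h', fun n => by
    apply e.injective; simp [hd]⟩
  hom_inv_id := by ext; simp
  inv_hom_id := by ext; simp

theorem hom_induction {M : DGMod 𝒜} {p : M.carrier → Prop} (m : M.carrier) (h0 : p 0)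
    (h : ∀ i, ∀ x ∈ M.deg i, p x) (hadd : ∀ x y, p x → p y → p (x + y)) : p m :=
  DirectSum.Decomposition.inductionOn M.deg h0 (fun x => h _ x x.2) hadd m

section Graded

variable [GradedRing 𝒜] [EvenlyGraded 𝒜]

/-- The additive projection onto the part of odd degree. -/
def oddAux (M : DGMod 𝒜) : M.carrier →+ M.carrier :=
  (DirectSum.toAddMonoid fun i : ℤ => if Odd i then (M.deg i).subtype else 0).comp
    (DirectSum.decomposeAddEquiv M.deg).toAddMonoidHom

theorem oddAux_of_mem (M : DGMod 𝒜) {i : ℤ} {m : M.carrier} (h : m ∈ M.deg i) :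
    M.oddAux m = if Odd i then m else 0 := by
  simp only [oddAux, AddMonoidHom.comp_apply]
  have : (DirectSum.decomposeAddEquiv M.deg).toAddMonoidHom m
      = DirectSum.of (fun i => M.deg i) i ⟨m, h⟩ := DirectSum.decompose_of_mem _ h
  rw [this, DirectSum.toAddMonoid_of]
  split_ifs <;> rfl

/-- The linear projection onto the part of odd degree. -/
def odd (M : DGMod 𝒜) : M.carrier →ₗ[A] M.carrier where
  toFun := M.oddAux
  map_add' := map_add _
  map_smul' a m := by
    refine DirectSum.Decomposition.inductionOn 𝒜 (motive := fun a =>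
      M.oddAux (a • m) = a • M.oddAux m) (by simp) (fun {i} a => ?_)
      (fun a b ha hb => by simp [add_smul, ha, hb]) a
    refine M.hom_induction (p := fun m => M.oddAux ((a : A) • m) = (a : A) • M.oddAux m) m
      (by simp) (fun j x hx => ?_) (fun x y hx hy => by simp [smul_add, hx, hy])
    by_cases hi : Odd i
    · rw [EvenlyGraded.eq_zero_of_odd i hi a.1 a.2]; simp
    · rw [M.oddAux_of_mem (M.smul_mem a.2 hx), M.oddAux_of_mem hx]
      have : Odd (i + j) ↔ Odd j := by grind
      simp [this]

theorem odd_of_mem (M : DGMod 𝒜) {i : ℤ} {m : M.carrier} (h : m ∈ M.deg i) :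
    M.odd m = if Odd i then m else 0 := M.oddAux_of_mem h

theorem odd_mem (M : DGMod 𝒜) {i : ℤ} {m : M.carrier} (h : m ∈ M.deg i) :
    M.odd m ∈ M.deg i := by
  rw [odd_of_mem M h]; split_ifs <;> simp [h]

@[simp] theorem odd_odd (M : DGMod 𝒜) (m : M.carrier) : M.odd (M.odd m) = M.odd m :=
  M.hom_induction (p := fun m => M.odd (M.odd m) = M.odd m) m (by simp)
    (fun i x hx => by rw [odd_of_mem M hx]; split_ifs <;> simp [odd_of_mem M hx, *])
    (fun x y hx hy => by simp [hx, hy])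

@[simp] theorem odd_d (M : DGMod 𝒜) (m : M.carrier) : M.odd (M.d m) = M.d m - M.d (M.odd m) :=
  M.hom_induction (p := fun m => M.odd (M.d m) = M.d m - M.d (M.odd m)) m (by simp)
    (fun i x hx => by
      rw [odd_of_mem M hx, odd_of_mem M (M.d_mem hx)]
      by_cases h : Odd i
      · have : ¬ Odd (i - 1) := by grind
        simp [h, this]
      · have : Odd (i - 1) := by grind
        simp [h, this])
    (fun x y hx hy => by simp only [map_add, hx, hy]; abel)

@[simp] theorem odd_hom {M N : DGMod 𝒜} (f : M ⟶ N) (m : M.carrier) :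
    N.odd (f.toLin m) = f.toLin (M.odd m) :=
  M.hom_induction (p := fun m => N.odd (f.toLin m) = f.toLin (M.odd m)) m (by simp)
    (fun i x hx => by
      rw [odd_of_mem M hx, odd_of_mem N (f.map_mem hx)]; split_ifs <;> simp)
    (fun x y hx hy => by simp only [map_add, hx, hy])

/-- The sign involution, `m ↦ (-1)^|m| m` on homogeneous elements. -/
def sign (M : DGMod 𝒜) : M.carrier →ₗ[A] M.carrier := LinearMap.id - (2 : ℤ) • M.odd

theorem sign_apply (M : DGMod 𝒜) (m : M.carrier) : M.sign m = m - (2 : ℤ) • M.odd m := rfl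

theorem sign_of_mem (M : DGMod 𝒜) {i : ℤ} {m : M.carrier} (h : m ∈ M.deg i) :
    M.sign m = (i.negOnePow : ℤ) • m := by
  rw [sign_apply, odd_of_mem M h]
  split_ifs with hi
  · rw [Int.negOnePow_odd i hi]; simp [two_smul]
  · rw [Int.negOnePow_even i (by simpa using hi)]; simp

/-! ### The tensor product -/

variable (M N P : DGMod 𝒜)

/-- The degree `k` part of `M ⊗ N`: sums of `m ⊗ n` with `|m| + |n| = k`. -/
def tensorDeg (k : ℤ) : AddSubgroup (M.carrier ⊗[A] N.carrier) :=
  AddSubgroup.closure {x | ∃ (i j : ℤ), ∃ m ∈ M.deg i, ∃ n ∈ N.deg j, i + j = k ∧ m ⊗ₜ[A] n = x}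

variable {M N} in
theorem tmul_mem {i j k : ℤ} {m : M.carrier} {n : N.carrier} (hm : m ∈ M.deg i)
    (hn : n ∈ N.deg j) (h : i + j = k) : m ⊗ₜ[A] n ∈ tensorDeg M N k :=
  AddSubgroup.subset_closure ⟨i, j, m, hm, n, hn, h, rfl⟩

variable {M N} in
theorem tensorDeg_induction {k : ℤ} {p : M.carrier ⊗[A] N.carrier → Prop}
    {x : M.carrier ⊗[A] N.carrier} (hx : x ∈ tensorDeg M N k)
    (h : ∀ i j, ∀ m ∈ M.deg i, ∀ n ∈ N.deg j, i + j = k → p (m ⊗ₜ n)) (h0 : p 0)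
    (hadd : ∀ x y, p x → p y → p (x + y)) : p x := by
  suffices H : p x ∧ p (-x) from H.1
  induction hx using AddSubgroup.closure_induction with
  | mem x hx =>
    obtain ⟨i, j, m, hm, n, hn, hk, rfl⟩ := hx
    refine ⟨h i j m hm n hn hk, ?_⟩
    rw [← TensorProduct.neg_tmul]
    exact h i j _ (neg_mem hm) n hn hk
  | zero => simpa using h0
  | add x y _ _ hx hy => exact ⟨hadd x y hx.1 hy.1, by rw [neg_add]; exact hadd _ _ hx.2 hy.2⟩
  | neg x _ hx => exact ⟨hx.2, by rw [neg_neg]; exact hx.1⟩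

variable {M N} in
theorem tensor_induction {p : M.carrier ⊗[A] N.carrier → Prop} (x : M.carrier ⊗[A] N.carrier)
    (h : ∀ i j, ∀ m ∈ M.deg i, ∀ n ∈ N.deg j, p (m ⊗ₜ n)) (h0 : p 0)
    (hadd : ∀ x y, p x → p y → p (x + y)) : p x := by
  induction x using TensorProduct.induction_on with
  | zero => exact h0
  | add x y hx hy => exact hadd x y hx hy
  | tmul m n =>
    refine M.hom_induction (p := fun m => p (m ⊗ₜ n)) m (by simpa) (fun i m hm => ?_)
      (fun x y hx hy => by rw [TensorProduct.add_tmul]; exact hadd _ _ hx hy)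
    exact N.hom_induction (p := fun n => p (m ⊗ₜ n)) n (by simpa) (fun j n hn => h i j m hm n hn)
      (fun x y hx hy => by rw [TensorProduct.tmul_add]; exact hadd _ _ hx hy)

/-- Auxiliary biadditive map for the decomposition of the tensor product. -/
def tensorDecomposeAux : M.carrier →+ N.carrier →+ DirectSum ℤ fun k => tensorDeg M N k :=
  ((DirectSum.toAddMonoid fun i : ℤ => AddMonoidHom.mk' (fun m : M.deg i =>
    (DirectSum.toAddMonoid fun j : ℤ => AddMonoidHom.mk' (fun n : N.deg j =>
      DirectSum.of (fun k => tensorDeg M N k) (i + j)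
        ⟨(m : M.carrier) ⊗ₜ[A] (n : N.carrier), tmul_mem m.2 n.2 rfl⟩) (fun n n' => by
          rw [← map_add]; congr 1; ext; simp [TensorProduct.tmul_add])).comp
    (DirectSum.decomposeAddEquiv N.deg).toAddMonoidHom) (fun m m' => by
      rw [← AddMonoidHom.add_comp]
      congr 1
      refine DirectSum.addHom_ext fun j n => ?_
      simp only [AddMonoidHom.add_apply, DirectSum.toAddMonoid_of, AddMonoidHom.mk'_apply]
      rw [← map_add]; congr 1; ext; simp [TensorProduct.add_tmul])).comp
  (DirectSum.decomposeAddEquiv M.deg).toAddMonoidHom)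

theorem tensorDecomposeAux_of_mem {i j k : ℤ} {m : M.carrier} {n : N.carrier} (hm : m ∈ M.deg i)
    (hn : n ∈ N.deg j) (h : i + j = k) :
    tensorDecomposeAux M N m n =
      DirectSum.of (fun k => tensorDeg M N k) k ⟨m ⊗ₜ[A] n, tmul_mem hm hn h⟩ := by
  subst h
  have h1 : (DirectSum.decomposeAddEquiv M.deg).toAddMonoidHom m
    = DirectSum.of (fun i => M.deg i) i ⟨m, hm⟩ := DirectSum.decompose_of_mem _ hm
  have h2 : (DirectSum.decomposeAddEquiv N.deg).toAddMonoidHom n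
    = DirectSum.of (fun i => N.deg i) j ⟨n, hn⟩ := DirectSum.decompose_of_mem _ hn
  simp only [tensorDecomposeAux, AddMonoidHom.comp_apply, h1, h2, DirectSum.toAddMonoid_of,
    AddMonoidHom.mk'_apply]

/-- Auxiliary map for the decomposition of the tensor product. -/
def tensorDecompose : M.carrier ⊗[A] N.carrier →+ DirectSum ℤ fun k => tensorDeg M N k :=
  TensorProduct.liftAddHom (tensorDecomposeAux M N) fun a m n => by
    refine DirectSum.Decomposition.inductionOn 𝒜 (motive := fun a =>
      tensorDecomposeAux M N (a • m) n = tensorDecomposeAux M N m (a • n)) (by simp)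
      (fun {i} a => ?_) (fun a b ha hb => by simp [add_smul, ha, hb]) a
    refine M.hom_induction (p := fun m => tensorDecomposeAux M N ((a : A) • m) n =
      tensorDecomposeAux M N m ((a : A) • n)) m
      (by simp) (fun j x hx => ?_) (fun x y hx hy => by simp [smul_add, hx, hy])
    refine N.hom_induction (p := fun n => tensorDecomposeAux M N ((a : A) • x) n =
      tensorDecomposeAux M N x ((a : A) • n)) n
      (by simp) (fun k y hy => ?_) (fun x y hx hy => by simp only [map_add, smul_add, hx, hy])
    rw [tensorDecomposeAux_of_mem M N (M.smul_mem a.2 hx) hy rfl,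
      tensorDecomposeAux_of_mem M N (k := i + j + k) hx (N.smul_mem a.2 hy) (by ring)]
    congr 2
    exact TensorProduct.smul_tmul _ _ _

instance tensorDecomposition : DirectSum.Decomposition (tensorDeg M N) :=
  DirectSum.Decomposition.ofAddHom (tensorDeg M N) (tensorDecompose M N)
    (AddMonoidHom.ext fun x => by
      refine tensor_induction (p := fun x => (DirectSum.coeAddMonoidHom (tensorDeg M N))
        (tensorDecompose M N x) = x) x (fun i j m hm n hn => ?_) (by simp)
        (fun x y hx hy => by simp only [map_add, hx, hy])
      rw [tensorDecompose, TensorProduct.liftAddHom_tmul,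
        tensorDecomposeAux_of_mem M N hm hn rfl, DirectSum.coeAddMonoidHom_of])
    (DirectSum.addHom_ext fun k ⟨x, hx⟩ => by
      simp only [AddMonoidHom.comp_apply, DirectSum.coeAddMonoidHom_of, AddMonoidHom.id_apply]
      induction hx using AddSubgroup.closure_induction with
      | mem x hx =>
        obtain ⟨i, j, m, hm, n, hn, hk, rfl⟩ := hx
        rw [tensorDecompose, TensorProduct.liftAddHom_tmul,
          tensorDecomposeAux_of_mem M N hm hn hk]
      | zero => rw [map_zero]; exact (map_zero _).symm
      | add x y hx hy h h' => rw [map_add, h, h', ← map_add]; rfl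
      | neg x hx h => rw [map_neg, h, ← map_neg]; rfl)

/-- The differential `d (m ⊗ n) = d m ⊗ n + (-1)^|m| m ⊗ d n` of the tensor product. -/
def tensorD : M.carrier ⊗[A] N.carrier →ₗ[A] M.carrier ⊗[A] N.carrier :=
  TensorProduct.map M.d LinearMap.id + TensorProduct.map M.sign N.d

@[simp] theorem tensorD_tmul (m : M.carrier) (n : N.carrier) :
    tensorD M N (m ⊗ₜ n) = M.d m ⊗ₜ n + M.sign m ⊗ₜ N.d n := rfl

/-- The tensor product of differential graded modules over `A`. -/
abbrev tensor : DGMod 𝒜 where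
  carrier := M.carrier ⊗[A] N.carrier
  deg := tensorDeg M N
  smul_mem {i j a x} ha hx := by
    refine tensorDeg_induction (p := fun x => a • x ∈ tensorDeg M N (i + j)) hx
      (fun k l m hm n hn h => ?_) (by simp)
      (fun x y hx hy => by rw [smul_add]; exact add_mem hx hy)
    rw [TensorProduct.smul_tmul']
    exact tmul_mem (M.smul_mem ha hm) hn (by omega)
  d := tensorD M N
  d_mem {i x} hx := by
    refine tensorDeg_induction (p := fun x => tensorD M N x ∈ tensorDeg M N (i - 1)) hx
      (fun k l m hm n hn h => ?_) (by simp)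
      (fun x y hx hy => by rw [map_add]; exact add_mem hx hy)
    rw [tensorD_tmul]
    refine add_mem (tmul_mem (M.d_mem hm) hn (by omega)) (tmul_mem ?_ (N.d_mem hn)
      (show k + (l - 1) = _ by omega))
    rw [sign_of_mem M hm]
    exact zsmul_mem hm _
  d_d x := by
    induction x using TensorProduct.induction_on with
    | zero => simp
    | add x y hx hy => simp only [map_add, hx, hy, add_zero]
    | tmul m n =>
      simp [sign_apply, M.d_d, N.d_d, TensorProduct.sub_tmul, smul_sub, two_smul,
        TensorProduct.add_tmul]
      abel

/-- The projection of the tensor product onto the part of odd degree. -/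
theorem tensor_odd_tmul (m : M.carrier) (n : N.carrier) :
    (tensor M N).odd (m ⊗ₜ n) =
      M.odd m ⊗ₜ n + m ⊗ₜ N.odd n - (2 : ℤ) • (M.odd m ⊗ₜ[A] N.odd n) := by
  let f : M.carrier ⊗[A] N.carrier →ₗ[A] M.carrier ⊗[A] N.carrier :=
      TensorProduct.map M.odd LinearMap.id + TensorProduct.map LinearMap.id N.odd
        - (2 : ℤ) • TensorProduct.map M.odd N.odd
  have key : ∀ x, (tensor M N).odd x = f x := fun x => by
    refine tensor_induction (p := fun x => (tensor M N).odd x = f x) x (fun i j m hm n hn => ?_)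
      (by simp) (fun x y hx hy => by simp only [map_add, hx, hy])
    rw [odd_of_mem (tensor M N) (tmul_mem hm hn rfl)]
    simp only [f, LinearMap.add_apply, LinearMap.sub_apply, LinearMap.smul_apply,
      TensorProduct.map_tmul, LinearMap.id_apply, odd_of_mem M hm, odd_of_mem N hn]
    by_cases hi : Odd i <;> by_cases hj : Odd j
    · have : ¬ Odd (i + j) := by grind
      simp [hi, hj, this, two_smul]
    · have : Odd (i + j) := by grind
      simp [hi, hj, this]
    · have : Odd (i + j) := by grind
      simp [hi, hj, this]
    · have : ¬ Odd (i + j) := by grind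
      simp [hi, hj, this]
  exact key _

theorem tensor_sign_tmul (m : M.carrier) (n : N.carrier) :
    (tensor M N).sign (m ⊗ₜ n) = M.sign m ⊗ₜ N.sign n := by
  have h : (tensor M N).sign (m ⊗ₜ n) = m ⊗ₜ n - (2 : ℤ) • (M.odd m ⊗ₜ n + m ⊗ₜ N.odd n -
      (2 : ℤ) • (M.odd m ⊗ₜ[A] N.odd n)) :=
    congrArg (fun y => m ⊗ₜ[A] n - (2 : ℤ) • y) (tensor_odd_tmul M N m n)
  rw [h]
  simp only [sign_apply, TensorProduct.sub_tmul, TensorProduct.tmul_sub,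
    two_smul, TensorProduct.add_tmul, TensorProduct.tmul_add]
  abel

variable (𝒜) in
/-- The unit of the tensor product: `A` itself with zero differential. -/
abbrev unit : DGMod 𝒜 where
  carrier := A
  deg := 𝒜
  smul_mem ha hm := SetLike.mul_mem_graded ha hm
  d := 0
  d_mem _ := zero_mem _
  d_d _ := rfl

@[simp] theorem unit_d (a : A) : (unit 𝒜).d a = 0 := rfl

@[simp] theorem unit_odd (a : A) : (unit 𝒜).odd a = 0 :=
  (unit 𝒜).hom_induction (p := fun a => (unit 𝒜).odd a = 0) a (by simp)
    (fun i x hx => by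
      rw [odd_of_mem _ hx]
      split_ifs with h
      · exact EvenlyGraded.eq_zero_of_odd (𝒜 := 𝒜) i h x hx
      · rfl)
    (fun x y hx hy => by rw [map_add, hx, hy, add_zero])

theorem unit_sign (a : A) : (unit 𝒜).sign a = a := by
  have h : (unit 𝒜).sign a = a - (2 : ℤ) • (unit 𝒜).odd a := rfl
  rw [h, unit_odd, smul_zero, sub_zero]

variable {M N} in
/-- The tensor product of morphisms. -/
def tensorMap {M' N' : DGMod 𝒜} (f : M ⟶ M') (g : N ⟶ N') : tensor M N ⟶ tensor M' N' where
  toLin := TensorProduct.map f.toLin g.toLin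
  map_mem {k x} hx := by
    refine tensorDeg_induction (p := fun x => TensorProduct.map f.toLin g.toLin x ∈
      tensorDeg M' N' k) hx (fun i j m hm n hn h => ?_) (by simp)
      (fun x y hx hy => by rw [map_add]; exact add_mem hx hy)
    exact tmul_mem (f.map_mem hm) (g.map_mem hn) h
  comm x := by
    change TensorProduct.map f.toLin g.toLin (tensorD M N x) =
      tensorD M' N' (TensorProduct.map f.toLin g.toLin x)
    induction x using TensorProduct.induction_on with
    | zero => simp
    | add x y hx hy => simp only [map_add, hx, hy]
    | tmul m n => simp [sign_apply, f.comm, g.comm]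

variable {P} in
/-- Homogeneous elements of a triple tensor product. -/
theorem assoc_mem {k : ℤ} {x : (M.carrier ⊗[A] N.carrier) ⊗[A] P.carrier}
    (hx : x ∈ tensorDeg (tensor M N) P k) :
    TensorProduct.assoc A _ _ _ x ∈ tensorDeg M (tensor N P) k := by
  refine tensorDeg_induction (p := fun x => TensorProduct.assoc A _ _ _ x ∈
      tensorDeg M (tensor N P) k) hx (fun i j y hy p hp h => ?_) (by simp)
      (fun x y hx hy => by rw [map_add]; exact add_mem hx hy)
  refine tensorDeg_induction (p := fun y => TensorProduct.assoc A _ _ _ (y ⊗ₜ p) ∈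
      tensorDeg M (tensor N P) k) hy (fun a b m hm n hn h' => ?_) (by simp)
      (fun x y hx hy => by rw [TensorProduct.add_tmul, map_add]; exact add_mem hx hy)
  rw [TensorProduct.assoc_tmul]
  exact tmul_mem hm (N := tensor N P) (tmul_mem hn hp rfl) (by omega)

variable {P} in
theorem assoc_symm_mem {k : ℤ} {x : M.carrier ⊗[A] (N.carrier ⊗[A] P.carrier)}
    (hx : x ∈ tensorDeg M (tensor N P) k) :
    (TensorProduct.assoc A _ _ _).symm x ∈ tensorDeg (tensor M N) P k := by
  refine tensorDeg_induction (p := fun x => (TensorProduct.assoc A _ _ _).symm x ∈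
      tensorDeg (tensor M N) P k) hx (fun i j m hm y hy h => ?_) (by simp)
      (fun x y hx hy => by rw [map_add]; exact add_mem hx hy)
  refine tensorDeg_induction (p := fun y => (TensorProduct.assoc A _ _ _).symm (m ⊗ₜ y) ∈
      tensorDeg (tensor M N) P k) hy (fun a b n hn p hp h' => ?_) (by simp)
      (fun x y hx hy => by rw [TensorProduct.tmul_add, map_add]; exact add_mem hx hy)
  rw [TensorProduct.assoc_symm_tmul]
  exact tmul_mem (M := tensor M N) (tmul_mem hm hn rfl) hp (by omega)

theorem assoc_d (x : (M.carrier ⊗[A] N.carrier) ⊗[A] P.carrier) :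
    TensorProduct.assoc A _ _ _ (tensorD (tensor M N) P x) =
      tensorD M (tensor N P) (TensorProduct.assoc A _ _ _ x) := by
  induction x using TensorProduct.induction_on with
  | zero => simp
  | add x y hx hy => simp only [map_add, hx, hy]
  | tmul x p =>
    induction x using TensorProduct.induction_on with
    | zero => simp
    | add x y hx hy => simp only [map_add, TensorProduct.add_tmul, hx, hy]
    | tmul m n =>
      change TensorProduct.assoc A _ _ _ (tensorD M N (m ⊗ₜ n) ⊗ₜ p +
          (tensor M N).sign (m ⊗ₜ n) ⊗ₜ P.d p) =
        M.d m ⊗ₜ (n ⊗ₜ p) + M.sign m ⊗ₜ tensorD N P (n ⊗ₜ p)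
      rw [tensor_sign_tmul]
      simp [TensorProduct.add_tmul, TensorProduct.tmul_add, add_assoc]

/-- The associator. -/
def assoc : tensor (tensor M N) P ≅ tensor M (tensor N P) :=
  mkIso (TensorProduct.assoc A _ _ _) (assoc_mem M N) (assoc_symm_mem M N) (assoc_d M N P)

/-- The left unitor. -/
def leftUnitor : tensor (unit 𝒜) M ≅ M :=
  mkIso (TensorProduct.lid A _)
    (fun {k x} hx => by
      refine tensorDeg_induction (p := fun x => TensorProduct.lid A _ x ∈ M.deg k) hx
        (fun i j a ha m hm h => ?_) (by simp)
        (fun x y hx hy => by rw [map_add]; exact add_mem hx hy)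
      rw [TensorProduct.lid_tmul, ← h]
      exact M.smul_mem ha hm)
    (fun {k m} hm => tmul_mem (M := unit 𝒜) (SetLike.one_mem_graded 𝒜) hm (zero_add k))
    (fun x => by
      change TensorProduct.lid A _ (tensorD (unit 𝒜) M x) = M.d (TensorProduct.lid A _ x)
      induction x using TensorProduct.induction_on with
      | zero => simp
      | add x y hx hy => simp only [map_add, hx, hy]
      | tmul a m =>
        change TensorProduct.lid A _ ((0 : A) ⊗ₜ m + (unit 𝒜).sign a ⊗ₜ M.d m) =
          M.d (TensorProduct.lid A _ (a ⊗ₜ m))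
        rw [unit_sign]; simp)

/-- The right unitor. -/
def rightUnitor : tensor M (unit 𝒜) ≅ M :=
  mkIso (TensorProduct.rid A _)
    (fun {k x} hx => by
      refine tensorDeg_induction (p := fun x => TensorProduct.rid A _ x ∈ M.deg k) hx
        (fun i j m hm a ha h => ?_) (by simp)
        (fun x y hx hy => by rw [map_add]; exact add_mem hx hy)
      rw [TensorProduct.rid_tmul, ← h, add_comm i]
      exact M.smul_mem ha hm)
    (fun {k m} hm => tmul_mem (N := unit 𝒜) hm (SetLike.one_mem_graded 𝒜) (add_zero k))
    (fun x => by
      change TensorProduct.rid A _ (tensorD M (unit 𝒜) x) = M.d (TensorProduct.rid A _ x)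
      induction x using TensorProduct.induction_on with
      | zero => simp
      | add x y hx hy => simp only [map_add, hx, hy]
      | tmul m a =>
        change TensorProduct.rid A _ (M.d m ⊗ₜ a + M.sign m ⊗ₜ (0 : A)) =
          M.d (TensorProduct.rid A _ (m ⊗ₜ a))
        simp)

/-- The underlying linear map of the braiding, `m ⊗ n ↦ (-1)^(|m| |n|) n ⊗ m`. -/
def braidLin : M.carrier ⊗[A] N.carrier →ₗ[A] N.carrier ⊗[A] M.carrier :=
  (TensorProduct.comm A _ _).toLinearMap ∘ₗ
    (LinearMap.id - (2 : ℤ) • TensorProduct.map M.odd N.odd)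

theorem braidLin_tmul (m : M.carrier) (n : N.carrier) :
    braidLin M N (m ⊗ₜ n) = n ⊗ₜ m - (2 : ℤ) • (N.odd n ⊗ₜ[A] M.odd m) := by
  simp [braidLin, two_smul]

theorem braidLin_of_mem {i j : ℤ} {m : M.carrier} {n : N.carrier} (hm : m ∈ M.deg i)
    (hn : n ∈ N.deg j) :
    braidLin M N (m ⊗ₜ n) = ((i * j).negOnePow : ℤ) • (n ⊗ₜ[A] m) := by
  rw [braidLin_tmul, odd_of_mem M hm, odd_of_mem N hn]
  by_cases h : Odd (i * j)
  · obtain ⟨hi, hj⟩ := Int.odd_mul.1 h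
    rw [Int.negOnePow_odd _ h]
    simp [hi, hj, two_smul]
  · rw [Int.negOnePow_even _ (Int.not_odd_iff_even.1 h)]
    rw [Int.odd_mul, not_and_or] at h
    rcases h with h | h <;> simp [h]

theorem braidLin_braidLin (x : M.carrier ⊗[A] N.carrier) : braidLin N M (braidLin M N x) = x := by
  induction x using TensorProduct.induction_on with
  | zero => simp
  | add x y hx hy => simp only [map_add, hx, hy]
  | tmul m n =>
    simp only [braidLin_tmul, two_smul, map_sub, map_add, odd_odd]
    abel

variable {M N} in
theorem braidLin_mem {k : ℤ} {x : M.carrier ⊗[A] N.carrier} (hx : x ∈ tensorDeg M N k) :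
    braidLin M N x ∈ tensorDeg N M k := by
  refine tensorDeg_induction (p := fun x => braidLin M N x ∈ tensorDeg N M k) hx
    (fun i j m hm n hn h => ?_) (by simp)
    (fun x y hx hy => by rw [map_add]; exact add_mem hx hy)
  rw [braidLin_of_mem M N hm hn]
  exact zsmul_mem (tmul_mem hn hm (by omega)) _

theorem braidLin_d (x : M.carrier ⊗[A] N.carrier) :
    braidLin M N (tensorD M N x) = tensorD N M (braidLin M N x) := by
  induction x using TensorProduct.induction_on with
  | zero => simp
  | add x y hx hy => simp only [map_add, hx, hy]
  | tmul m n =>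
    simp only [tensorD_tmul, map_add, map_sub, braidLin_tmul, sign_apply, odd_d, odd_odd,
      two_smul, TensorProduct.add_tmul, TensorProduct.sub_tmul, TensorProduct.tmul_sub]
    abel

/-- The symmetry isomorphism, with the Koszul sign. -/
def braid : tensor M N ≅ tensor N M where
  hom := ⟨braidLin M N, braidLin_mem, braidLin_d M N⟩
  inv := ⟨braidLin N M, braidLin_mem, braidLin_d N M⟩
  hom_inv_id := hom_ext (LinearMap.ext (braidLin_braidLin M N))
  inv_hom_id := hom_ext (LinearMap.ext (braidLin_braidLin N M))

instance : MonoidalCategoryStruct (DGMod 𝒜) where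
  tensorObj := tensor
  whiskerLeft M _ _ f := tensorMap (𝟙 M) f
  whiskerRight f N := tensorMap f (𝟙 N)
  tensorHom := tensorMap
  tensorUnit := unit 𝒜
  associator := assoc
  leftUnitor := leftUnitor
  rightUnitor := rightUnitor

instance : MonoidalCategory (DGMod 𝒜) where
  tensorHom_def _ _ := hom_ext (TensorProduct.ext' fun _ _ => rfl)
  id_tensorHom_id _ _ := hom_ext (TensorProduct.ext' fun _ _ => rfl)
  tensorHom_comp_tensorHom _ _ _ _ := hom_ext (TensorProduct.ext' fun _ _ => rfl)
  whiskerLeft_id _ _ := hom_ext (TensorProduct.ext' fun _ _ => rfl)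
  id_whiskerRight _ _ := hom_ext (TensorProduct.ext' fun _ _ => rfl)
  associator_naturality _ _ _ := hom_ext (TensorProduct.ext_threefold fun _ _ _ => rfl)
  leftUnitor_naturality f := hom_ext (TensorProduct.ext' fun a m => (f.toLin.map_smul a m).symm)
  rightUnitor_naturality f := hom_ext (TensorProduct.ext' fun m a => (f.toLin.map_smul a m).symm)
  pentagon _ _ _ _ := hom_ext (TensorProduct.ext_fourfold fun _ _ _ _ => rfl)
  triangle _ _ := hom_ext (TensorProduct.ext_threefold fun m a n =>
    (TensorProduct.smul_tmul a m n).symm)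

instance : SymmetricCategory (DGMod 𝒜) where
  braiding := braid
  braiding_naturality_right M {_ _} f := hom_ext (TensorProduct.ext' fun m n => by
    change braidLin _ _ (m ⊗ₜ f.toLin n) =
      TensorProduct.map f.toLin LinearMap.id (braidLin _ _ (m ⊗ₜ n))
    simp [braidLin_tmul])
  braiding_naturality_left f N := hom_ext (TensorProduct.ext' fun m n => by
    change braidLin _ _ (f.toLin m ⊗ₜ n) =
      TensorProduct.map LinearMap.id f.toLin (braidLin _ _ (m ⊗ₜ n))
    simp [braidLin_tmul])
  hexagon_forward M N P := hom_ext (TensorProduct.ext_threefold fun m n p => by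
    change TensorProduct.assoc A _ _ _ (braidLin M (tensor N P) (m ⊗ₜ (n ⊗ₜ p))) =
      TensorProduct.map LinearMap.id (braidLin M P) (TensorProduct.assoc A _ _ _
        (braidLin M N (m ⊗ₜ n) ⊗ₜ p))
    rw [braidLin_tmul M (tensor N P), tensor_odd_tmul, braidLin_tmul]
    simp only [two_smul, TensorProduct.add_tmul, TensorProduct.sub_tmul, TensorProduct.tmul_sub,
      TensorProduct.tmul_add, map_add, map_sub, TensorProduct.assoc_tmul, TensorProduct.map_tmul,
      LinearMap.id_apply, braidLin_tmul, odd_odd]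
    abel)
  hexagon_reverse M N P := hom_ext (TensorProduct.ext_threefold' fun m n p => by
    change (TensorProduct.assoc A _ _ _).symm (braidLin (tensor M N) P ((m ⊗ₜ n) ⊗ₜ p)) =
      TensorProduct.map (braidLin M P) LinearMap.id ((TensorProduct.assoc A _ _ _).symm
        (m ⊗ₜ braidLin N P (n ⊗ₜ p)))
    rw [braidLin_tmul (tensor M N) P, tensor_odd_tmul, braidLin_tmul]
    simp only [two_smul, TensorProduct.add_tmul, TensorProduct.sub_tmul, TensorProduct.tmul_sub,
      TensorProduct.tmul_add, map_add, map_sub, TensorProduct.assoc_symm_tmul,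
      TensorProduct.map_tmul, LinearMap.id_apply, braidLin_tmul, odd_odd]
    abel)
  symmetry M N := (braid M N).hom_inv_id

end Graded
end DGMod

/-! ### Extension and restriction of scalars -/

/-- The structure map `A → B` of an algebra preserves the gradings. -/
class GradedAlgebraMap {A B : Type} [CommRing A] [CommRing B] [Algebra A B]
    (𝒜 : ℤ → AddSubgroup A) (ℬ : ℤ → AddSubgroup B) : Prop where
  map_mem : ∀ {i : ℤ} {a : A}, a ∈ 𝒜 i → algebraMap A B a ∈ ℬ i

namespace DGMod

section Scalars

variable {A B : Type} [CommRing A] [CommRing B] [Algebra A B]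
  (𝒜 : ℤ → AddSubgroup A) (ℬ : ℤ → AddSubgroup B)
  [GradedRing 𝒜] [EvenlyGraded 𝒜] [GradedRing ℬ] [EvenlyGraded ℬ] [GradedAlgebraMap 𝒜 ℬ]

/-- The `A`-algebra `B`, as a differential graded `A`-module with zero differential. -/
abbrev ofAlgebra : DGMod 𝒜 where
  carrier := B
  deg := ℬ
  smul_mem ha hm := by
    rw [Algebra.smul_def]
    exact SetLike.mul_mem_graded (GradedAlgebraMap.map_mem ha) hm
  d := 0
  d_mem _ := zero_mem _
  d_d _ := rfl

/-- The structure map `A → B` as a morphism of differential graded `A`-modules. -/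
def algebraMapHom : unit 𝒜 ⟶ ofAlgebra 𝒜 ℬ where
  toLin := Algebra.linearMap A B
  map_mem ha := GradedAlgebraMap.map_mem ha
  comm _ := map_zero (algebraMap A B)

/-- A differential graded `B`-module regarded as a differential graded `A`-module. -/
abbrev restrict (N : DGMod ℬ) : DGMod 𝒜 :=
  letI : Module A N.carrier := Module.compHom N.carrier (algebraMap A B)
  { carrier := N.carrier
    deg := N.deg
    smul_mem := fun ha hm => N.smul_mem (GradedAlgebraMap.map_mem (𝒜 := 𝒜) (ℬ := ℬ) ha) hm
    d := { N.d with map_smul' := fun a m => N.d.map_smul (algebraMap A B a) m }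
    d_mem := N.d_mem
    d_d := N.d_d }

/-- Restriction of scalars along `A → B`. -/
def restrictScalars : DGMod ℬ ⥤ DGMod 𝒜 where
  obj N := restrict 𝒜 ℬ N
  map {N N'} f :=
    { toLin :=
        { toFun := f.toLin
          map_add' := f.toLin.map_add
          map_smul' := fun a m => f.toLin.map_smul (algebraMap A B a) m }
      map_mem := f.map_mem
      comm := f.comm }

/-- The differential graded `B`-module `B ⊗ M`, with `|b ⊗ m| = |b| + |m|` and
`d (b ⊗ m) = b ⊗ d m`. -/
abbrev extend (M : DGMod 𝒜) : DGMod ℬ where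
  carrier := B ⊗[A] M.carrier
  deg := tensorDeg (ofAlgebra 𝒜 ℬ) M
  decomposition := tensorDecomposition (ofAlgebra 𝒜 ℬ) M
  smul_mem {i j b x} hb hx := by
    refine tensorDeg_induction (p := fun x : B ⊗[A] M.carrier =>
      b • x ∈ tensorDeg (ofAlgebra 𝒜 ℬ) M (i + j)) hx
      (fun k l c hc m hm h => ?_) (by simp)
      (fun x y hx hy => by rw [smul_add]; exact add_mem hx hy)
    exact tmul_mem (M := ofAlgebra 𝒜 ℬ) (SetLike.mul_mem_graded hb hc) hm (by omega)
  d := M.d.baseChange B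
  d_mem {i x} hx := by
    refine tensorDeg_induction (p := fun x : B ⊗[A] M.carrier =>
      M.d.baseChange B x ∈ tensorDeg (ofAlgebra 𝒜 ℬ) M (i - 1)) hx
      (fun k l c hc m hm h => ?_) (by simp)
      (fun x y hx hy => by rw [map_add]; exact add_mem hx hy)
    exact tmul_mem (M := ofAlgebra 𝒜 ℬ) hc (M.d_mem hm) (by omega)
  d_d x := by
    induction x using TensorProduct.induction_on with
    | zero => simp
    | add x y hx hy => simp only [map_add, hx, hy, add_zero]
    | tmul b m => simp [M.d_d]

variable {𝒜} in
theorem extend_mem {M : DGMod 𝒜} {i j k : ℤ} {b : B} {m : M.carrier} (hb : b ∈ ℬ i)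
    (hm : m ∈ M.deg j) (h : i + j = k) : b ⊗ₜ[A] m ∈ (extend 𝒜 ℬ M).deg k :=
  tmul_mem (M := ofAlgebra 𝒜 ℬ) hb hm h

/-- Two morphisms out of `B ⊗ M` agree if they agree on the elements `1 ⊗ m`. -/
theorem extend_hom_ext {M : DGMod 𝒜} {N : DGMod ℬ} {f g : extend 𝒜 ℬ M ⟶ N}
    (h : ∀ m : M.carrier, f.toLin ((1 : B) ⊗ₜ[A] m) = g.toLin ((1 : B) ⊗ₜ[A] m)) : f = g := by
  refine hom_ext (LinearMap.ext fun x => ?_)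
  have key : ∀ (b : B) (m : M.carrier), b ⊗ₜ[A] m = b • ((1 : B) ⊗ₜ[A] m) := fun b m => by
    rw [TensorProduct.smul_tmul', smul_eq_mul, mul_one]
  change f.toLin x = g.toLin x
  induction x using TensorProduct.induction_on with
  | zero => rw [map_zero, map_zero]
  | add x y hx hy => rw [map_add, map_add, hx, hy]
  | tmul b m => rw [key, map_smul, map_smul, h]

theorem extend_odd_tmul (M : DGMod 𝒜) (b : B) (m : M.carrier) :
    (extend 𝒜 ℬ M).odd (b ⊗ₜ[A] m) = b ⊗ₜ[A] M.odd m := by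
  refine DirectSum.Decomposition.inductionOn ℬ (motive := fun b =>
    (extend 𝒜 ℬ M).odd (b ⊗ₜ[A] m) = b ⊗ₜ[A] M.odd m) (by simp) (fun {i} b => ?_)
    (fun b c hb hc => by simp only [TensorProduct.add_tmul, map_add, hb, hc]) b
  refine M.hom_induction (p := fun m => (extend 𝒜 ℬ M).odd ((b : B) ⊗ₜ[A] m) =
    (b : B) ⊗ₜ[A] M.odd m) m (by simp) (fun j m hm => ?_)
    (fun x y hx hy => by simp only [TensorProduct.tmul_add, map_add, hx, hy])
  by_cases hi : Odd i
  · rw [EvenlyGraded.eq_zero_of_odd i hi b.1 b.2]; simp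
  · rw [odd_of_mem _ (extend_mem ℬ b.2 hm rfl), odd_of_mem M hm]
    have : Odd (i + j) ↔ Odd j := by grind
    by_cases hj : Odd j <;> simp [this, hj]

theorem extend_sign_tmul (M : DGMod 𝒜) (b : B) (m : M.carrier) :
    (extend 𝒜 ℬ M).sign (b ⊗ₜ[A] m) = b ⊗ₜ[A] M.sign m := by
  have h : (extend 𝒜 ℬ M).sign (b ⊗ₜ[A] m) = b ⊗ₜ[A] m - (2 : ℤ) • (b ⊗ₜ[A] M.odd m) :=
    congrArg (fun y => b ⊗ₜ[A] m - (2 : ℤ) • y) (extend_odd_tmul 𝒜 ℬ M b m)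
  rw [h, sign_apply, TensorProduct.tmul_sub, two_smul, two_smul, TensorProduct.tmul_add]

/-- Extension of scalars `B ⊗ -` along `A → B`. -/
def extendScalars : DGMod 𝒜 ⥤ DGMod ℬ where
  obj M := extend 𝒜 ℬ M
  map {M M'} f :=
    { toLin := f.toLin.baseChange B
      map_mem := fun {k x} hx => by
        refine tensorDeg_induction (p := fun x : B ⊗[A] M.carrier =>
          f.toLin.baseChange B x ∈ tensorDeg (ofAlgebra 𝒜 ℬ) M' k) hx
          (fun i l c hc m hm h => ?_) (by simp)
          (fun x y hx hy => by rw [map_add]; exact add_mem hx hy)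
        exact extend_mem ℬ hc (f.map_mem hm) h
      comm := fun x => by
        change f.toLin.baseChange B (M.d.baseChange B x) = M'.d.baseChange B (f.toLin.baseChange B x)
        induction x using TensorProduct.induction_on with
        | zero => simp
        | add x y hx hy => simp only [map_add, hx, hy]
        | tmul b m => simp [f.comm] }
  map_id _ := extend_hom_ext 𝒜 ℬ fun _ => rfl
  map_comp _ _ := extend_hom_ext 𝒜 ℬ fun _ => rfl

/-- The counit `B ⊗ N → N`, `b ⊗ n ↦ b • n`. -/
def counitHom (N : DGMod ℬ) : extend 𝒜 ℬ (restrict 𝒜 ℬ N) ⟶ N :=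
  letI : Module A N.carrier := Module.compHom N.carrier (algebraMap A B)
  haveI : IsScalarTower A B N.carrier := ⟨fun a b n => by
    rw [Algebra.smul_def, mul_smul]; rfl⟩
  { toLin := (LinearMap.id (R := A) (M := N.carrier)).liftBaseChange B
    map_mem := fun {k x} hx => by
      refine tensorDeg_induction (M := ofAlgebra 𝒜 ℬ) (N := restrict 𝒜 ℬ N)
        (p := fun x : B ⊗[A] N.carrier =>
          (LinearMap.id (R := A) (M := N.carrier)).liftBaseChange B x ∈ N.deg k) hx
        (fun i l c hc n hn h => ?_) (by simp)
        (fun x y hx hy => by rw [map_add]; exact add_mem hx hy)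
      rw [LinearMap.liftBaseChange_tmul, ← h]
      exact N.smul_mem hc hn
    comm := fun x => by
      change (LinearMap.id (R := A) (M := N.carrier)).liftBaseChange B
          ((restrict 𝒜 ℬ N).d.baseChange B x) =
        N.d ((LinearMap.id (R := A) (M := N.carrier)).liftBaseChange B x)
      induction x using TensorProduct.induction_on with
      | zero => simp
      | add x y hx hy => simp only [map_add, hx, hy]
      | tmul b n =>
        rw [LinearMap.baseChange_tmul, LinearMap.liftBaseChange_tmul,
          LinearMap.liftBaseChange_tmul, map_smul]
        rfl }

/-- The unit `M → B ⊗ M`, `m ↦ 1 ⊗ m`. -/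
def unitHom (M : DGMod 𝒜) : M ⟶ restrict 𝒜 ℬ (extend 𝒜 ℬ M) :=
  mkHom (fun m => (1 : B) ⊗ₜ[A] m)
    (fun m m' => TensorProduct.tmul_add _ m m')
    (fun a m => by
      change (1 : B) ⊗ₜ[A] (a • m) = algebraMap A B a • ((1 : B) ⊗ₜ[A] m)
      rw [← TensorProduct.smul_tmul, TensorProduct.smul_tmul', Algebra.smul_def, smul_eq_mul])
    (fun hm => extend_mem ℬ (SetLike.one_mem_graded ℬ) hm (zero_add _))
    (fun _ => rfl)

/-- Extension of scalars is left adjoint to restriction of scalars. -/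
def extendRestrictAdj : extendScalars 𝒜 ℬ ⊣ restrictScalars 𝒜 ℬ :=
  Adjunction.mkOfUnitCounit
    { unit :=
        { app := unitHom 𝒜 ℬ
          naturality := fun _ _ _ => hom_ext (LinearMap.ext fun _ => rfl) }
      counit :=
        { app := counitHom 𝒜 ℬ
          naturality := fun N N' f => extend_hom_ext 𝒜 ℬ fun n =>
            (f.toLin.map_smul (1 : B) n).symm }
      left_triangle := by
        ext M : 2
        exact extend_hom_ext 𝒜 ℬ fun m => one_smul B ((1 : B) ⊗ₜ[A] m)
      right_triangle := by
        ext N : 2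
        exact hom_ext (LinearMap.ext fun n => one_smul B (show N.carrier from n)) }

/-- The comparison isomorphism `B ≅ B ⊗ A`. -/
def extendUnitIso : unit ℬ ≅ extend 𝒜 ℬ (unit 𝒜) :=
  mkIso (TensorProduct.AlgebraTensorModule.rid A B B).symm
    (fun {i b} hb => extend_mem ℬ hb (SetLike.one_mem_graded 𝒜) (add_zero i))
    (fun {k x} hx => by
      refine tensorDeg_induction (M := ofAlgebra 𝒜 ℬ) (N := unit 𝒜) (p := fun x =>
        TensorProduct.AlgebraTensorModule.rid A B B x ∈ ℬ k) hx
        (fun i l b hb a ha h => ?_) (by simp)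
        (fun x y hx hy => by rw [map_add]; exact add_mem hx hy)
      rw [TensorProduct.AlgebraTensorModule.rid_tmul, ← h, add_comm i, Algebra.smul_def]
      exact SetLike.mul_mem_graded (GradedAlgebraMap.map_mem ha) hb)
    (fun b => by
      change (0 : B) ⊗ₜ[A] (1 : A) = b ⊗ₜ[A] (0 : A)
      rw [TensorProduct.zero_tmul, TensorProduct.tmul_zero])

/-- The comparison map `(B ⊗ M) ⊗ (B ⊗ N) ≅ B ⊗ (M ⊗ N)`,
`(b ⊗ m) ⊗ (b' ⊗ n) ↦ b b' ⊗ (m ⊗ n)`. -/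
def extendTensorIso (M N : DGMod 𝒜) :
    tensor (extend 𝒜 ℬ M) (extend 𝒜 ℬ N) ≅ extend 𝒜 ℬ (tensor M N) :=
  mkIso (TensorProduct.AlgebraTensorModule.distribBaseChange A B M.carrier N.carrier).symm
    (fun {k x} hx => by
      refine tensorDeg_induction (M := extend 𝒜 ℬ M) (N := extend 𝒜 ℬ N) (p := fun x =>
        (TensorProduct.AlgebraTensorModule.distribBaseChange A B M.carrier N.carrier).symm x ∈
          (extend 𝒜 ℬ (tensor M N)).deg k) hx
        (fun i j x hx y hy h => ?_) (by simp)
        (fun x y hx hy => by rw [map_add]; exact add_mem hx hy)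
      refine tensorDeg_induction (M := ofAlgebra 𝒜 ℬ) (N := M) (p := fun x =>
        (TensorProduct.AlgebraTensorModule.distribBaseChange A B M.carrier N.carrier).symm
          (x ⊗ₜ[B] y) ∈ (extend 𝒜 ℬ (tensor M N)).deg k) hx
        (fun i1 i2 b hb m hm h1 => ?_) (by simp)
        (fun x y hx hy => by rw [TensorProduct.add_tmul, map_add]; exact add_mem hx hy)
      refine tensorDeg_induction (M := ofAlgebra 𝒜 ℬ) (N := N) (p := fun y =>
        (TensorProduct.AlgebraTensorModule.distribBaseChange A B M.carrier N.carrier).symm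
          ((b ⊗ₜ[A] m) ⊗ₜ[B] y) ∈ (extend 𝒜 ℬ (tensor M N)).deg k) hy
        (fun j1 j2 c hc n hn h2 => ?_) (by simp)
        (fun x y hx hy => by rw [TensorProduct.tmul_add, map_add]; exact add_mem hx hy)
      rw [TensorProduct.AlgebraTensorModule.distribBaseChange_symm_tmul]
      exact extend_mem (M := tensor M N) ℬ (SetLike.mul_mem_graded hb hc) (tmul_mem hm hn rfl)
        (by omega))
    (fun {k x} hx => by
      refine tensorDeg_induction (M := ofAlgebra 𝒜 ℬ) (N := tensor M N) (p := fun x =>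
        TensorProduct.AlgebraTensorModule.distribBaseChange A B M.carrier N.carrier x ∈
          (tensor (extend 𝒜 ℬ M) (extend 𝒜 ℬ N)).deg k) hx
        (fun i j b hb x hx h => ?_) (by simp)
        (fun x y hx hy => by rw [map_add]; exact add_mem hx hy)
      refine tensorDeg_induction (M := M) (N := N) (p := fun x =>
        TensorProduct.AlgebraTensorModule.distribBaseChange A B M.carrier N.carrier (b ⊗ₜ x) ∈
          (tensor (extend 𝒜 ℬ M) (extend 𝒜 ℬ N)).deg k) hx
        (fun i1 i2 m hm n hn h1 => ?_) (by simp)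
        (fun x y hx hy => by rw [TensorProduct.tmul_add, map_add]; exact add_mem hx hy)
      rw [TensorProduct.AlgebraTensorModule.distribBaseChange_tmul]
      exact tmul_mem (M := extend 𝒜 ℬ M) (N := extend 𝒜 ℬ N) (extend_mem ℬ hb hm rfl)
        (extend_mem ℬ (SetLike.one_mem_graded ℬ) hn rfl) (by omega))
    (fun x => by
      change (TensorProduct.AlgebraTensorModule.distribBaseChange A B M.carrier N.carrier).symm
          (tensorD (extend 𝒜 ℬ M) (extend 𝒜 ℬ N) x) = (tensorD M N).baseChange B
        ((TensorProduct.AlgebraTensorModule.distribBaseChange A B M.carrier N.carrier).symm x)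
      induction x using TensorProduct.induction_on with
      | zero => simp
      | add x y hx hy => simp only [map_add, hx, hy]
      | tmul x y =>
        induction x using TensorProduct.induction_on with
        | zero => simp
        | add x y hx hy => simp only [map_add, TensorProduct.add_tmul, hx, hy]
        | tmul b m =>
          induction y using TensorProduct.induction_on with
          | zero => simp
          | add x y hx hy => simp only [map_add, TensorProduct.tmul_add, hx, hy]
          | tmul c n =>
            change (TensorProduct.AlgebraTensorModule.distribBaseChange A B _ _).symm
                ((b ⊗ₜ[A] M.d m) ⊗ₜ[B] (c ⊗ₜ[A] n) +
                  (extend 𝒜 ℬ M).sign (b ⊗ₜ[A] m) ⊗ₜ[B] (c ⊗ₜ[A] N.d n)) = _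
            rw [extend_sign_tmul, map_add,
              TensorProduct.AlgebraTensorModule.distribBaseChange_symm_tmul,
              TensorProduct.AlgebraTensorModule.distribBaseChange_symm_tmul,
              TensorProduct.AlgebraTensorModule.distribBaseChange_symm_tmul,
              LinearMap.baseChange_tmul, tensorD_tmul, TensorProduct.tmul_add])

/-- Two morphisms out of `B ⊗ (M ⊗ N)` agree if they agree on the elements `1 ⊗ (m ⊗ n)`. -/
theorem extend_hom_ext₂ {M N : DGMod 𝒜} {P : DGMod ℬ} {f g : extend 𝒜 ℬ (tensor M N) ⟶ P}
    (h : ∀ (m : M.carrier) (n : N.carrier), f.toLin ((1 : B) ⊗ₜ[A] (m ⊗ₜ[A] n)) =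
      g.toLin ((1 : B) ⊗ₜ[A] (m ⊗ₜ[A] n))) : f = g := by
  refine extend_hom_ext 𝒜 ℬ fun x => ?_
  change M.carrier ⊗[A] N.carrier at x
  induction x using TensorProduct.induction_on with
  | zero => rw [TensorProduct.tmul_zero, map_zero, map_zero]
  | add x y hx hy => rw [TensorProduct.tmul_add, map_add, map_add, hx, hy]
  | tmul m n => exact h m n

/-- Two morphisms out of `B ⊗ ((M ⊗ N) ⊗ P)` agree if they agree on the elements
`1 ⊗ ((m ⊗ n) ⊗ p)`. -/
theorem extend_hom_ext₃ {M N P : DGMod 𝒜} {Q : DGMod ℬ}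
    {f g : extend 𝒜 ℬ (tensor (tensor M N) P) ⟶ Q}
    (h : ∀ (m : M.carrier) (n : N.carrier) (p : P.carrier),
      f.toLin ((1 : B) ⊗ₜ[A] ((m ⊗ₜ[A] n) ⊗ₜ[A] p)) =
      g.toLin ((1 : B) ⊗ₜ[A] ((m ⊗ₜ[A] n) ⊗ₜ[A] p))) : f = g := by
  refine extend_hom_ext₂ 𝒜 ℬ fun x p => ?_
  change M.carrier ⊗[A] N.carrier at x
  induction x using TensorProduct.induction_on with
  | zero => rw [TensorProduct.zero_tmul, TensorProduct.tmul_zero, map_zero, map_zero]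
  | add x y hx hy =>
    rw [TensorProduct.add_tmul, TensorProduct.tmul_add, map_add, map_add, hx, hy]
  | tmul m n => exact h m n p

/-- Extension of scalars is strong monoidal. -/
instance extendScalarsMonoidal : (extendScalars 𝒜 ℬ).Monoidal :=
  Functor.CoreMonoidal.toMonoidal
    (.mk' (F := extendScalars 𝒜 ℬ)
      (εIso := extendUnitIso 𝒜 ℬ)
      (μIso := extendTensorIso 𝒜 ℬ)
      (μIso_inv_natural_left := fun _ _ => extend_hom_ext₂ 𝒜 ℬ fun _ _ => rfl)
      (μIso_inv_natural_right := fun _ _ => extend_hom_ext₂ 𝒜 ℬ fun _ _ => rfl)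
      (oplax_associativity := fun _ _ _ => extend_hom_ext₃ 𝒜 ℬ fun _ _ _ => rfl)
      (oplax_left_unitality := fun M => extend_hom_ext 𝒜 ℬ fun m => by
        change (1 : B) ⊗ₜ[B] ((1 : B) ⊗ₜ[A] m) =
          ((1 : A) • (1 : B)) ⊗ₜ[B] ((1 : B) ⊗ₜ[A] m)
        rw [one_smul])
      (oplax_right_unitality := fun M => extend_hom_ext 𝒜 ℬ fun m => by
        change ((1 : B) ⊗ₜ[A] m) ⊗ₜ[B] (1 : B) =
          ((1 : B) ⊗ₜ[A] m) ⊗ₜ[B] ((1 : A) • (1 : B))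
        rw [one_smul]))

/-- Extension of scalars is strong symmetric monoidal. -/
instance extendScalarsBraided : (extendScalars 𝒜 ℬ).Braided where
  braided M N := by
    let f : extend 𝒜 ℬ (tensor M N) ⟶ extend 𝒜 ℬ (tensor N M) :=
      (extendScalars 𝒜 ℬ).map (braid M N).hom
    let g := (braid (extend 𝒜 ℬ M) (extend 𝒜 ℬ N)).hom
    have h : f ≫ (extendTensorIso 𝒜 ℬ N M).inv = (extendTensorIso 𝒜 ℬ M N).inv ≫ g :=
      extend_hom_ext₂ 𝒜 ℬ fun m n => by
        change TensorProduct.AlgebraTensorModule.distribBaseChange A B N.carrier M.carrier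
            ((1 : B) ⊗ₜ[A] braidLin M N (m ⊗ₜ n)) =
          braidLin (extend 𝒜 ℬ M) (extend 𝒜 ℬ N)
            (((1 : B) ⊗ₜ[A] m) ⊗ₜ[B] ((1 : B) ⊗ₜ[A] n))
        rw [braidLin_tmul, braidLin_tmul, extend_odd_tmul, extend_odd_tmul, two_smul, two_smul,
          TensorProduct.tmul_sub, TensorProduct.tmul_add, map_sub, map_add]
        rfl
    change (extendTensorIso 𝒜 ℬ M N).hom ≫ f = g ≫ (extendTensorIso 𝒜 ℬ N M).hom
    have h' : f = (extendTensorIso 𝒜 ℬ M N).inv ≫ g ≫ (extendTensorIso 𝒜 ℬ N M).hom := by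
      rw [← Category.assoc, ← h, Category.assoc, Iso.inv_hom_id, Category.comp_id]
    rw [h', Iso.hom_inv_id_assoc]

end Scalars
end DGMod

/-! ### Shifts, homology and model structures -/

namespace DGMod

section Homotopy

variable {A : Type} [CommRing A] {𝒜 : ℤ → AddSubgroup A}

/-- The reindexed decomposition used for the shift. -/
instance shiftDecomposition (M : DGMod 𝒜) (k : ℤ) :
    DirectSum.Decomposition fun i : ℤ => M.deg (i - k) :=
  DirectSum.Decomposition.ofAddHom (fun i : ℤ => M.deg (i - k))
    ((DirectSum.toAddMonoid fun j : ℤ =>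
      (DirectSum.of (fun i : ℤ => M.deg (i - k)) (j + k)).comp
        (AddSubgroup.inclusion (show M.deg j ≤ M.deg (j + k - k) by rw [add_sub_cancel_right]))).comp
      (DirectSum.decomposeAddEquiv M.deg).toAddMonoidHom)
    (AddMonoidHom.ext fun m => by
      refine M.hom_induction (p := fun m => (AddMonoidHom.comp _ _) m = AddMonoidHom.id _ m) m
        (by simp only [map_zero]) (fun j x hx => ?_) (fun x y hx hy => by simp only [map_add, hx, hy])
      have h : (DirectSum.decomposeAddEquiv M.deg).toAddMonoidHom x
        = DirectSum.of (fun i => M.deg i) j ⟨x, hx⟩ := DirectSum.decompose_of_mem _ hx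
      simp only [AddMonoidHom.comp_apply, h, DirectSum.toAddMonoid_of,
        DirectSum.coeAddMonoidHom_of]
      rfl)
    (DirectSum.addHom_ext fun i ⟨x, hx⟩ => by
      have h : (DirectSum.decomposeAddEquiv M.deg).toAddMonoidHom x
        = DirectSum.of (fun i => M.deg i) (i - k) ⟨x, hx⟩ := DirectSum.decompose_of_mem _ hx
      simp only [AddMonoidHom.comp_apply, DirectSum.coeAddMonoidHom_of, h,
        DirectSum.toAddMonoid_of, AddMonoidHom.id_apply]
      exact DFinsupp.single_eq_of_sigma_eq (Sigma.subtype_ext (sub_add_cancel i k) rfl))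

variable (𝒜) in
/-- The `k`-fold suspension `Σ^k`, for any integer `k`: `(Σ^k M)_i = M_{i-k}` with differential
`(-1)^k d`. -/
def shift (k : ℤ) : DGMod 𝒜 ⥤ DGMod 𝒜 where
  obj M :=
    { carrier := M.carrier
      deg := fun i => M.deg (i - k)
      smul_mem := fun {i j a m} ha hm => by
        have := M.smul_mem ha hm
        rwa [← add_sub_assoc] at this
      d := (k.negOnePow : ℤ) • M.d
      d_mem := fun {i m} hm => by
        have := M.d_mem hm
        rw [sub_right_comm] at this
        exact zsmul_mem this _
      d_d := fun m => by
        simp only [LinearMap.smul_apply, map_zsmul, M.d_d, smul_zero] }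
  map f :=
    { toLin := f.toLin
      map_mem := fun h => f.map_mem h
      comm := fun m => by
        change f.toLin ((k.negOnePow : ℤ) • _) = (k.negOnePow : ℤ) • _
        rw [map_zsmul, f.comm] }

/-- The homology `H_*(M) = ker d / im d`, the direct sum of the homology modules `H_i(M)`. -/
abbrev homology (M : DGMod 𝒜) : Type :=
  LinearMap.ker M.d ⧸ (LinearMap.range M.d).submoduleOf (LinearMap.ker M.d)

/-- The map induced on homology. -/
def homologyMap {M N : DGMod 𝒜} (f : M ⟶ N) : M.homology →ₗ[A] N.homology :=
  Submodule.mapQ _ _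
    (f.toLin.restrict (p := LinearMap.ker M.d) (q := LinearMap.ker N.d) fun m hm => by
      rw [LinearMap.mem_ker] at hm ⊢
      rw [← f.comm, hm, map_zero])
    (by
      rintro ⟨m, hm⟩ ⟨x, hx⟩
      exact ⟨f.toLin x, by rw [← f.comm, hx]; rfl⟩)

variable (𝒜)

/-- Quasi-isomorphisms: morphisms which induce an isomorphism on homology. -/
def quasiIso : MorphismProperty (DGMod 𝒜) := fun _ _ f => Function.Bijective (homologyMap f)

/-- Surjective morphisms. -/
def surjections : MorphismProperty (DGMod 𝒜) := fun _ _ f => Function.Surjective f.toLin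

end Homotopy
end DGMod

/-! ### Model categories, symmetric monoidal model categories and Quillen equivalences -/

section Model

universe v u v' u'

/-- Three classes of morphisms which may form a model structure. -/
structure ModelData (C : Type u) [Category.{v} C] where
  weq : MorphismProperty C
  cof : MorphismProperty C
  fib : MorphismProperty C

namespace ModelData

variable {C : Type u} [Category.{v} C] {D : Type u'} [Category.{v'} D]

/-- The three classes form a model category. -/
def IsModelCategory (S : ModelData C) : Prop :=
  ∃ M : ModelCategory C, M.categoryWithWeakEquivalences.weakEquivalences = S.weq ∧
    M.categoryWithCofibrations.cofibrations = S.cof ∧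
    M.categoryWithFibrations.fibrations = S.fib

/-- Cofibrant objects. -/
def Cofibrant (S : ModelData C) (X : C) : Prop :=
  ∀ (I : C) (hI : IsInitial I), S.cof (hI.to X)

/-- Fibrant objects. -/
def Fibrant (S : ModelData C) (X : C) : Prop :=
  ∀ (T : C) (hT : IsTerminal T), S.fib (hT.from X)

/-- Symmetric monoidal model categories: closed symmetric monoidal categories with a model
structure satisfying the pushout product axiom and the unit axiom. -/
structure IsSymmetricMonoidal [MonoidalCategory C] [SymmetricCategory C] (S : ModelData C) :
    Prop where
  isModelCategory : S.IsModelCategory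
  closed : Nonempty (MonoidalClosed C)
  pushout_product : ∀ {A B K L P : C} (i : A ⟶ B) (k : K ⟶ L), S.cof i → S.cof k →
    ∀ (inl : B ⊗ K ⟶ P) (inr : A ⊗ L ⟶ P), IsPushout (i ▷ K) (A ◁ k) inl inr →
    ∀ p : P ⟶ B ⊗ L, inl ≫ p = B ◁ k → inr ≫ p = i ▷ L →
      S.cof p ∧ (S.weq i ∨ S.weq k → S.weq p)
  unit : ∀ {Q X : C} (q : Q ⟶ 𝟙_ C), S.Cofibrant Q → S.weq q → S.Cofibrant X →
    S.weq (q ▷ X) ∧ S.weq (X ◁ q)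

/-- Quillen equivalences. -/
structure IsQuillenEquivalence (S : ModelData C) (T : ModelData D) {L : C ⥤ D} {R : D ⥤ C}
    (adj : L ⊣ R) : Prop where
  map_cof : ∀ {X Y : C} (f : X ⟶ Y), S.cof f → T.cof (L.map f)
  map_trivial_cof : ∀ {X Y : C} (f : X ⟶ Y), S.cof f → S.weq f → T.weq (L.map f)
  weq_iff : ∀ {X : C} {Y : D}, S.Cofibrant X → T.Fibrant Y → ∀ f : L.obj X ⟶ Y,
    T.weq f ↔ S.weq (adj.homEquiv X Y f)

/-- Symmetric monoidal Quillen equivalences: Quillen equivalences between symmetric monoidal model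
categories whose left adjoint is strong symmetric monoidal and preserves cofibrant replacements
of the unit. -/
structure IsSymmetricMonoidalQuillenEquivalence [MonoidalCategory C] [SymmetricCategory C]
    [MonoidalCategory D] [SymmetricCategory D] (S : ModelData C) (T : ModelData D)
    {L : C ⥤ D} {R : D ⥤ C} [L.Braided] (adj : L ⊣ R) : Prop where
  left : S.IsSymmetricMonoidal
  right : T.IsSymmetricMonoidal
  quillen : IsQuillenEquivalence S T adj
  unit : ∀ {Q : C} (q : Q ⟶ 𝟙_ C), S.Cofibrant Q → S.weq q →
    T.weq (L.map q ≫ Functor.OplaxMonoidal.η L)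

end ModelData

end Model

namespace DGMod

section Structures

variable {A : Type} [CommRing A] (𝒜 : ℤ → AddSubgroup A)

/-- The projective model structure on differential graded modules: weak equivalences are the
quasi-isomorphisms, fibrations the surjections, and cofibrations have the left lifting property
with respect to surjective quasi-isomorphisms. -/
def projective : ModelData (DGMod 𝒜) where
  weq := quasiIso 𝒜
  cof := (surjections 𝒜 ⊓ quasiIso 𝒜).llp
  fib := surjections 𝒜

/-- Graded maps in the homotopy category: `f` induces an isomorphism `[Y, Z]_* ≅ [X, Z]_*`, where
`[X, Z]_k = [Σ^k X, Z]` for `k ∈ ℤ`. -/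
def InducesIso {X Y : DGMod 𝒜} (f : X ⟶ Y) (Z : DGMod 𝒜) : Prop :=
  ∀ k : ℤ, Function.Bijective fun
    g : (quasiIso 𝒜).Q.obj ((shift 𝒜 k).obj Y) ⟶ (quasiIso 𝒜).Q.obj Z =>
      (quasiIso 𝒜).Q.map ((shift 𝒜 k).map f) ≫ g

/-- `Z` is local with respect to the class of maps `S`. (Every object is fibrant.) -/
def IsLocalObject (S : MorphismProperty (DGMod 𝒜)) (Z : DGMod 𝒜) : Prop :=
  ∀ ⦃X Y : DGMod 𝒜⦄ (s : X ⟶ Y), S s → InducesIso 𝒜 s Z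

/-- The `S`-local equivalences. -/
def localEquivalences (S : MorphismProperty (DGMod 𝒜)) : MorphismProperty (DGMod 𝒜) :=
  fun _ _ f => ∀ Z : DGMod 𝒜, IsLocalObject 𝒜 S Z → InducesIso 𝒜 f Z

/-- The left Bousfield localization of the projective model structure at a class of maps `S` which
is closed under shifts: the cofibrations are unchanged, the weak equivalences are the `S`-local
equivalences and the fibrations are defined by the right lifting property. -/
def leftBousfield (S : MorphismProperty (DGMod 𝒜)) : ModelData (DGMod 𝒜) where
  weq := localEquivalences 𝒜 S
  cof := (projective 𝒜).cof
  fib := ((projective 𝒜).cof ⊓ localEquivalences 𝒜 S).rlp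

variable {B : Type} [CommRing B] [Algebra A B] (ℬ : ℤ → AddSubgroup B)
  [GradedRing 𝒜] [EvenlyGraded 𝒜] [GradedRing ℬ] [EvenlyGraded ℬ] [GradedAlgebraMap 𝒜 ℬ]

/-- The set of all integer shifts of the structure map `A → B`. -/
def shiftsOfAlgebraMap : MorphismProperty (DGMod 𝒜) :=
  MorphismProperty.ofHoms fun k : ℤ => (shift 𝒜 k).map (algebraMapHom 𝒜 ℬ)

end Structures
end DGMod

/-! ### The rings `𝒪_ℱ` and `ℰ⁻¹𝒪_ℱ` -/

namespace EulerRings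

open LaurentPolynomial

/-- The ring `∏_{n ≥ 1} ℚ`. -/
abbrev R : Type := ℕ+ → ℚ

/-- The graded subalgebras considered below are generated by monomials. -/
theorem component_mem {s : Set R[T;T⁻¹]} (hs : ∀ x ∈ s, ∃ (k : ℤ) (r : R), x = .single k r)
    {f : R[T;T⁻¹]} (hf : f ∈ Algebra.adjoin R s) (k : ℤ) :
    (.single k (f.coeff k) : R[T;T⁻¹]) ∈ Algebra.adjoin R s := by
  have single_mem : ∀ (i : ℤ) (r : R), (.single i r : R[T;T⁻¹]) ∈ Algebra.adjoin R s → ∀ k : ℤ,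
      (.single k ((.single i r : R[T;T⁻¹]).coeff k) : R[T;T⁻¹]) ∈ Algebra.adjoin R s := by
    intro i r h k
    rw [AddMonoidAlgebra.coeff_single, Finsupp.single_apply]
    split_ifs with hik
    · rwa [← hik]
    · rw [AddMonoidAlgebra.single_zero]; exact zero_mem _
  induction hf using Algebra.adjoin_induction generalizing k with
  | mem x hx =>
    obtain ⟨i, r, rfl⟩ := hs x hx
    exact single_mem i r (Algebra.subset_adjoin hx) k
  | algebraMap r => exact single_mem 0 r (Subalgebra.algebraMap_mem _ r) k
  | add x y _ _ hx hy =>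
    rw [AddMonoidAlgebra.coeff_add, Finsupp.add_apply, AddMonoidAlgebra.single_add]
    exact add_mem (hx k) (hy k)
  | mul x y _ _ hx hy =>
    have h : x * y = ∑ i ∈ x.coeff.support, ∑ j ∈ y.coeff.support,
        (.single i (x.coeff i) : R[T;T⁻¹]) * .single j (y.coeff j) := by
      rw [← Finset.sum_mul_sum]
      congr 1
      · exact (AddMonoidAlgebra.sum_coeff_single x).symm
      · exact (AddMonoidAlgebra.sum_coeff_single y).symm
    rw [h]
    simp only [AddMonoidAlgebra.coeff_sum, Finsupp.finsetSum_apply]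
    rw [← AddMonoidAlgebra.singleAddHom_apply, map_sum]
    refine sum_mem fun i _ => ?_
    rw [map_sum]
    refine sum_mem fun j _ => ?_
    have hm := mul_mem (hx i) (hy j)
    rw [AddMonoidAlgebra.single_mul_single] at hm ⊢
    exact single_mem _ _ hm k

/-- `c`, whose component in the factor `n` is `c_n`. -/
def c : R[T;T⁻¹] := T 1

/-- The inverse of `c_n` in the factor `n`. -/
def cInv (n : ℕ+) : R[T;T⁻¹] := C (Pi.single n 1) * T (-1)

/-- The graded ring `𝒪_ℱ = ∏_{n ≥ 1} ℚ[c_n]`, with `c_n` of degree `-2`. The product is that of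
graded rings: in degree `-2k` it is `∏_{n ≥ 1} ℚ c_n^k = R c^k` for `k ≥ 0`, so that it is the
polynomial ring `R[c]`, here inside `R[c, c⁻¹]`. -/
abbrev OF : Subalgebra R R[T;T⁻¹] := Algebra.adjoin R {c}

/-- The ring `𝒪_ℱ[c_1⁻¹, …, c_m⁻¹]`. -/
abbrev OFInv (m : ℕ+) : Subalgebra R R[T;T⁻¹] := Algebra.adjoin R ({c} ∪ cInv '' {n | n ≤ m})

/-- The ring `ℰ⁻¹𝒪_ℱ = colim_m 𝒪_ℱ[c_1⁻¹, …, c_m⁻¹]`, a union of subrings. -/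
abbrev EOF : Subalgebra R R[T;T⁻¹] := ⨆ m : ℕ+, OFInv m

theorem EOF_eq : EOF = Algebra.adjoin R (⋃ m : ℕ+, ({c} ∪ cInv '' {n | n ≤ m})) :=
  (Algebra.adjoin_iUnion _).symm

theorem OF_le_EOF : OF ≤ EOF :=
  (Algebra.adjoin_mono Set.subset_union_left).trans (le_iSup OFInv 1)

/-- Subalgebras of `R[c, c⁻¹]` which contain the homogeneous components of their elements. -/
class HomogeneousSubalgebra (S : Subalgebra R R[T;T⁻¹]) : Prop where
  component_mem : ∀ f ∈ S, ∀ k : ℤ, (.single k (f.coeff k) : R[T;T⁻¹]) ∈ S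

instance : HomogeneousSubalgebra OF where
  component_mem f hf k := component_mem
    (by rintro x rfl; exact ⟨1, 1, rfl⟩) hf k

instance : HomogeneousSubalgebra EOF where
  component_mem f hf k := by
    rw [EOF_eq] at hf ⊢
    refine component_mem (fun x hx => ?_) hf k
    obtain ⟨m, rfl | ⟨n, -, rfl⟩⟩ := Set.mem_iUnion.1 hx
    · exact ⟨1, 1, rfl⟩
    · exact ⟨-1, Pi.single n 1, (single_eq_C_mul_T _ _).symm⟩

section Grading

variable (S : Subalgebra R R[T;T⁻¹])

/-- The elements of degree `i`, where `c` has degree `-2`: those for which the coefficient of `c^k`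
vanishes unless `i = -2k`. -/
def grading (i : ℤ) : @AddSubgroup S (CommRing.toRing.toAddGroupWithOne.toAddGroup) where
  carrier := {f | ∀ k : ℤ, (f : R[T;T⁻¹]).coeff k ≠ 0 → i = -2 * k}
  zero_mem' := fun k hk => absurd rfl hk
  add_mem' := fun {f g} hf hg k hk => by
    by_cases h : (f : R[T;T⁻¹]).coeff k = 0
    · refine hg k fun h' => hk ?_
      change (f : R[T;T⁻¹]).coeff k + (g : R[T;T⁻¹]).coeff k = 0
      rw [h, h', add_zero]
    · exact hf k h
  neg_mem' := fun {f} hf k hk => hf k fun h => hk (by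
    change -((f : R[T;T⁻¹]).coeff k) = 0
    rw [h, neg_zero])

variable {S}

theorem mem_grading {i : ℤ} {f : S} :
    f ∈ grading S i ↔ ∀ k : ℤ, (f : R[T;T⁻¹]).coeff k ≠ 0 → i = -2 * k := Iff.rfl

instance : SetLike.GradedMonoid (grading S) where
  one_mem k hk := by
    by_contra h
    refine hk ?_
    have : k ≠ 0 := fun h' => h (by simp [h'])
    change (AddMonoidAlgebra.coeff (1 : R[T;T⁻¹])) k = 0
    rw [← T_zero, T_apply, if_neg this.symm]
  mul_mem i j f g hf hg k hk := by
    change AddMonoidAlgebra.coeff ((f : R[T;T⁻¹]) * (g : R[T;T⁻¹])) k ≠ 0 at hk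
    have := AddMonoidAlgebra.support_coeff_mul_subset (f : R[T;T⁻¹]) (g : R[T;T⁻¹])
      (Finsupp.mem_support_iff.2 hk)
    obtain ⟨a, ha, b, hb, rfl⟩ := Finset.mem_add.1 this
    rw [hf a (Finsupp.mem_support_iff.1 ha), hg b (Finsupp.mem_support_iff.1 hb)]
    ring

instance : EvenlyGraded (grading S) where
  eq_zero_of_odd i hi f hf := by
    ext k : 2
    by_contra h
    have := hf k h
    grind

theorem grading_isInternal [HomogeneousSubalgebra S] : DirectSum.IsInternal (grading S) := by
  have key : ∀ (x : DirectSum ℤ fun i => grading S i) (k : ℤ),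
      ((DirectSum.coeAddMonoidHom (grading S) x : S) : R[T;T⁻¹]).coeff k =
        ((x (-2 * k) : S) : R[T;T⁻¹]).coeff k := by
    intro x k
    induction x using DirectSum.induction_on with
    | zero => rfl
    | of i x =>
      rw [DirectSum.coeAddMonoidHom_of]
      by_cases h : i = -2 * k
      · subst h; rw [DirectSum.of_eq_same]
      · rw [DirectSum.of_eq_of_ne _ _ _ (Ne.symm h)]
        by_contra h'
        exact h (x.2 k h')
    | add x y hx hy =>
      rw [map_add]
      exact congrArg₂ (· + ·) hx hy
  constructor
  · intro x y hxy
    refine DFinsupp.ext fun i => ?_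
    ext k : 3
    by_cases h : i = -2 * k
    · subst h; rw [← key, ← key, hxy]
    · have hx : ((x i : S) : R[T;T⁻¹]).coeff k = 0 := by
        by_contra h'; exact h ((x i).2 k h')
      have hy : ((y i : S) : R[T;T⁻¹]).coeff k = 0 := by
        by_contra h'; exact h ((y i).2 k h')
      rw [hx, hy]
  · intro f
    refine ⟨∑ k ∈ (f : R[T;T⁻¹]).coeff.support, DirectSum.of (fun i => grading S i) (-2 * k)
      ⟨⟨.single k ((f : R[T;T⁻¹]).coeff k), HomogeneousSubalgebra.component_mem _ f.2 k⟩,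
        fun l hl => ?_⟩, ?_⟩
    · change (AddMonoidAlgebra.coeff (.single k _ : R[T;T⁻¹])) l ≠ 0 at hl
      rw [AddMonoidAlgebra.coeff_single, Finsupp.single_apply] at hl
      split_ifs at hl with h
      · rw [h]
      · exact absurd rfl hl
    · rw [map_sum]
      simp only [DirectSum.coeAddMonoidHom_of]
      apply Subtype.ext
      rw [AddSubmonoidClass.coe_finsetSum]
      exact AddMonoidAlgebra.sum_coeff_single (f : R[T;T⁻¹])

instance [HomogeneousSubalgebra S] : GradedRing (grading S) where
  __ := grading_isInternal.chooseDecomposition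

end Grading

/-- The inclusion `j : 𝒪_ℱ → ℰ⁻¹𝒪_ℱ`. -/
def j : OF →+* EOF := (Subalgebra.inclusion OF_le_EOF).toRingHom

/-- `ℰ⁻¹𝒪_ℱ` as an `𝒪_ℱ`-algebra along `j`. -/
instance : Algebra OF EOF := j.toAlgebra

instance : GradedAlgebraMap (grading OF) (grading EOF) where
  map_mem h := h

end EulerRings

end

/-!
Write `A → B` for `𝒪_ℱ → ℰ⁻¹𝒪_ℱ`, with idempotents `e_n` of `A` cutting out the factors and Euler
classes `x_n = c e_n + 1 - e_n`, equal to `c_n` in the factor `n` and to `1` elsewhere. Then `B` is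
the localization of `A` at the multiplicative set `S` generated by the `x_n`.

*The projective model structure.* A surjective quasi-isomorphism is a map which lifts bounding
chains of cycles (`diskLifting_iff`). Cofibration-trivial fibration factorizations come from a
sequential colimit of cones on free modules, which kill all lifting obstructions at every stage;
no transfinite small object argument is needed. The other factorization adds the cone of the
identity of a free module. For the pushout product axiom one passes to the adjoint statement about
internal homs, `Hom(L, X) → Hom(K, X) ×_{Hom(K, Y)} Hom(L, Y)`; its lifting properties are those of
`K → L` with respect to maps between cones on shifts of `X` and `Y`. The unit axiom holds because
the unit is cofibrant.

*The local equivalences.* A map `f` is a local equivalence exactly if `B ⊗ f` is a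
quasi-isomorphism (`localEquivalences_eq`). As `B` is a localization, this condition is elementary:
`f` induces an isomorphism on homology up to `S`-torsion (`extendQuasiIso_iff`). Restrictions of
`B`-modules are local, since the adjunction passes to homotopy categories, and they detect the
maps which become quasi-isomorphisms over `B` by the Yoneda lemma. Conversely, let `Z` be local. A
homology class of `Z` is a map from a sphere, which extends uniquely to a shift of `B`; evaluating
the extension at `c_n⁻¹` shows that `c` acts bijectively on `e_n H(Z)`, so that `x_n` acts
bijectively on `H(Z)` and `Z → B ⊗ Z` is a quasi-isomorphism (`bijective_smul_of_isLocalObject`).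

*The localized model structure.* With this description, factorizations for the localization are
obtained by pulling a factorization over `B` back along the unit `Y → B ⊗ Y`
(`exists_factorization_extendModel`), and the pushout product and unit axioms, as well as the
Quillen equivalence, follow from the corresponding facts over `B`, because extension of scalars is
strong monoidal, preserves pushouts and cofibrations, and by definition preserves and detects the
weak equivalences.
-/

noncomputable section

namespace DGMod

variable {A : Type} [CommRing A] {𝒜 : ℤ → AddSubgroup A}

/-! ### Homogeneous components -/

/-- The homogeneous component of degree `i`. -/
def proj (M : DGMod 𝒜) (i : ℤ) : M.carrier →+ M.carrier :=
  (M.deg i).subtype.comp ((DFinsupp.evalAddMonoidHom i).comp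
    (DirectSum.decomposeAddEquiv M.deg).toAddMonoidHom)

theorem proj_mem (M : DGMod 𝒜) (i : ℤ) (m : M.carrier) : M.proj i m ∈ M.deg i :=
  (DirectSum.decompose M.deg m i).2

theorem proj_of_mem (M : DGMod 𝒜) {i : ℤ} {m : M.carrier} (h : m ∈ M.deg i) : M.proj i m = m :=
  DirectSum.decompose_of_mem_same _ h

theorem proj_of_mem_ne (M : DGMod 𝒜) {i j : ℤ} {m : M.carrier} (h : m ∈ M.deg i) (hij : i ≠ j) :
    M.proj j m = 0 :=
  DirectSum.decompose_of_mem_ne _ h hij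

theorem exists_sum_proj (M : DGMod 𝒜) (m : M.carrier) :
    ∃ s : Finset ℤ, ∑ i ∈ s, M.proj i m = m := by
  classical
  exact ⟨_, DirectSum.sum_support_decompose M.deg m⟩

theorem proj_hom {M N : DGMod 𝒜} (f : M ⟶ N) (i : ℤ) (m : M.carrier) :
    N.proj i (f.toLin m) = f.toLin (M.proj i m) :=
  M.hom_induction (p := fun m => N.proj i (f.toLin m) = f.toLin (M.proj i m)) m (by simp)
    (fun j x hx => by
      by_cases h : j = i
      · subst h; rw [proj_of_mem _ hx, proj_of_mem _ (f.map_mem hx)]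
      · rw [proj_of_mem_ne _ hx h, proj_of_mem_ne _ (f.map_mem hx) h, map_zero])
    (fun x y hx hy => by simp only [map_add, hx, hy])

theorem proj_d (M : DGMod 𝒜) (i : ℤ) (m : M.carrier) :
    M.proj (i - 1) (M.d m) = M.d (M.proj i m) :=
  M.hom_induction (p := fun m => M.proj (i - 1) (M.d m) = M.d (M.proj i m)) m (by simp)
    (fun j x hx => by
      by_cases h : j = i
      · subst h; rw [proj_of_mem _ hx, proj_of_mem _ (M.d_mem hx)]
      · rw [proj_of_mem_ne _ hx h, proj_of_mem_ne _ (M.d_mem hx) (by omega), map_zero])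
    (fun x y hx hy => by simp only [map_add, hx, hy])

theorem proj_smul (M : DGMod 𝒜) {i j : ℤ} {a : A} (ha : a ∈ 𝒜 i) (m : M.carrier) :
    M.proj (i + j) (a • m) = a • M.proj j m :=
  M.hom_induction (p := fun m => M.proj (i + j) (a • m) = a • M.proj j m) m (by simp)
    (fun k x hx => by
      by_cases h : k = j
      · subst h; rw [proj_of_mem _ hx, proj_of_mem _ (M.smul_mem ha hx)]
      · rw [proj_of_mem_ne _ hx h, proj_of_mem_ne _ (M.smul_mem ha hx) (by omega), smul_zero])
    (fun x y hx hy => by simp only [map_add, smul_add, hx, hy])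

theorem d_proj_eq_zero (M : DGMod 𝒜) (i : ℤ) {m : M.carrier} (h : M.d m = 0) :
    M.d (M.proj i m) = 0 := by
  rw [← proj_d, h, map_zero]

/-- A cycle is a sum of homogeneous cycles. -/
theorem cycle_induction {M : DGMod 𝒜} {p : M.carrier → Prop} (m : M.carrier) (hm : M.d m = 0)
    (h0 : p 0) (h : ∀ i, ∀ x ∈ M.deg i, M.d x = 0 → p x)
    (hadd : ∀ x y, p x → p y → p (x + y)) : p m := by
  obtain ⟨s, hs⟩ := M.exists_sum_proj m
  rw [← hs]
  exact Finset.sum_induction _ p hadd h0 fun i _ => h i _ (M.proj_mem i m) (M.d_proj_eq_zero i hm)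

/-- Independent additive subgroups which span form a decomposition. -/
@[reducible]
def decompositionOfIndep {M : Type} [AddCommGroup M] (deg : ℤ → AddSubgroup M)
    (h : ∀ x : DirectSum ℤ fun i => deg i, DirectSum.coeAddMonoidHom deg x = 0 → ∀ k, x k = 0)
    (h' : ∀ m, m ∈ ⨆ i, deg i) : DirectSum.Decomposition deg :=
  DirectSum.IsInternal.chooseDecomposition (ℳ := deg)
    ⟨(injective_iff_map_eq_zero _).2 fun x hx => DFinsupp.ext fun k => h x hx k, fun m => by
      have : ⨆ i, deg i ≤ (DirectSum.coeAddMonoidHom deg).range :=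
        iSup_le fun i m hm => ⟨DirectSum.of (fun i => deg i) i ⟨m, hm⟩,
          DirectSum.coeAddMonoidHom_of _ _ _⟩
      exact this (h' m)⟩

/-- A family of additive projections onto additive subgroups which span gives a decomposition. -/
@[reducible]
def decompositionOfProj {M : Type} [AddCommGroup M] (deg : ℤ → AddSubgroup M) (π : ℤ → M →+ M)
    (h : ∀ i, ∀ m ∈ deg i, π i m = m) (h0 : ∀ i j, ∀ m ∈ deg i, i ≠ j → π j m = 0)
    (h' : ∀ m, m ∈ ⨆ i, deg i) : DirectSum.Decomposition deg :=
  decompositionOfIndep deg (fun x hx k => by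
    have key : ∀ x : DirectSum ℤ fun i => deg i,
        π k (DirectSum.coeAddMonoidHom deg x) = (x k : M) := fun x => by
      induction x using DirectSum.induction_on with
      | zero => simp
      | of i x =>
        rw [DirectSum.coeAddMonoidHom_of]
        by_cases hik : i = k
        · subst hik; rw [h _ _ x.2, DirectSum.of_eq_same]
        · rw [h0 _ _ _ x.2 hik, DirectSum.of_eq_of_ne _ _ _ (Ne.symm hik)]; rfl
      | add x y hx hy => rw [map_add, map_add, hx, hy]; rfl
    apply Subtype.ext
    rw [← key, hx, map_zero]; rfl) h'

/-! ### Differential graded submodules and quotients -/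

/-- A submodule closed under homogeneous components and under the differential, as a differential
graded module. -/
abbrev sub (M : DGMod 𝒜) (N : Submodule A M.carrier) (hd : ∀ x ∈ N, M.d x ∈ N)
    (hp : ∀ i, ∀ x ∈ N, M.proj i x ∈ N) : DGMod 𝒜 where
  carrier := N
  deg i := (M.deg i).comap N.subtype.toAddMonoidHom
  decomposition := decompositionOfProj _
    (fun i => ((M.proj i).comp N.subtype.toAddMonoidHom).codRestrict N fun x => hp i x x.2)
    (fun i m hm => Subtype.ext (M.proj_of_mem hm))
    (fun i j m hm hij => Subtype.ext (M.proj_of_mem_ne hm hij))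
    (fun m => by
      obtain ⟨s, hs⟩ := M.exists_sum_proj m
      have : m = ∑ i ∈ s, (⟨M.proj i m, hp i m m.2⟩ : N) := by
        apply Subtype.ext; rw [AddSubmonoidClass.coe_finsetSum]; exact hs.symm
      rw [this]
      exact sum_mem fun i _ => (le_iSup (fun i => (M.deg i).comap N.subtype.toAddMonoidHom) i)
        (M.proj_mem i m))
  smul_mem ha hm := M.smul_mem ha hm
  d := M.d.restrict hd
  d_mem hm := M.d_mem hm
  d_d m := Subtype.ext (M.d_d m)

/-- The inclusion of a differential graded submodule. -/
def subι (M : DGMod 𝒜) (N : Submodule A M.carrier) (hd : ∀ x ∈ N, M.d x ∈ N)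
    (hp : ∀ i, ∀ x ∈ N, M.proj i x ∈ N) : M.sub N hd hp ⟶ M where
  toLin := N.subtype
  map_mem h := h
  comm _ := rfl

/-- The morphism into a differential graded submodule containing the image. -/
def subLift {M P : DGMod 𝒜} (N : Submodule A M.carrier) (hd : ∀ x ∈ N, M.d x ∈ N)
    (hp : ∀ i, ∀ x ∈ N, M.proj i x ∈ N) (f : P ⟶ M) (hf : ∀ x, f.toLin x ∈ N) :
    P ⟶ M.sub N hd hp where
  toLin := f.toLin.codRestrict N hf
  map_mem h := f.map_mem h
  comm m := Subtype.ext (f.comm m)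

/-- The quotient by a submodule closed under homogeneous components and the differential. -/
abbrev quot (M : DGMod 𝒜) (N : Submodule A M.carrier) (hd : ∀ x ∈ N, M.d x ∈ N)
    (hp : ∀ i, ∀ x ∈ N, M.proj i x ∈ N) : DGMod 𝒜 where
  carrier := M.carrier ⧸ N
  deg i := (M.deg i).map N.mkQ.toAddMonoidHom
  decomposition := decompositionOfProj _
    (fun i => QuotientAddGroup.map N.toAddSubgroup N.toAddSubgroup (M.proj i) (hp i))
    (by
      rintro i _ ⟨m, hm, rfl⟩
      change Submodule.Quotient.mk (p := N) (M.proj i m) = Submodule.Quotient.mk m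
      rw [M.proj_of_mem hm])
    (by
      rintro i j _ ⟨m, hm, rfl⟩ hij
      change Submodule.Quotient.mk (p := N) (M.proj j m) = 0
      rw [M.proj_of_mem_ne hm hij, Submodule.Quotient.mk_zero])
    (fun m => by
      obtain ⟨m, rfl⟩ := N.mkQ_surjective m
      obtain ⟨s, hs⟩ := M.exists_sum_proj m
      rw [← hs, map_sum]
      exact sum_mem fun i _ => (le_iSup (fun i => (M.deg i).map N.mkQ.toAddMonoidHom) i)
        ⟨_, M.proj_mem i m, rfl⟩)
  smul_mem {i j a} _ ha := by
    rintro ⟨m, hm, rfl⟩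
    exact ⟨a • m, M.smul_mem ha hm, map_smul N.mkQ a m⟩
  d := N.mapQ N M.d hd
  d_mem := by
    rintro i _ ⟨m, hm, rfl⟩
    exact ⟨M.d m, M.d_mem hm, rfl⟩
  d_d m := by
    obtain ⟨m, rfl⟩ := N.mkQ_surjective m
    change N.mkQ (M.d (M.d m)) = 0
    rw [M.d_d, map_zero]

/-- The projection to a quotient. -/
def quotπ (M : DGMod 𝒜) (N : Submodule A M.carrier) (hd : ∀ x ∈ N, M.d x ∈ N)
    (hp : ∀ i, ∀ x ∈ N, M.proj i x ∈ N) : M ⟶ M.quot N hd hp where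
  toLin := N.mkQ
  map_mem h := ⟨_, h, rfl⟩
  comm _ := rfl

/-- The morphism out of a quotient induced by a morphism which vanishes on the submodule. -/
def quotDesc {M P : DGMod 𝒜} (N : Submodule A M.carrier) (hd : ∀ x ∈ N, M.d x ∈ N)
    (hp : ∀ i, ∀ x ∈ N, M.proj i x ∈ N) (f : M ⟶ P) (hf : ∀ x ∈ N, f.toLin x = 0) :
    M.quot N hd hp ⟶ P where
  toLin := N.liftQ f.toLin hf
  map_mem := by rintro i _ ⟨m, hm, rfl⟩; exact f.map_mem hm
  comm m := by
    obtain ⟨m, rfl⟩ := N.mkQ_surjective m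
    exact f.comm m

/-! ### Products, finite limits and finite colimits -/

/-- The product, which is also the coproduct. -/
abbrev prod (M N : DGMod 𝒜) : DGMod 𝒜 where
  carrier := M.carrier × N.carrier
  deg i := (M.deg i).prod (N.deg i)
  decomposition := decompositionOfProj _ (fun i => (M.proj i).prodMap (N.proj i))
    (fun i m hm => Prod.ext (M.proj_of_mem hm.1) (N.proj_of_mem hm.2))
    (fun i j m hm hij => Prod.ext (M.proj_of_mem_ne hm.1 hij) (N.proj_of_mem_ne hm.2 hij))
    (fun ⟨m, n⟩ => by
      obtain ⟨s, hs⟩ := M.exists_sum_proj m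
      obtain ⟨t, ht⟩ := N.exists_sum_proj n
      have : (m, n) = ∑ i ∈ s, (M.proj i m, (0 : N.carrier)) +
          ∑ i ∈ t, ((0 : M.carrier), N.proj i n) := by
        ext <;> simp [Prod.fst_sum, Prod.snd_sum, hs, ht]
      rw [this]
      exact add_mem
        (sum_mem fun i _ => (le_iSup (fun i => (M.deg i).prod (N.deg i)) i)
          ⟨M.proj_mem i m, zero_mem _⟩)
        (sum_mem fun i _ => (le_iSup (fun i => (M.deg i).prod (N.deg i)) i)
          ⟨zero_mem _, N.proj_mem i n⟩))
  smul_mem ha hm := ⟨M.smul_mem ha hm.1, N.smul_mem ha hm.2⟩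
  d := M.d.prodMap N.d
  d_mem hm := ⟨M.d_mem hm.1, N.d_mem hm.2⟩
  d_d m := Prod.ext (M.d_d m.1) (N.d_d m.2)

theorem prod_proj (M N : DGMod 𝒜) (i : ℤ) (x : M.carrier × N.carrier) :
    (prod M N).proj i x = (M.proj i x.1, N.proj i x.2) := by
  let f : prod M N ⟶ M := ⟨LinearMap.fst A _ _, fun h => h.1, fun _ => rfl⟩
  let g : prod M N ⟶ N := ⟨LinearMap.snd A _ _, fun h => h.2, fun _ => rfl⟩
  exact Prod.ext (proj_hom f i x).symm (proj_hom g i x).symm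

variable (𝒜) in
/-- The zero module. -/
abbrev zero : DGMod 𝒜 where
  carrier := PUnit
  deg _ := ⊤
  decomposition := decompositionOfProj _ (fun _ => 0) (fun _ _ _ => rfl) (fun _ _ _ _ _ => rfl)
    (fun _ => (le_iSup (fun _ : ℤ => (⊤ : AddSubgroup PUnit)) 0) trivial)
  smul_mem _ _ := trivial
  d := 0
  d_mem _ := trivial
  d_d _ := rfl

/-- The zero morphism. -/
def zeroHom (M N : DGMod 𝒜) : M ⟶ N := ⟨0, fun _ => zero_mem _, fun _ => (map_zero N.d).symm⟩

variable (𝒜) in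
/-- The zero module is initial. -/
def zeroIsInitial : IsInitial (zero 𝒜) :=
  IsInitial.ofUniqueHom (fun M => zeroHom _ M) fun M f => hom_ext (LinearMap.ext fun x => by
    rw [show x = 0 from rfl, map_zero, map_zero])

variable (𝒜) in
/-- The zero module is terminal. -/
def zeroIsTerminal : IsTerminal (zero 𝒜) :=
  IsTerminal.ofUniqueHom (fun M => zeroHom M _) fun _ _ => hom_ext (LinearMap.ext fun _ => rfl)

/-- The first projection. -/
@[simps] def fst (M N : DGMod 𝒜) : prod M N ⟶ M :=
  ⟨LinearMap.fst A _ _, fun h => h.1, fun _ => rfl⟩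

/-- The second projection. -/
@[simps] def snd (M N : DGMod 𝒜) : prod M N ⟶ N :=
  ⟨LinearMap.snd A _ _, fun h => h.2, fun _ => rfl⟩

/-- The first inclusion. -/
@[simps] def inl (M N : DGMod 𝒜) : M ⟶ prod M N :=
  ⟨LinearMap.inl A _ _, fun h => ⟨h, zero_mem _⟩, fun _ => Prod.ext rfl (map_zero N.d).symm⟩

/-- The second inclusion. -/
@[simps] def inr (M N : DGMod 𝒜) : N ⟶ prod M N :=
  ⟨LinearMap.inr A _ _, fun h => ⟨zero_mem _, h⟩, fun _ => Prod.ext (map_zero M.d).symm rfl⟩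

/-- The morphism into a product with given components. -/
@[simps] def pair {M N P : DGMod 𝒜} (f : P ⟶ M) (g : P ⟶ N) : P ⟶ prod M N :=
  ⟨f.toLin.prod g.toLin, fun h => ⟨f.map_mem h, g.map_mem h⟩,
    fun m => Prod.ext (f.comm m) (g.comm m)⟩

/-- The morphism out of a coproduct with given components. -/
@[simps] def copair {M N P : DGMod 𝒜} (f : M ⟶ P) (g : N ⟶ P) : prod M N ⟶ P :=
  ⟨f.toLin.coprod g.toLin, fun h => add_mem (f.map_mem h.1) (g.map_mem h.2),
    fun m => by simp [f.comm, g.comm]⟩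

theorem inl_copair {M N P : DGMod 𝒜} (f : M ⟶ P) (g : N ⟶ P) : inl M N ≫ copair f g = f :=
  hom_ext (LinearMap.ext fun x => by simp)

theorem inr_copair {M N P : DGMod 𝒜} (f : M ⟶ P) (g : N ⟶ P) : inr M N ≫ copair f g = g :=
  hom_ext (LinearMap.ext fun x => by simp)

theorem prod_hom_ext {M N P : DGMod 𝒜} {f g : prod M N ⟶ P} (h : inl M N ≫ f = inl M N ≫ g)
    (h' : inr M N ≫ f = inr M N ≫ g) : f = g :=
  hom_ext (LinearMap.prod_ext (congrArg Hom.toLin h) (congrArg Hom.toLin h'))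

instance : HasFiniteProducts (DGMod 𝒜) :=
  have := (zeroIsTerminal 𝒜).hasTerminal
  have : HasBinaryProducts (DGMod 𝒜) := by
    refine @hasBinaryProducts_of_hasLimit_pair _ _ fun {M N} => ?_
    exact HasLimit.mk ⟨_, BinaryFan.isLimitMk (fst := fst M N) (snd := snd M N)
      (fun s => pair s.fst s.snd)
      (fun _ => rfl) (fun _ => rfl) (fun s m h h' => hom_ext (LinearMap.ext fun x =>
        Prod.ext (congrArg (fun f : s.pt ⟶ M => f.toLin x) h)
          (congrArg (fun f : s.pt ⟶ N => f.toLin x) h')))⟩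
  hasFiniteProducts_of_has_binary_and_terminal

instance : HasFiniteCoproducts (DGMod 𝒜) :=
  have := (zeroIsInitial 𝒜).hasInitial
  have : HasBinaryCoproducts (DGMod 𝒜) := by
    refine @hasBinaryCoproducts_of_hasColimit_pair _ _ fun {M N} => ?_
    exact HasColimit.mk ⟨_, BinaryCofan.isColimitMk (inl := inl M N) (inr := inr M N)
      (fun s => copair s.inl s.inr)
      (fun s => inl_copair s.inl s.inr) (fun s => inr_copair s.inl s.inr)
      (fun s m h h' => prod_hom_ext (h.trans (inl_copair s.inl s.inr).symm)
        (h'.trans (inr_copair s.inl s.inr).symm))⟩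
  hasFiniteCoproducts_of_has_binary_and_initial

instance : HasEqualizers (DGMod 𝒜) := by
  refine @hasEqualizers_of_hasLimit_parallelPair _ _ fun {M N f g} => ?_
  let K : Submodule A M.carrier := LinearMap.ker (f.toLin - g.toLin)
  have hK : ∀ x, x ∈ K ↔ f.toLin x = g.toLin x := fun x => by
    rw [LinearMap.mem_ker, LinearMap.sub_apply, sub_eq_zero]
  have hd : ∀ x ∈ K, M.d x ∈ K := fun x hx => by
    rw [hK] at hx ⊢; rw [f.comm, g.comm, hx]
  have hp : ∀ i, ∀ x ∈ K, M.proj i x ∈ K := fun i x hx => by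
    rw [hK] at hx ⊢; rw [← proj_hom, ← proj_hom, hx]
  refine HasLimit.mk ⟨Fork.ofι (subι M K hd hp)
    (hom_ext (LinearMap.ext fun x => (hK _).1 x.2)), Fork.IsLimit.mk' _ fun s => ?_⟩
  refine ⟨subLift K hd hp s.ι fun x => (hK _).2 (congrArg (fun f => Hom.toLin f x) s.condition),
    rfl, fun {m} hm => hom_ext (LinearMap.ext fun x => Subtype.ext ?_)⟩
  exact congrArg (fun f => Hom.toLin f x) hm

instance : HasCoequalizers (DGMod 𝒜) := by
  refine @hasCoequalizers_of_hasColimit_parallelPair _ _ fun {M N f g} => ?_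
  let K : Submodule A N.carrier := LinearMap.range (f.toLin - g.toLin)
  have hd : ∀ x ∈ K, N.d x ∈ K := by
    rintro _ ⟨x, rfl⟩; exact ⟨M.d x, by simp [f.comm, g.comm]⟩
  have hp : ∀ i, ∀ x ∈ K, N.proj i x ∈ K := by
    rintro i _ ⟨x, rfl⟩; exact ⟨M.proj i x, by simp [← proj_hom]⟩
  have hq : ∀ x, K.mkQ (f.toLin x) = K.mkQ (g.toLin x) := fun x => by
    rw [← sub_eq_zero, ← map_sub]
    exact (Submodule.Quotient.mk_eq_zero _).2 ⟨x, rfl⟩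
  refine HasColimit.mk ⟨Cofork.ofπ (quotπ N K hd hp)
    (hom_ext (LinearMap.ext fun x => hq x)), Cofork.IsColimit.mk' _ fun s => ?_⟩
  refine ⟨quotDesc K hd hp s.π ?_, hom_ext (LinearMap.ext fun x => rfl),
    fun {m} hm => hom_ext (LinearMap.ext fun x => ?_)⟩
  · rintro _ ⟨x, rfl⟩
    have : s.π.toLin (f.toLin x) = s.π.toLin (g.toLin x) :=
      congrArg (fun f => Hom.toLin f x) s.condition
    simp [this]
  · obtain ⟨x, rfl⟩ := K.mkQ_surjective x
    exact congrArg (fun f => Hom.toLin f x) hm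

instance : HasFiniteLimits (DGMod 𝒜) := hasFiniteLimits_of_hasEqualizers_and_finite_products

instance : HasFiniteColimits (DGMod 𝒜) :=
  hasFiniteColimits_of_hasCoequalizers_and_finite_coproducts

end DGMod

namespace DGMod

variable {A : Type} [CommRing A] {𝒜 : ℤ → AddSubgroup A}

/-! ### Quasi-isomorphisms -/

theorem homology_mk_eq_zero {M : DGMod 𝒜} {x : LinearMap.ker M.d} :
    (Submodule.Quotient.mk x : M.homology) = 0 ↔ ∃ y, M.d y = x :=
  Submodule.Quotient.mk_eq_zero _

/-- Quasi-isomorphisms in terms of cycles and boundaries. -/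
theorem quasiIso_iff {M N : DGMod 𝒜} {f : M ⟶ N} : quasiIso 𝒜 f ↔
    (∀ x, M.d x = 0 → ∀ y, f.toLin x = N.d y → ∃ x', M.d x' = x) ∧
    (∀ y, N.d y = 0 → ∃ x, M.d x = 0 ∧ ∃ y', y = f.toLin x + N.d y') := by
  refine and_congr ?_ ?_
  · refine (injective_iff_map_eq_zero (homologyMap f)).trans
      ⟨fun h x hx y hy => ?_, fun h x hx => ?_⟩
    · exact homology_mk_eq_zero.1 (h (Submodule.Quotient.mk ⟨x, hx⟩)
        (homology_mk_eq_zero.2 ⟨y, hy.symm⟩))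
    · obtain ⟨⟨x, hx'⟩, rfl⟩ := Submodule.Quotient.mk_surjective _ x
      obtain ⟨y, hy⟩ := homology_mk_eq_zero.1 hx
      exact homology_mk_eq_zero.2 (h x hx' y hy.symm)
  · refine ⟨fun h y hy => ?_, fun h y => ?_⟩
    · obtain ⟨x, hx⟩ := h (Submodule.Quotient.mk ⟨y, hy⟩)
      obtain ⟨⟨x, hx'⟩, rfl⟩ := Submodule.Quotient.mk_surjective _ x
      obtain ⟨y', h'⟩ := (Submodule.Quotient.eq _).1 hx.symm
      refine ⟨x, hx', y', ?_⟩
      change N.d y' = y - f.toLin x at h'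
      rw [h', add_sub_cancel]
    · obtain ⟨⟨y, hy⟩, rfl⟩ := Submodule.Quotient.mk_surjective _ y
      obtain ⟨x, hx, y', rfl⟩ := h y hy
      refine ⟨Submodule.Quotient.mk ⟨x, hx⟩, ((Submodule.Quotient.eq _).2 ?_).symm⟩
      exact ⟨y', (add_sub_cancel_left (f.toLin x) (N.d y')).symm⟩

variable (𝒜) in
/-- Homology, as a functor to ungraded modules. -/
def homologyFunctor : DGMod 𝒜 ⥤ ModuleCat.{0} A where
  obj M := ModuleCat.of A M.homology
  map f := ModuleCat.ofHom (homologyMap f)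
  map_id M := by
    ext
    rfl
  map_comp f g := by
    ext
    rfl

variable (𝒜) in
theorem quasiIso_eq :
    quasiIso 𝒜 = (MorphismProperty.isomorphisms (ModuleCat.{0} A)).inverseImage
      (homologyFunctor 𝒜) := by
  ext M N f
  rw [MorphismProperty.inverseImage_iff, MorphismProperty.isomorphisms.iff,
    ConcreteCategory.isIso_iff_bijective]
  rfl

instance : (quasiIso 𝒜).HasTwoOutOfThreeProperty := by rw [quasiIso_eq]; infer_instance

instance : (quasiIso 𝒜).IsStableUnderRetracts := by rw [quasiIso_eq]; infer_instance

instance : (quasiIso 𝒜).RespectsIso := by rw [quasiIso_eq]; infer_instance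

instance : (quasiIso 𝒜).IsMultiplicative := by rw [quasiIso_eq]; infer_instance

instance : (surjections 𝒜).IsStableUnderRetracts where
  of_retract {M N P Q f g} h hg y := by
    obtain ⟨x, hx⟩ := hg (h.i.right.toLin y)
    refine ⟨h.r.left.toLin x, ?_⟩
    have h1 : f.toLin (h.r.left.toLin x) = h.r.right.toLin (g.toLin x) :=
      congrArg (fun k => Hom.toLin k x) h.r.w
    have h2 : h.r.right.toLin (h.i.right.toLin y) = y :=
      congrArg (fun k => Hom.toLin k y) h.retract_right
    rw [h1, hx, h2]

instance : (surjections 𝒜).IsStableUnderComposition where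
  comp_mem _ _ hf hg := hg.comp hf

/-! ### Trivial fibrations -/

theorem exists_homogeneous_preimage {M N : DGMod 𝒜} {f : M ⟶ N}
    (hf : Function.Surjective f.toLin) {i : ℤ} {y : N.carrier} (hy : y ∈ N.deg i) :
    ∃ x ∈ M.deg i, f.toLin x = y := by
  obtain ⟨x, hx⟩ := hf y
  exact ⟨M.proj i x, M.proj_mem i x, by rw [← proj_hom, hx, proj_of_mem _ hy]⟩

theorem exists_homogeneous_d {M : DGMod 𝒜} {i : ℤ} {x y : M.carrier} (hy : y ∈ M.deg (i - 1))
    (h : M.d x = y) : ∃ x ∈ M.deg i, M.d x = y :=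
  ⟨M.proj i x, M.proj_mem i x, by rw [← proj_d, h, proj_of_mem _ hy]⟩

/-- The right lifting property with respect to the inclusions of spheres into disks: a cycle of `X`
with a bounding chain of its image in `Y` has a bounding chain in `X` which lifts it. -/
def DiskLifting {X Y : DGMod 𝒜} (p : X ⟶ Y) : Prop :=
  ∀ (i : ℤ), ∀ y ∈ Y.deg i, ∀ x ∈ X.deg (i - 1), X.d x = 0 → p.toLin x = Y.d y →
    ∃ x' ∈ X.deg i, X.d x' = x ∧ p.toLin x' = y

theorem sum_proj_of_subset (M : DGMod 𝒜) (m : M.carrier) :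
    ∃ s : Finset ℤ, ∀ t, s ⊆ t → ∑ i ∈ t, M.proj i m = m := by
  obtain ⟨s, hs⟩ := M.exists_sum_proj m
  refine ⟨s, fun t ht => ?_⟩
  rw [← Finset.sum_subset ht fun i _ hi => ?_, hs]
  rw [← hs, map_sum]
  refine Finset.sum_eq_zero fun j hj => M.proj_of_mem_ne (M.proj_mem j m) ?_
  rintro rfl
  exact hi hj

/-- The lifting property for disks extends to inhomogeneous elements. -/
theorem DiskLifting.exists_lift {X Y : DGMod 𝒜} {p : X ⟶ Y} (hp : DiskLifting p)
    {x : X.carrier} {y : Y.carrier} (hx : X.d x = 0) (h : p.toLin x = Y.d y) :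
    ∃ x', X.d x' = x ∧ p.toLin x' = y := by
  have key : ∀ i, ∃ x', X.d x' = X.proj (i - 1) x ∧ p.toLin x' = Y.proj i y := fun i => by
    obtain ⟨x', -, hx'⟩ := hp i _ (Y.proj_mem i y) _ (X.proj_mem (i - 1) x)
      (X.d_proj_eq_zero _ hx) (by rw [← proj_hom, h, proj_d])
    exact ⟨x', hx'⟩
  choose x' h1 h2 using key
  obtain ⟨s, hs⟩ := X.sum_proj_of_subset x
  obtain ⟨t, ht⟩ := Y.sum_proj_of_subset y
  refine ⟨∑ i ∈ s.image (· + 1) ∪ t, x' i, ?_, ?_⟩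
  · rw [map_sum, Finset.sum_congr rfl fun i _ => h1 i]
    have : ∑ i ∈ s.image (· + 1) ∪ t, X.proj (i - 1) x =
        ∑ i ∈ (s.image (· + 1) ∪ t).image (· - 1), X.proj i x := by
      rw [Finset.sum_image fun i _ j _ h => by simpa using h]
    rw [this]
    refine hs _ fun i hi => Finset.mem_image.2 ⟨i + 1, ?_, by simp⟩
    exact Finset.mem_union_left _ (Finset.mem_image_of_mem _ hi)
  · rw [map_sum, Finset.sum_congr rfl fun i _ => h2 i]
    exact ht _ Finset.subset_union_right

theorem DiskLifting.surjective {X Y : DGMod 𝒜} {p : X ⟶ Y} (hp : DiskLifting p) :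
    Function.Surjective p.toLin := fun y => by
  obtain ⟨x, hx, hx'⟩ := hp.exists_lift (x := 0) (y := Y.d y) (map_zero _)
    (by rw [map_zero, Y.d_d])
  obtain ⟨x', -, h⟩ := hp.exists_lift hx hx'
  exact ⟨x', h⟩

/-- The surjective quasi-isomorphisms are the morphisms with the lifting property for disks. -/
theorem diskLifting_iff {X Y : DGMod 𝒜} {p : X ⟶ Y} :
    DiskLifting p ↔ (surjections 𝒜 ⊓ quasiIso 𝒜) p := by
  constructor
  · refine fun hp => ⟨hp.surjective, quasiIso_iff.2 ⟨fun x hx y hy => ?_, fun y hy => ?_⟩⟩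
    · obtain ⟨x', h, -⟩ := hp.exists_lift hx hy
      exact ⟨x', h⟩
    · obtain ⟨x, hx, hx'⟩ := hp.exists_lift (x := 0) (y := y) (map_zero _)
        (by rw [map_zero, hy])
      exact ⟨x, hx, 0, by rw [hx', map_zero, add_zero]⟩
  · rintro ⟨hs, hq⟩ i y hy x hx hdx h
    obtain ⟨inj, surj⟩ := quasiIso_iff.1 hq
    obtain ⟨x₁, hx₁, rfl⟩ := exists_homogeneous_preimage hs hy
    -- correct `x₁` so that its differential is `x`, then by a cycle and a boundary over `Y`
    have h0 : X.d (x - X.d x₁) = 0 := by rw [map_sub, hdx, X.d_d, sub_zero]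
    obtain ⟨x₂, hx₂⟩ := inj _ h0 0 (by rw [map_sub, h, p.comm, sub_self, map_zero])
    obtain ⟨x₂, hx₂, h₂⟩ := exists_homogeneous_d (sub_mem hx (X.d_mem hx₁)) hx₂
    obtain ⟨z, hz, y', hy'⟩ := surj (p.toLin x₂) (by
      rw [← p.comm, h₂, map_sub, h, p.comm, sub_self])
    obtain ⟨x₃, rfl⟩ := hs y'
    refine ⟨X.proj i (x₁ + x₂ - z - X.d x₃), X.proj_mem _ _, ?_, ?_⟩
    · have : X.d (x₁ + x₂ - z - X.d x₃) = x := by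
        rw [map_sub, map_sub, map_add, h₂, hz, X.d_d]; abel
      rw [← proj_d, this, proj_of_mem _ hx]
    · have : p.toLin (x₁ + x₂ - z - X.d x₃) = p.toLin x₁ := by
        rw [map_sub, map_sub, map_add, hy', p.comm]; abel
      rw [← proj_hom, this, proj_of_mem _ hy]

/-! ### Mapping cones -/

/-- The mapping cone of `f : M ⟶ N`, with differential `d (m, n) = (-d m, f m + d n)`. -/
abbrev cone {M N : DGMod 𝒜} (f : M ⟶ N) : DGMod 𝒜 where
  carrier := M.carrier × N.carrier
  deg i := (M.deg (i - 1)).prod (N.deg i)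
  decomposition := (prod ((shift 𝒜 1).obj M) N).decomposition
  smul_mem {i j a m} ha hm := (prod ((shift 𝒜 1).obj M) N).smul_mem ha hm
  d := (-(M.d ∘ₗ LinearMap.fst A _ _)).prod (f.toLin.coprod N.d)
  d_mem hm := ⟨(M.deg _).neg_mem (M.d_mem hm.1), add_mem (f.map_mem hm.1) (N.d_mem hm.2)⟩
  d_d m := by
    ext <;> simp [M.d_d, N.d_d, f.comm]

theorem cone_d {M N : DGMod 𝒜} (f : M ⟶ N) (x : M.carrier × N.carrier) :
    (cone f).d x = (-M.d x.1, f.toLin x.1 + N.d x.2) := rfl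

/-- The inclusion of the target into the mapping cone. -/
def coneInr {M N : DGMod 𝒜} (f : M ⟶ N) : N ⟶ cone f where
  toLin := LinearMap.inr A _ _
  map_mem h := ⟨zero_mem _, h⟩
  comm n := by rw [cone_d]; ext <;> simp

/-- A morphism into a mapping cone consists of a map of degree `-1` anticommuting with the
differentials and a map of degree `0`. -/
def coneLift {L M N : DGMod 𝒜} (f : M ⟶ N) (v : L.carrier →ₗ[A] M.carrier)
    (w : L.carrier →ₗ[A] N.carrier) (hv : ∀ {i l}, l ∈ L.deg i → v l ∈ M.deg (i - 1))
    (hw : ∀ {i l}, l ∈ L.deg i → w l ∈ N.deg i) (hvd : ∀ l, v (L.d l) = -M.d (v l))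
    (hwd : ∀ l, w (L.d l) = f.toLin (v l) + N.d (w l)) : L ⟶ cone f where
  toLin := v.prod w
  map_mem h := ⟨hv h, hw h⟩
  comm l := Prod.ext (hvd l) (hwd l)

/-- The morphism of mapping cones induced by a commutative square. -/
def coneMap {M N M' N' : DGMod 𝒜} {f : M ⟶ N} {f' : M' ⟶ N'} (a : M ⟶ M') (b : N ⟶ N')
    (h : f ≫ b = a ≫ f') : cone f ⟶ cone f' where
  toLin := a.toLin.prodMap b.toLin
  map_mem h := ⟨a.map_mem h.1, b.map_mem h.2⟩
  comm x := by
    have h' : b.toLin (f.toLin x.1) = f'.toLin (a.toLin x.1) :=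
      congrArg (fun k => Hom.toLin k x.1) h
    ext
    · simp [a.comm]
    · simp [b.comm, h']

/-- For a surjective quasi-isomorphism `p`, so is the map from the cone of the identity to the
cone of `p`. -/
theorem diskLifting_coneMap {X Y : DGMod 𝒜} {p : X ⟶ Y} (hp : DiskLifting p) :
    DiskLifting (coneMap (f := 𝟙 X) (f' := p) (𝟙 X) p rfl) := by
  rintro i ⟨a, y⟩ ⟨ha, hy⟩ ⟨a', x⟩ ⟨-, hx⟩ h0 h
  have h1 : a' = -X.d a := congrArg Prod.fst h
  have h2 : p.toLin x = p.toLin a + Y.d y := congrArg Prod.snd h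
  have h3 : a' + X.d x = 0 := congrArg Prod.snd h0
  obtain ⟨x', hx', h4, h5⟩ := hp i y hy (x - a) (sub_mem hx ha)
    (by rw [map_sub, sub_eq_add_neg, ← h1, add_comm, h3]) (by rw [map_sub, h2]; abel)
  exact ⟨(a, x'), ⟨ha, hx'⟩, Prod.ext h1.symm (by simp [h4]), Prod.ext rfl h5⟩

/-- Cones of identities are contractible, so a surjection induces a surjective quasi-isomorphism
between them. -/
theorem diskLifting_coneMap_id {X Y : DGMod 𝒜} {p : X ⟶ Y} (hp : Function.Surjective p.toLin) :
    DiskLifting (coneMap (f := 𝟙 X) (f' := 𝟙 Y) p p (Category.comp_id p).symm) := by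
  rintro i ⟨a, b⟩ ⟨ha, hb⟩ ⟨a', x⟩ ⟨-, hx⟩ h0 h
  have h2 : p.toLin x = a + Y.d b := congrArg Prod.snd h
  have h3 : a' + X.d x = 0 := congrArg Prod.snd h0
  obtain ⟨b', hb', rfl⟩ := exists_homogeneous_preimage hp hb
  refine ⟨(x - X.d b', b'), ⟨(X.deg _).sub_mem hx (X.d_mem hb'), hb'⟩,
    Prod.ext ?_ ?_, Prod.ext ?_ rfl⟩
  · simp [X.d_d, ← eq_neg_of_add_eq_zero_left h3]
  · simp
  · change p.toLin (x - X.d b') = a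
    rw [map_sub, h2, p.comm, add_sub_cancel_right]

/-! ### Free modules -/

section Free

variable [GradedRing 𝒜]

variable (𝒜) in
/-- The free graded module on generators `i` of degree `δ i`, with zero differential. -/
abbrev free {I : Type} (δ : I → ℤ) : DGMod 𝒜 where
  carrier := I →₀ A
  deg k :=
    { carrier := {φ | ∀ i, φ i ∈ 𝒜 (k - δ i)}
      zero_mem' := fun _ => zero_mem _
      add_mem' := fun h h' i => add_mem (h i) (h' i)
      neg_mem' := fun h i => neg_mem (h i) }
  decomposition :=
    have key : ∀ (k : ℤ) (φ : I →₀ A) (i : I), (Finsupp.liftAddHom fun i =>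
        (Finsupp.singleAddHom i).comp ((unit 𝒜).proj (k - δ i))) φ i =
          (unit 𝒜).proj (k - δ i) (φ i) := fun k φ i => by
      induction φ using Finsupp.induction_linear with
      | zero => simp
      | add φ ψ h h' => rw [map_add, Finsupp.add_apply, h, h', Finsupp.add_apply, map_add]
      | single j a =>
        classical
        rw [Finsupp.liftAddHom_apply_single]
        change Finsupp.single j ((unit 𝒜).proj (k - δ j) a) i = _
        rw [Finsupp.single_apply, Finsupp.single_apply]
        split_ifs with h
        · rw [h]
        · rw [map_zero]
    decompositionOfProj _ (fun k => Finsupp.liftAddHom fun i =>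
        (Finsupp.singleAddHom i).comp ((unit 𝒜).proj (k - δ i)))
      (fun k φ hφ => Finsupp.ext fun i => by rw [key]; exact (unit 𝒜).proj_of_mem (hφ i))
      (fun k l φ hφ hkl => Finsupp.ext fun i => by
        rw [key]; exact (unit 𝒜).proj_of_mem_ne (hφ i) (by omega))
      (fun φ => by
        induction φ using Finsupp.induction_linear with
        | zero => exact zero_mem _
        | add φ ψ h h' => exact add_mem h h'
        | single i a =>
          classical
          obtain ⟨s, hs⟩ := (unit 𝒜).exists_sum_proj a
          rw [← hs, ← Finsupp.singleAddHom_apply, map_sum]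
          refine sum_mem fun k _ => AddSubgroup.mem_iSup_of_mem (k + δ i) fun j => ?_
          rw [Finsupp.singleAddHom_apply, Finsupp.single_apply]
          split_ifs with h
          · subst h; rw [add_sub_cancel_right]; exact (unit 𝒜).proj_mem k a
          · exact zero_mem _)
  smul_mem {k l a φ} ha hφ i := by
    rw [add_sub_assoc]; exact SetLike.mul_mem_graded ha (hφ i)
  d := 0
  d_mem _ := zero_mem _
  d_d _ := rfl

theorem free_single_mem {I : Type} (δ : I → ℤ) (i : I) {k : ℤ} (h : δ i = k) :
    Finsupp.single i (1 : A) ∈ (free 𝒜 δ).deg k := fun j => by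
  classical
  rw [Finsupp.single_apply]
  split_ifs with hij
  · subst hij; rw [← h, sub_self]; exact SetLike.one_mem_graded 𝒜
  · exact zero_mem _

theorem free_linearCombination_mem {I : Type} {δ : I → ℤ} {M : DGMod 𝒜} {w : I → M.carrier}
    {e k l : ℤ} (hw : ∀ i, w i ∈ M.deg (δ i + e)) {φ : I →₀ A} (hφ : φ ∈ (free 𝒜 δ).deg k)
    (h : k + e = l) : Finsupp.linearCombination A w φ ∈ M.deg l := by
  refine sum_mem fun i _ => ?_
  have := M.smul_mem (hφ i) (hw i)
  rwa [show k - δ i + (δ i + e) = l by omega] at this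

/-- The morphism out of a free module given by cycles. -/
def freeDesc {I : Type} {δ : I → ℤ} {M : DGMod 𝒜} (w : I → M.carrier)
    (hw : ∀ i, w i ∈ M.deg (δ i)) (hd : ∀ i, M.d (w i) = 0) : free 𝒜 δ ⟶ M where
  toLin := Finsupp.linearCombination A w
  map_mem h := free_linearCombination_mem (e := 0) (by simpa using hw) h (add_zero _)
  comm φ := by
    rw [LinearMap.zero_apply, map_zero, Finsupp.linearCombination_apply, Finsupp.sum, map_sum]
    exact (Finset.sum_eq_zero fun i _ => by rw [map_smul, hd, smul_zero]).symm

/-- Attaching free cells to `X` is a cofibration. -/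
theorem coneInr_llp {I : Type} {δ : I → ℤ} {X : DGMod 𝒜} (a : free 𝒜 δ ⟶ X) :
    (surjections 𝒜 ⊓ quasiIso 𝒜).llp (coneInr a) := by
  intro W Z p hp
  rw [← diskLifting_iff] at hp
  refine ⟨fun {u v} sq => ?_⟩
  have hsq : ∀ x, p.toLin (u.toLin x) = v.toLin (0, x) := fun x =>
    congrArg (fun k => Hom.toLin k x) sq.w
  -- the boundary of the `i`-th cell, and the cell itself
  let b : I → X.carrier := fun i => a.toLin (Finsupp.single i 1)
  have hb : ∀ i, b i ∈ X.deg (δ i) := fun i => a.map_mem (free_single_mem δ i rfl)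
  have hdb : ∀ i, X.d (b i) = 0 := fun i => by
    rw [← a.comm]; exact map_zero _
  have key : ∀ i, ∃ w ∈ W.deg (δ i + 1), W.d w = u.toLin (b i) ∧
      p.toLin w = v.toLin (Finsupp.single i 1, 0) := fun i => by
    have hmem : (Finsupp.single i (1 : A), (0 : X.carrier)) ∈ (cone a).deg (δ i + 1) :=
      ⟨free_single_mem δ i (by simp), zero_mem _⟩
    refine hp _ _ (v.map_mem hmem) _ (by simpa using u.map_mem (hb i)) ?_ ?_
    · rw [← u.comm, hdb, map_zero]
    · rw [hsq, ← v.comm, cone_d]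
      congr 1
      ext : 1
      · exact neg_zero.symm
      · simp [b]
  choose w hw hw1 hw2 using key
  have hd : ∀ φ, W.d (Finsupp.linearCombination A w φ) = u.toLin (a.toLin φ) := fun φ => by
    have : W.d ∘ₗ Finsupp.linearCombination A w = u.toLin ∘ₗ a.toLin := by
      ext i; simp [hw1, b]
    exact congrArg (fun k => k φ) this
  have hp : ∀ φ, p.toLin (Finsupp.linearCombination A w φ) = v.toLin (φ, 0) := fun φ => by
    have : p.toLin ∘ₗ Finsupp.linearCombination A w = v.toLin ∘ₗ LinearMap.inl A _ _ := by
      ext i; simp [hw2]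
    exact congrArg (fun k => k φ) this
  refine ⟨⟨⟨⟨(Finsupp.linearCombination A w).coprod u.toLin, fun {k x} hx => ?_, fun x => ?_⟩,
    ?_, ?_⟩⟩⟩
  · exact add_mem (free_linearCombination_mem hw hx.1 (by ring)) (u.map_mem hx.2)
  · change Finsupp.linearCombination A w (-0) + u.toLin (a.toLin x.1 + X.d x.2) =
      W.d (Finsupp.linearCombination A w x.1 + u.toLin x.2)
    rw [neg_zero, map_zero, zero_add, map_add, map_add, hd, u.comm]
  · refine hom_ext (LinearMap.ext fun x => ?_)
    change Finsupp.linearCombination A w 0 + u.toLin x = u.toLin x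
    rw [map_zero, zero_add]
  · refine hom_ext (LinearMap.ext fun x => ?_)
    change p.toLin (Finsupp.linearCombination A w x.1 + u.toLin x.2) = v.toLin x
    rw [map_add, hp, hsq, ← map_add]
    simp

/-- Adding free contractible summands to `X` gives a morphism with the left lifting property with
respect to surjections. -/
theorem inl_cone_free_llp {I : Type} (δ : I → ℤ) (X : DGMod 𝒜) :
    (surjections 𝒜).llp (inl X (cone (𝟙 (free 𝒜 δ)))) := by
  intro W Z p hp
  refine ⟨fun {u v} sq => ?_⟩
  have hsq : ∀ x, p.toLin (u.toLin x) = v.toLin (x, 0) := fun x =>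
    congrArg (fun k => Hom.toLin k x) sq.w
  have key : ∀ i, ∃ w ∈ W.deg (δ i + 1), p.toLin w = v.toLin (0, Finsupp.single i 1, 0) :=
    fun i => exists_homogeneous_preimage hp (v.map_mem
      ⟨zero_mem _, free_single_mem δ i (by simp), zero_mem _⟩)
  choose w hw hwp using key
  let f := Finsupp.linearCombination A w
  have hf : ∀ φ, p.toLin (f φ) = v.toLin (0, φ, 0) := fun φ => by
    have : p.toLin ∘ₗ f = v.toLin ∘ₗ LinearMap.inr A _ _ ∘ₗ LinearMap.inl A _ _ := by
      ext i; simp [f, hwp]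
    exact congrArg (fun k => k φ) this
  have hf' : ∀ φ, p.toLin (W.d (f φ)) = v.toLin (0, 0, φ) := fun φ => by
    rw [p.comm, hf, ← v.comm]
    congr 1
    change (X.d 0, -(0 : I →₀ A), φ + 0) = _
    simp
  refine ⟨⟨⟨⟨u.toLin.coprod (f.coprod (W.d ∘ₗ f)), fun {k x} hx => ?_, fun x => ?_⟩, ?_, ?_⟩⟩⟩
  · refine add_mem (u.map_mem hx.1) (add_mem ?_ ?_)
    · exact free_linearCombination_mem hw hx.2.1 (by ring)
    · have := W.d_mem (free_linearCombination_mem hw hx.2.2 rfl)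
      rwa [add_sub_cancel_right] at this
  · change u.toLin (X.d x.1) + (f (-0) + W.d (f (x.2.1 + 0))) =
      W.d (u.toLin x.1 + (f x.2.1 + W.d (f x.2.2)))
    simp [u.comm, W.d_d]
  · refine hom_ext (LinearMap.ext fun x => ?_)
    change u.toLin x + (f 0 + W.d (f 0)) = u.toLin x
    simp
  · refine hom_ext (LinearMap.ext fun x => ?_)
    change p.toLin (u.toLin x.1 + (f x.2.1 + W.d (f x.2.2))) = v.toLin x
    rw [map_add, map_add, hf, hf', hsq, ← map_add, ← map_add]
    simp

end Free

end DGMod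

namespace DGMod

variable {A : Type} [CommRing A] {𝒜 : ℤ → AddSubgroup A}

/-! ### Sequential colimits -/

section SeqColim

variable (F : ℕ ⥤ DGMod 𝒜)

/-- The transition maps of a sequence, as linear maps. -/
def seqMap (i j : ℕ) (h : i ≤ j) : (F.obj i).carrier →ₗ[A] (F.obj j).carrier :=
  (F.map (homOfLE h)).toLin

instance seqDirected : DirectedSystem (fun n => (F.obj n).carrier) (seqMap F · · ·) where
  map_self i x := by
    change (F.map (𝟙 i)).toLin x = x
    rw [F.map_id]; rfl
  map_map i j k hij hjk x := by
    change (F.map (homOfLE hij) ≫ F.map (homOfLE hjk)).toLin x = _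
    rw [← F.map_comp]; rfl

/-- The underlying module of the colimit of a sequence. -/
abbrev SeqCarrier : Type := Module.DirectLimit (fun n => (F.obj n).carrier) (seqMap F)

/-- The map from the `n`-th term to the colimit. -/
def seqOf (n : ℕ) : (F.obj n).carrier →ₗ[A] SeqCarrier F :=
  Module.DirectLimit.of A ℕ (fun n => (F.obj n).carrier) (seqMap F) n

theorem seqOf_map {i j : ℕ} (h : i ≤ j) (x : (F.obj i).carrier) :
    seqOf F j ((F.map (homOfLE h)).toLin x) = seqOf F i x :=
  Module.DirectLimit.of_f (f := seqMap F) (hij := h)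

theorem seqOf_eq_zero {i : ℕ} {x : (F.obj i).carrier} (h : seqOf F i x = 0) :
    ∃ (j : ℕ) (hij : i ≤ j), (F.map (homOfLE hij)).toLin x = 0 :=
  Module.DirectLimit.of.zero_exact h

theorem exists_seqOf (z : SeqCarrier F) : ∃ i x, seqOf F i x = z :=
  Module.DirectLimit.exists_of z

/-- The homogeneous elements of the colimit. -/
def seqDeg (k : ℤ) : AddSubgroup (SeqCarrier F) where
  carrier := {z | ∃ i, ∃ x ∈ (F.obj i).deg k, seqOf F i x = z}
  zero_mem' := ⟨0, 0, zero_mem _, map_zero _⟩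
  add_mem' := by
    rintro _ _ ⟨i, x, hx, rfl⟩ ⟨j, y, hy, rfl⟩
    refine ⟨max i j, _, add_mem ((F.map (homOfLE (le_max_left i j))).map_mem hx)
      ((F.map (homOfLE (le_max_right i j))).map_mem hy), ?_⟩
    rw [map_add, seqOf_map, seqOf_map]
  neg_mem' := by
    rintro _ ⟨i, x, hx, rfl⟩
    exact ⟨i, -x, neg_mem hx, map_neg _ _⟩

/-- A finite family of homogeneous elements of the colimit comes from a single stage. -/
theorem exists_seqOf_family (x : DirectSum ℤ fun k => seqDeg F k) :
    ∃ i, ∃ z : (F.obj i).carrier, ∀ k, seqOf F i ((F.obj i).proj k z) = (x k : SeqCarrier F) := by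
  induction x using DirectSum.induction_on with
  | zero => exact ⟨0, 0, fun k => by simp⟩
  | of k x =>
    obtain ⟨_, i, z, hz, rfl⟩ := x
    refine ⟨i, z, fun l => ?_⟩
    by_cases h : k = l
    · subst h; rw [proj_of_mem _ hz, DirectSum.of_eq_same]
    · rw [proj_of_mem_ne _ hz h, map_zero, DirectSum.of_eq_of_ne _ _ _ (Ne.symm h)]; rfl
  | add x y hx hy =>
    obtain ⟨i, z, hz⟩ := hx
    obtain ⟨j, w, hw⟩ := hy
    refine ⟨max i j, (F.map (homOfLE (le_max_left i j))).toLin z +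
      (F.map (homOfLE (le_max_right i j))).toLin w, fun k => ?_⟩
    rw [map_add, proj_hom, proj_hom, map_add, seqOf_map, seqOf_map, hz, hw]
    rfl

/-- The differential of the colimit. -/
def seqD : SeqCarrier F →ₗ[A] SeqCarrier F :=
  Module.DirectLimit.map (fun n => (F.obj n).d) fun _ _ h =>
    LinearMap.ext fun x => ((F.map (homOfLE h)).comm x).symm

theorem seqD_seqOf (i : ℕ) (x : (F.obj i).carrier) :
    seqD F (seqOf F i x) = seqOf F i ((F.obj i).d x) :=
  Module.DirectLimit.map_apply_of (fun n => (F.obj n).d) _ x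

/-- The colimit of a sequence of differential graded modules. -/
abbrev seqColim : DGMod 𝒜 where
  carrier := SeqCarrier F
  deg := seqDeg F
  decomposition := decompositionOfIndep _ (fun x hx k => by
      obtain ⟨i, z, hz⟩ := exists_seqOf_family F x
      have hx' : seqOf F i z = 0 := by
        classical
        obtain ⟨s, hs⟩ := (F.obj i).sum_proj_of_subset z
        rw [← hs (s ∪ x.support) Finset.subset_union_left, map_sum,
          Finset.sum_congr rfl fun k _ => hz k, ← hx, DirectSum.coeAddMonoidHom_eq_dfinsuppSum]
        exact (DFinsupp.sum_of_support_subset (f := x) Finset.subset_union_right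
          (g := fun k (z : seqDeg F k) => (z : SeqCarrier F)) (fun _ _ => rfl)).symm
      obtain ⟨j, hij, h⟩ := seqOf_eq_zero F hx'
      apply Subtype.ext
      rw [← hz, ← seqOf_map F hij, ← proj_hom, h, map_zero, map_zero]
      rfl)
    (fun z => by
      obtain ⟨i, x, rfl⟩ := exists_seqOf F z
      obtain ⟨s, hs⟩ := (F.obj i).exists_sum_proj x
      rw [← hs, map_sum]
      exact sum_mem fun k _ => AddSubgroup.mem_iSup_of_mem k ⟨i, _, (F.obj i).proj_mem k x, rfl⟩)
  smul_mem := by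
    rintro i j a _ ha ⟨n, x, hx, rfl⟩
    exact ⟨n, a • x, (F.obj n).smul_mem ha hx, map_smul _ _ _⟩
  d := seqD F
  d_mem := by
    rintro i _ ⟨n, x, hx, rfl⟩
    exact ⟨n, _, (F.obj n).d_mem hx, (seqD_seqOf F n x).symm⟩
  d_d z := by
    obtain ⟨i, x, rfl⟩ := exists_seqOf F z
    rw [seqD_seqOf, seqD_seqOf, (F.obj i).d_d, map_zero]

/-- The morphism from the `n`-th term to the colimit. -/
def seqι (n : ℕ) : F.obj n ⟶ seqColim F where
  toLin := seqOf F n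
  map_mem h := ⟨n, _, h, rfl⟩
  comm x := (seqD_seqOf F n x).symm

variable {F}

theorem seqMap_comp {W : DGMod 𝒜} (g : ∀ n, F.obj n ⟶ W)
    (hg : ∀ n, F.map (homOfLE (Nat.le_add_right n 1)) ≫ g (n + 1) = g n) (i j : ℕ) (h : i ≤ j)
    (x : (F.obj i).carrier) : (g j).toLin (seqMap F i j h x) = (g i).toLin x := by
  have : F.map (homOfLE h) ≫ g j = g i := by
    induction j, h using Nat.le_induction with
    | base => rw [show homOfLE (le_refl i) = 𝟙 i from rfl, F.map_id, Category.id_comp]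
    | succ j hij ih =>
      rw [← ih, ← hg j, ← Category.assoc, ← F.map_comp]; rfl
  exact congrArg (fun k => Hom.toLin k x) this

/-- The morphism out of the colimit given by a compatible family. -/
def seqDesc {W : DGMod 𝒜} (g : ∀ n, F.obj n ⟶ W)
    (hg : ∀ n, F.map (homOfLE (Nat.le_add_right n 1)) ≫ g (n + 1) = g n) : seqColim F ⟶ W where
  toLin := Module.DirectLimit.lift A ℕ _ (seqMap F) (fun n => (g n).toLin) (seqMap_comp g hg)
  map_mem := by
    rintro k _ ⟨i, x, hx, rfl⟩
    rw [seqOf, Module.DirectLimit.lift_of]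
    exact (g i).map_mem hx
  comm z := by
    obtain ⟨i, x, rfl⟩ := exists_seqOf F z
    rw [seqD_seqOf, seqOf, Module.DirectLimit.lift_of, Module.DirectLimit.lift_of, (g i).comm]

theorem seqι_desc {W : DGMod 𝒜} (g : ∀ n, F.obj n ⟶ W)
    (hg : ∀ n, F.map (homOfLE (Nat.le_add_right n 1)) ≫ g (n + 1) = g n) (n : ℕ) :
    seqι F n ≫ seqDesc g hg = g n :=
  hom_ext (LinearMap.ext fun x =>
    Module.DirectLimit.lift_of (fun n => (g n).toLin) (seqMap_comp g hg) x)

theorem seqColim_hom_ext {W : DGMod 𝒜} {f g : seqColim F ⟶ W}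
    (h : ∀ n, seqι F n ≫ f = seqι F n ≫ g) : f = g :=
  hom_ext (LinearMap.ext fun z => by
    obtain ⟨i, x, rfl⟩ := exists_seqOf F z
    exact congrArg (fun k => Hom.toLin k x) (h i))

/-- A left lifting property of the transition maps is inherited by the inclusion of the first term
into the colimit. -/
theorem seqι_zero_llp {P : MorphismProperty (DGMod 𝒜)}
    (h : ∀ n, P.llp (F.map (homOfLE (Nat.le_add_right n 1)))) : P.llp (seqι F 0) := by
  intro W Z p hp
  refine ⟨fun {u v} sq => ?_⟩
  have hι : ∀ n, F.map (homOfLE (Nat.le_add_right n 1)) ≫ seqι F (n + 1) = seqι F n := fun n =>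
    hom_ext (LinearMap.ext fun x => seqOf_map F _ x)
  have step : ∀ n (g : {g : F.obj n ⟶ W // g ≫ p = seqι F n ≫ v}),
      ∃ g' : F.obj (n + 1) ⟶ W, F.map (homOfLE (Nat.le_add_right n 1)) ≫ g' = g.1 ∧
        g' ≫ p = seqι F (n + 1) ≫ v := fun n g => by
    have := h n p hp
    have sq' : CommSq g.1 (F.map (homOfLE (Nat.le_add_right n 1))) p (seqι F (n + 1) ≫ v) :=
      ⟨by rw [g.2, ← Category.assoc, hι]⟩
    exact ⟨sq'.lift, sq'.fac_left, sq'.fac_right⟩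
  choose next h1 h2 using step
  let g : ∀ n, {g : F.obj n ⟶ W // g ≫ p = seqι F n ≫ v} := fun n =>
    Nat.rec ⟨u, sq.w⟩ (fun n g => ⟨next n g, h2 n g⟩) n
  refine ⟨⟨⟨seqDesc (fun n => (g n).1) fun n => h1 n (g n), ?_, ?_⟩⟩⟩
  · exact seqι_desc (fun n => (g n).1) _ 0
  · refine seqColim_hom_ext fun n => ?_
    rw [← Category.assoc, seqι_desc]
    exact (g n).2

end SeqColim

/-! ### Factorizations -/

section Factorization

/-- The inclusion of a summand with contractible complement is a quasi-isomorphism. -/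
theorem quasiIso_inl_cone_id (X F : DGMod 𝒜) : quasiIso 𝒜 (inl X (cone (𝟙 F))) := by
  refine quasiIso_iff.2 ⟨fun x _ y hy => ⟨y.1, (congrArg Prod.fst hy).symm⟩, ?_⟩
  rintro ⟨x, a, b⟩ h
  have h1 : X.d x = 0 := congrArg Prod.fst h
  have h2 : a + F.d b = 0 := congrArg (fun z => z.2.2) h
  refine ⟨x, h1, (0, b, 0), ?_⟩
  change (x, a, b) = (x + X.d 0, 0 + -F.d b, 0 + (b + F.d 0))
  simp [eq_neg_of_add_eq_zero_left h2]

variable [GradedRing 𝒜]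

section Step

variable {X Y : DGMod 𝒜} (f : X ⟶ Y)

/-- The homogeneous cycles of `X` with a bounding chain of their image in `Y`. -/
structure SphereIndex : Type where
  degree : ℤ
  cycle : X.carrier
  chain : Y.carrier
  cycle_mem : cycle ∈ X.deg (degree - 1)
  chain_mem : chain ∈ Y.deg degree
  d_cycle : X.d cycle = 0
  d_chain : f.toLin cycle = Y.d chain

/-- The attaching map for the cells which bound all homogeneous cycles whose image is bounded. -/
def attach : free 𝒜 (fun i : SphereIndex f => i.degree - 1) ⟶ X :=
  freeDesc SphereIndex.cycle SphereIndex.cycle_mem SphereIndex.d_cycle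

/-- The extension of `f` over the attached cells. -/
def attachDesc : cone (attach f) ⟶ Y where
  toLin := (Finsupp.linearCombination A SphereIndex.chain).coprod f.toLin
  map_mem h := add_mem (free_linearCombination_mem (δ := fun i : SphereIndex f => i.degree - 1)
    (e := 1) (fun i => by simpa using i.chain_mem) h.1 (by ring)) (f.map_mem h.2)
  comm x := by
    have : Y.d ∘ₗ Finsupp.linearCombination A SphereIndex.chain =
        f.toLin ∘ₗ (attach f).toLin := by
      ext i; simp [attach, freeDesc, i.d_chain]
    have hx : Y.d (Finsupp.linearCombination A SphereIndex.chain x.1) =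
      f.toLin ((attach f).toLin x.1) := congrArg (fun k => k x.1) this
    change Finsupp.linearCombination A (SphereIndex.chain (f := f)) (-0) +
      f.toLin ((attach f).toLin x.1 + X.d x.2) =
        Y.d (Finsupp.linearCombination A SphereIndex.chain x.1 + f.toLin x.2)
    rw [neg_zero, map_zero, zero_add, map_add, map_add, hx, f.comm]

theorem coneInr_attachDesc : coneInr (attach f) ≫ attachDesc f = f :=
  hom_ext (LinearMap.ext fun x => by
    change Finsupp.linearCombination A (SphereIndex.chain (f := f)) 0 + f.toLin x = f.toLin x
    rw [map_zero, zero_add])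

/-- The sequence obtained from `f` by attaching cells repeatedly. -/
def tower (f : X ⟶ Y) : ℕ → Σ Z : DGMod 𝒜, (Z ⟶ Y)
  | 0 => ⟨X, f⟩
  | n + 1 => ⟨_, attachDesc (tower f n).2⟩

/-- The sequence obtained from `f` by attaching cells repeatedly, as a functor. -/
def towerFunctor : ℕ ⥤ DGMod 𝒜 :=
  Functor.ofSequence (X := fun n => (tower f n).1) fun n => coneInr (attach (tower f n).2)

theorem towerFunctor_map (n : ℕ) : (towerFunctor f).map (homOfLE (Nat.le_add_right n 1)) =
    coneInr (attach (tower f n).2) :=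
  Functor.ofSequence_map_homOfLE_succ _ n

/-- The morphism from the colimit of the tower. -/
def towerDesc : seqColim (towerFunctor f) ⟶ Y :=
  seqDesc (fun n => (tower f n).2) fun n => by
    rw [towerFunctor_map]; exact coneInr_attachDesc _

theorem seqι_towerDesc (n : ℕ) : seqι (towerFunctor f) n ≫ towerDesc f = (tower f n).2 :=
  seqι_desc _ _ n

theorem diskLifting_towerDesc : DiskLifting (towerDesc f) := by
  rintro i y hy _ ⟨n, x, hx, rfl⟩ hd h
  rw [seqD_seqOf] at hd
  obtain ⟨m, hnm, hm⟩ := seqOf_eq_zero _ hd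
  rw [← seqOf_map _ hnm] at h ⊢
  replace hx := ((towerFunctor f).map (homOfLE hnm)).map_mem hx
  rw [((towerFunctor f).map (homOfLE hnm)).comm] at hm
  generalize ((towerFunctor f).map (homOfLE hnm)).toLin x = x' at *
  -- at the stage `m` the cycle and its bounding chain are the index of a cell of the next stage
  let c : SphereIndex (tower f m).2 := ⟨i, x', y, hx, hy, hm, by
    rw [← h, ← seqι_towerDesc]; rfl⟩
  let e : (tower f (m + 1)).1.carrier := (Finsupp.single c 1, 0)
  have he : e ∈ (tower f (m + 1)).1.deg i :=
    ⟨free_single_mem _ c rfl, zero_mem _⟩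
  refine ⟨seqOf (towerFunctor f) (m + 1) e, ⟨m + 1, e, he, rfl⟩, ?_, ?_⟩
  · have h1 := seqOf_map (towerFunctor f) (Nat.le_add_right m 1) x'
    rw [towerFunctor_map] at h1
    refine (seqD_seqOf (towerFunctor f) (m + 1) e).trans (Eq.trans ?_ h1)
    congr 1
    change (-(0 : SphereIndex (tower f m).2 →₀ A),
      (attach (tower f m).2).toLin (Finsupp.single c 1) + (tower f m).1.d 0) = (0, x')
    refine Prod.ext neg_zero ?_
    change Finsupp.linearCombination A SphereIndex.cycle (Finsupp.single c 1) +
      (tower f m).1.d 0 = x'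
    rw [map_zero, add_zero, Finsupp.linearCombination_single, one_smul]
  · have h1 : (towerDesc f).toLin (seqOf (towerFunctor f) (m + 1) e) =
        (tower f (m + 1)).2.toLin e := by
      rw [← seqι_towerDesc]; rfl
    rw [h1]
    change Finsupp.linearCombination A SphereIndex.chain (Finsupp.single c 1) +
      (tower f m).2.toLin 0 = y
    simp [c]

end Step

/-- Every morphism is a cofibration followed by a surjective quasi-isomorphism. -/
instance : MorphismProperty.HasFactorization (surjections 𝒜 ⊓ quasiIso 𝒜).llp
    (surjections 𝒜 ⊓ quasiIso 𝒜) where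
  nonempty_mapFactorizationData f := ⟨
    { Z := seqColim (towerFunctor f)
      i := seqι (towerFunctor f) 0
      p := towerDesc f
      fac := seqι_towerDesc f 0
      hi := seqι_zero_llp fun n => by rw [towerFunctor_map]; exact coneInr_llp _
      hp := diskLifting_iff.1 (diskLifting_towerDesc f) }⟩

/-- Every morphism factors as a morphism with the left lifting property with respect to surjections
which is also a quasi-isomorphism, followed by a surjection. -/
theorem exists_factorization_surjection {X Y : DGMod 𝒜} (f : X ⟶ Y) :
    ∃ (Z : DGMod 𝒜) (i : X ⟶ Z) (p : Z ⟶ Y), (surjections 𝒜).llp i ∧ quasiIso 𝒜 i ∧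
      surjections 𝒜 p ∧ i ≫ p = f := by
  let I := Σ k : ℤ, Y.deg k
  let F := free 𝒜 fun i : I => i.1 - 1
  let w : F.carrier →ₗ[A] Y.carrier := Finsupp.linearCombination A fun i : I => (i.2 : Y.carrier)
  have hw : ∀ {k l φ}, φ ∈ F.deg k → k + 1 = l → w φ ∈ Y.deg l := fun hφ h =>
    free_linearCombination_mem (e := 1) (fun i => by simp) hφ h
  let g : cone (𝟙 F) ⟶ Y :=
    { toLin := w.coprod (Y.d ∘ₗ w)
      map_mem := fun {k x} hx => by
        refine add_mem (hw hx.1 (by ring)) ?_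
        have := Y.d_mem (hw hx.2 rfl)
        rwa [add_sub_cancel_right] at this
      comm := fun x => by
        change w (-0) + Y.d (w (x.1 + 0)) = Y.d (w x.1 + Y.d (w x.2))
        simp [Y.d_d] }
  refine ⟨prod X (cone (𝟙 F)), inl _ _, copair f g, inl_cone_free_llp _ _,
    quasiIso_inl_cone_id _ _, fun y => ?_, inl_copair f g⟩
  have hY : ∀ y, ∃ φ, w φ = y := fun y => by
    refine Y.hom_induction (p := fun y => ∃ φ, w φ = y) y ⟨0, map_zero _⟩ (fun i y hy => ?_) ?_
    · refine ⟨Finsupp.single (⟨i, y, hy⟩ : I) 1, ?_⟩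
      exact (Finsupp.linearCombination_single A _ _).trans (one_smul A y)
    · rintro _ _ ⟨φ, rfl⟩ ⟨ψ, rfl⟩; exact ⟨φ + ψ, map_add _ _ _⟩
  obtain ⟨φ, rfl⟩ := hY y
  refine ⟨(0, φ, 0), ?_⟩
  change f.toLin 0 + (w φ + Y.d (w 0)) = w φ
  simp

/-- The cofibrations which are quasi-isomorphisms are the maps with the left lifting property with
respect to all surjections. -/
theorem trivialCofibration_iff {X Y : DGMod 𝒜} (f : X ⟶ Y) :
    ((surjections 𝒜 ⊓ quasiIso 𝒜).llp ⊓ quasiIso 𝒜) f ↔ (surjections 𝒜).llp f := by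
  obtain ⟨Z, i, p, hi, hiq, hp, fac⟩ := exists_factorization_surjection f
  constructor
  · rintro ⟨hf, hfq⟩
    have hpq : quasiIso 𝒜 p := (quasiIso 𝒜).of_precomp i p hiq (by rwa [fac])
    have := hf p ⟨hp, hpq⟩
    exact MorphismProperty.of_retract (RetractArrow.ofLeftLiftingProperty fac) hi
  · refine fun hf => ⟨fun W Z p hp => hf p hp.1, ?_⟩
    have := hf p hp
    exact MorphismProperty.of_retract (RetractArrow.ofLeftLiftingProperty fac) hiq

end Factorization

end DGMod

namespace ModelData

universe v u

/-- Three classes of morphisms form a model category if they form two weak factorization systems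
and the weak equivalences satisfy two-out-of-three. -/
theorem IsModelCategory.of_isWeakFactorizationSystem {C : Type u} [Category.{v} C]
    [HasFiniteLimits C] [HasFiniteColimits C] (S : ModelData C)
    (h : S.weq.HasTwoOutOfThreeProperty)
    (h₁ : MorphismProperty.IsWeakFactorizationSystem S.cof (S.fib ⊓ S.weq))
    (h₂ : MorphismProperty.IsWeakFactorizationSystem (S.cof ⊓ S.weq) S.fib) :
    S.IsModelCategory :=
  letI : CategoryWithFibrations C := ⟨S.fib⟩
  letI : CategoryWithCofibrations C := ⟨S.cof⟩
  letI : CategoryWithWeakEquivalences C := ⟨S.weq⟩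
  haveI : (weakEquivalences C).HasTwoOutOfThreeProperty := h
  haveI : MorphismProperty.IsWeakFactorizationSystem (cofibrations C) (trivialFibrations C) := h₁
  haveI : MorphismProperty.IsWeakFactorizationSystem (trivialCofibrations C) (fibrations C) := h₂
  ⟨ModelCategory.mk' C, rfl, rfl, rfl⟩

end ModelData

namespace DGMod

variable {A : Type} [CommRing A] (𝒜 : ℤ → AddSubgroup A) [GradedRing 𝒜]

instance : MorphismProperty.HasFactorization (projective 𝒜).cof
    ((projective 𝒜).fib ⊓ (projective 𝒜).weq) :=
  inferInstanceAs (MorphismProperty.HasFactorization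
    (surjections 𝒜 ⊓ quasiIso 𝒜).llp (surjections 𝒜 ⊓ quasiIso 𝒜))

instance : ((projective 𝒜).fib ⊓ (projective 𝒜).weq).IsStableUnderRetracts :=
  inferInstanceAs (surjections 𝒜 ⊓ quasiIso 𝒜).IsStableUnderRetracts

instance : MorphismProperty.IsWeakFactorizationSystem (projective 𝒜).cof
    ((projective 𝒜).fib ⊓ (projective 𝒜).weq) where
  rlp := MorphismProperty.rlp_eq_of_le_rlp_of_hasFactorization_of_isStableUnderRetracts
    ((MorphismProperty.le_llp_iff_le_rlp _ _).1 le_rfl)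
  llp := rfl

/-- The projective model structure is a model category. -/
theorem projective_isModelCategory : (projective 𝒜).IsModelCategory := by
  have h : (projective 𝒜).cof ⊓ (projective 𝒜).weq = (surjections 𝒜).llp := by
    ext X Y f; exact trivialCofibration_iff f
  refine .of_isWeakFactorizationSystem _ (inferInstanceAs (quasiIso 𝒜).HasTwoOutOfThreeProperty)
    inferInstance ?_
  rw [h]
  change MorphismProperty.IsWeakFactorizationSystem (surjections 𝒜).llp (surjections 𝒜)
  have : MorphismProperty.HasFactorization (surjections 𝒜).llp (surjections 𝒜) :=
    ⟨fun f => by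
      obtain ⟨Z, i, p, hi, -, hp, fac⟩ := exists_factorization_surjection f
      exact ⟨⟨Z, i, p, fac, hi, hp⟩⟩⟩
  exact ⟨MorphismProperty.rlp_eq_of_le_rlp_of_hasFactorization_of_isStableUnderRetracts
    ((MorphismProperty.le_llp_iff_le_rlp _ _).1 le_rfl), rfl, this⟩

end DGMod

namespace DGMod

variable {A : Type} [CommRing A] {𝒜 : ℤ → AddSubgroup A}

/-! ### Pullbacks -/

section Pullback

variable {M N P : DGMod 𝒜} (f : M ⟶ P) (g : N ⟶ P)

/-- The submodule of pairs with the same image. -/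
def pullbackSubmodule : Submodule A (M.carrier × N.carrier) :=
  LinearMap.eqLocus (f.toLin ∘ₗ LinearMap.fst A _ _) (g.toLin ∘ₗ LinearMap.snd A _ _)

theorem mem_pullbackSubmodule {x : M.carrier × N.carrier} :
    x ∈ pullbackSubmodule f g ↔ f.toLin x.1 = g.toLin x.2 := Iff.rfl

/-- The pullback of differential graded modules. -/
abbrev pullbackObj : DGMod 𝒜 :=
  sub (prod M N) (pullbackSubmodule f g)
    (fun x hx => by
      rw [mem_pullbackSubmodule] at hx ⊢
      exact (f.comm x.1).trans ((congrArg P.d hx).trans (g.comm x.2).symm))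
    (fun i x hx => by
      rw [mem_pullbackSubmodule] at hx ⊢
      rw [prod_proj, ← proj_hom, ← proj_hom, hx])

/-- The first projection of a pullback. -/
def pullbackFst : pullbackObj f g ⟶ M := subι _ _ _ _ ≫ fst M N

/-- The second projection of a pullback. -/
def pullbackSnd : pullbackObj f g ⟶ N := subι _ _ _ _ ≫ snd M N

variable {f g} in
/-- The morphism into a pullback. -/
def pullbackLift {Q : DGMod 𝒜} (a : Q ⟶ M) (b : Q ⟶ N) (h : a ≫ f = b ≫ g) :
    Q ⟶ pullbackObj f g :=
  subLift _ _ _ (pair a b) fun x => congrArg (fun k => Hom.toLin k x) h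

theorem isPullback_pullbackObj : IsPullback (pullbackFst f g) (pullbackSnd f g) f g where
  w := hom_ext (LinearMap.ext fun x => x.2)
  isLimit' := ⟨PullbackCone.IsLimit.mk _ (fun s => pullbackLift s.fst s.snd s.condition)
    (fun _ => rfl) (fun _ => rfl) fun s _ h h' => hom_ext (LinearMap.ext fun x =>
      Subtype.ext (Prod.ext (congrArg (fun k : s.pt ⟶ M => k.toLin x) h)
        (congrArg (fun k : s.pt ⟶ N => k.toLin x) h')))⟩

end Pullback

/-! ### The internal hom -/

theorem shift_d (M : DGMod 𝒜) (k : ℤ) (m : M.carrier) :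
    ((shift 𝒜 k).obj M).d m = (k.negOnePow : ℤ) • M.d m := rfl

theorem negOnePow_smul_smul {M : Type} [AddCommGroup M] (k : ℤ) (m : M) :
    (k.negOnePow : ℤ) • (k.negOnePow : ℤ) • m = m := by
  rcases Int.even_or_odd k with h | h
  · simp [Int.negOnePow_even k h]
  · simp [Int.negOnePow_odd k h]

theorem negOnePow_pred (k : ℤ) : ((k - 1).negOnePow : ℤ) = -(k.negOnePow : ℤ) := by
  rw [Int.negOnePow_sub, Int.negOnePow_one]; simp

theorem diskLifting_shift {X Y : DGMod 𝒜} {p : X ⟶ Y} (hp : DiskLifting p) (k : ℤ) :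
    DiskLifting ((shift 𝒜 k).map p) := by
  intro i y hy x hx hdx h
  change Y.carrier at y
  change X.carrier at x
  change y ∈ Y.deg (i - k) at hy
  change x ∈ X.deg (i - 1 - k) at hx
  change p.toLin x = (k.negOnePow : ℤ) • Y.d y at h
  change (k.negOnePow : ℤ) • X.d x = 0 at hdx
  obtain ⟨x', hx', h1, h2⟩ := hp (i - k) y hy ((k.negOnePow : ℤ) • x)
    (zsmul_mem (by rwa [sub_right_comm]) _) (by rw [map_zsmul, hdx])
    (by rw [map_zsmul, h, negOnePow_smul_smul])
  exact ⟨x', hx', by rw [shift_d, h1, negOnePow_smul_smul], h2⟩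

section InternalHom

variable (L X : DGMod 𝒜)

/-- The linear maps of degree `k`. -/
def homDeg (k : ℤ) : AddSubgroup (L.carrier →ₗ[A] X.carrier) where
  carrier := {f | ∀ i, ∀ l ∈ L.deg i, f l ∈ X.deg (i + k)}
  zero_mem' _ _ _ := zero_mem _
  add_mem' h h' i l hl := add_mem (h i l hl) (h' i l hl)
  neg_mem' h i l hl := neg_mem (h i l hl)

variable {L X} in
theorem smul_mem_homDeg {i k : ℤ} {a : A} (ha : a ∈ 𝒜 i) {f : L.carrier →ₗ[A] X.carrier}
    (hf : f ∈ homDeg L X k) : a • f ∈ homDeg L X (i + k) := fun j l hl => by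
  have := X.smul_mem ha (hf j l hl)
  rwa [add_left_comm] at this

variable {L X} in
theorem homDeg_comp_left {K : DGMod 𝒜} {m : ℤ} {h : L.carrier →ₗ[A] X.carrier}
    (hh : h ∈ homDeg L X m)
    (k : K ⟶ L) : h ∘ₗ k.toLin ∈ homDeg K X m := fun i _ hl =>
  hh i _ (k.map_mem hl)

variable {L X} in
theorem homDeg_induction {p : (L.carrier →ₗ[A] X.carrier) → Prop} {f : L.carrier →ₗ[A] X.carrier}
    (hf : f ∈ ⨆ k, homDeg L X k) (h0 : p 0) (h : ∀ k, ∀ f ∈ homDeg L X k, p f)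
    (hadd : ∀ f g, p f → p g → p (f + g)) : p f :=
  AddSubgroup.iSup_induction (homDeg L X) (C := p) hf h h0 hadd

variable [GradedRing 𝒜]

/-- The finite sums of homogeneous linear maps. -/
def homSub : Submodule A (L.carrier →ₗ[A] X.carrier) where
  __ := ⨆ k, homDeg L X k
  smul_mem' a f hf := by
    change a • f ∈ ⨆ k, homDeg L X k
    change f ∈ ⨆ k, homDeg L X k at hf
    refine homDeg_induction (p := fun f => a • f ∈ ⨆ k, homDeg L X k) hf (by simp)
      (fun k f hf => ?_) (fun f g hf hg => by rw [smul_add]; exact add_mem hf hg)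
    exact DirectSum.Decomposition.inductionOn 𝒜 (motive := fun a => a • f ∈ ⨆ k, homDeg L X k)
      (by simp) (fun {i} a => AddSubgroup.mem_iSup_of_mem (i + k) (smul_mem_homDeg a.2 hf))
      (fun a b ha hb => by rw [add_smul]; exact add_mem ha hb) a

variable {L X} in
theorem mem_homSub {f : L.carrier →ₗ[A] X.carrier} : f ∈ homSub L X ↔ f ∈ ⨆ k, homDeg L X k :=
  Iff.rfl

variable [EvenlyGraded 𝒜]

@[simp] theorem sign_sign (M : DGMod 𝒜) (m : M.carrier) : M.sign (M.sign m) = m := by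
  simp only [sign_apply, map_sub, map_add, odd_odd, two_smul]
  abel

theorem sign_d (M : DGMod 𝒜) (m : M.carrier) : M.sign (M.d m) = -M.d (M.sign m) := by
  simp only [sign_apply, map_sub, map_add, odd_d, two_smul]
  abel

theorem sign_hom {M N : DGMod 𝒜} (f : M ⟶ N) (m : M.carrier) :
    N.sign (f.toLin m) = f.toLin (M.sign m) := by
  simp only [sign_apply, map_sub, map_zsmul, odd_hom]

/-- The differential `d f = d ∘ f - (-1)^|f| f ∘ d`, where the sign is expressed through the sign
involutions of the source and the target. -/
def homD : (L.carrier →ₗ[A] X.carrier) →ₗ[A] (L.carrier →ₗ[A] X.carrier) where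
  toFun f := X.d ∘ₗ f - X.sign ∘ₗ f ∘ₗ L.sign ∘ₗ L.d
  map_add' f g := by ext; simp; abel
  map_smul' a f := by ext; simp [smul_sub]

theorem homD_apply (f : L.carrier →ₗ[A] X.carrier) (l : L.carrier) :
    homD L X f l = X.d (f l) - X.sign (f (L.sign (L.d l))) := rfl

theorem homD_homD (f : L.carrier →ₗ[A] X.carrier) : homD L X (homD L X f) = 0 := by
  ext l
  simp [homD_apply, X.d_d, L.d_d, sign_d]

variable {L X}

theorem sign_conj {k : ℤ} {f : L.carrier →ₗ[A] X.carrier} (hf : f ∈ homDeg L X k)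
    (l : L.carrier) : X.sign (f (L.sign l)) = (k.negOnePow : ℤ) • f l :=
  L.hom_induction (p := fun l => X.sign (f (L.sign l)) = (k.negOnePow : ℤ) • f l) l (by simp)
    (fun i l hl => by
      rw [sign_of_mem L hl, map_zsmul, map_zsmul, sign_of_mem X (hf i l hl), Int.negOnePow_add,
        Units.val_mul, mul_smul, negOnePow_smul_smul])
    (fun x y hx hy => by simp only [map_add, smul_add, hx, hy])

theorem homD_of_mem {k : ℤ} {f : L.carrier →ₗ[A] X.carrier} (hf : f ∈ homDeg L X k)
    (l : L.carrier) : homD L X f l = X.d (f l) - (k.negOnePow : ℤ) • f (L.d l) := by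
  rw [homD_apply, sign_conj hf]

theorem homD_mem_homDeg {k : ℤ} {f : L.carrier →ₗ[A] X.carrier} (hf : f ∈ homDeg L X k) :
    homD L X f ∈ homDeg L X (k - 1) := fun i l hl => by
  rw [homD_of_mem hf, ← add_sub_assoc]
  refine sub_mem (X.d_mem (hf i l hl)) (zsmul_mem ?_ _)
  have := hf _ _ (L.d_mem hl)
  rwa [sub_add_eq_add_sub] at this

variable (L X)

theorem homD_mem_homSub {f : L.carrier →ₗ[A] X.carrier} (hf : f ∈ homSub L X) :
    homD L X f ∈ homSub L X := by
  rw [mem_homSub] at hf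
  exact homDeg_induction (p := fun f => homD L X f ∈ homSub L X) hf (by simp)
    (fun k f hf => AddSubgroup.mem_iSup_of_mem (k - 1) (homD_mem_homDeg hf))
    (fun f g hf hg => by rw [map_add]; exact add_mem hf hg)

/-- The internal hom: finite sums of homogeneous linear maps. -/
abbrev internalHom : DGMod 𝒜 where
  carrier := homSub L X
  deg k := (homDeg L X k).comap (homSub L X).subtype.toAddMonoidHom
  decomposition := decompositionOfIndep _
    (fun x hx k => by
      -- on elements of degree `i`, the summand of degree `k` is the part of degree `i + k`
      have key : ∀ (x : DirectSum ℤ fun k =>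
          (homDeg L X k).comap (homSub L X).subtype.toAddMonoidHom) (i : ℤ) (l : L.carrier),
          l ∈ L.deg i → X.proj (i + k) ((DirectSum.coeAddMonoidHom _ x : homSub L X).1 l) =
            (x k).1.1 l := fun x i l hl => by
        induction x using DirectSum.induction_on with
        | zero => simp
        | of j f =>
          have hf : f.1.1 l ∈ X.deg (i + j) := f.2 i l hl
          rw [DirectSum.coeAddMonoidHom_of]
          by_cases h : j = k
          · subst h; rw [proj_of_mem _ hf, DirectSum.of_eq_same]
          · rw [proj_of_mem_ne _ hf (by omega), DirectSum.of_eq_of_ne _ _ _ (Ne.symm h)]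
            rfl
        | add x y hx hy =>
          have : (DirectSum.coeAddMonoidHom _ (x + y) : homSub L X).1 l =
              (DirectSum.coeAddMonoidHom _ x : homSub L X).1 l +
                (DirectSum.coeAddMonoidHom _ y : homSub L X).1 l := by
            rw [map_add]; rfl
          rw [this, map_add, hx, hy]; rfl
      refine Subtype.ext (Subtype.ext (LinearMap.ext fun l => ?_))
      refine L.hom_induction (p := fun l => (x k).1.1 l = 0) l (map_zero _) (fun i l hl => ?_)
        (fun y z hy hz => by rw [map_add, hy, hz, add_zero])
      rw [← key x i l hl, hx]
      exact map_zero _)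
    (fun ⟨f, hf⟩ => by
      refine AddSubgroup.iSup_induction' (homDeg L X) (C := fun f hf =>
        (⟨f, hf⟩ : homSub L X) ∈ ⨆ k, (homDeg L X k).comap (homSub L X).subtype.toAddMonoidHom)
        (fun k f hf => AddSubgroup.mem_iSup_of_mem k hf) (zero_mem _)
        (fun f g _ _ h h' => add_mem h h') hf)
  smul_mem ha hf := smul_mem_homDeg ha hf
  d := (homD L X).restrict fun f hf => homD_mem_homSub L X hf
  d_mem hf := homD_mem_homDeg hf
  d_d f := Subtype.ext (homD_homD L X f.1)

variable {L X}

/-- A homogeneous linear map as an element of the internal hom. -/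
def ofHomDeg {k : ℤ} (f : L.carrier →ₗ[A] X.carrier) (hf : f ∈ homDeg L X k) :
    (internalHom L X).carrier :=
  ⟨f, AddSubgroup.mem_iSup_of_mem k hf⟩

variable (L) in
/-- Functoriality of the internal hom in the target. -/
def homMapRight {X Y : DGMod 𝒜} (p : X ⟶ Y) : internalHom L X ⟶ internalHom L Y where
  toLin := (LinearMap.compRight A p.toLin).restrict fun f hf => by
    rw [mem_homSub] at hf
    exact homDeg_induction (p := fun f => LinearMap.compRight A p.toLin f ∈ homSub L Y) hf (by simp)
      (fun k f hf => AddSubgroup.mem_iSup_of_mem k fun i l hl => p.map_mem (hf i l hl))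
      (fun f g hf hg => by rw [map_add]; exact add_mem hf hg)
  map_mem hf i l hl := p.map_mem (hf i l hl)
  comm f := Subtype.ext (LinearMap.ext fun l => by
    change p.toLin (homD L X f.1 l) = homD L Y (p.toLin ∘ₗ f.1) l
    simp [homD_apply, p.comm, sign_hom])

variable (X) in
/-- Functoriality of the internal hom in the source. -/
def homMapLeft {K L : DGMod 𝒜} (k : K ⟶ L) : internalHom L X ⟶ internalHom K X where
  toLin := (LinearMap.lcomp A X.carrier k.toLin).restrict fun f hf => by
    rw [mem_homSub] at hf
    exact homDeg_induction (p := fun f => LinearMap.lcomp A X.carrier k.toLin f ∈ homSub K X) hf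
      (by simp) (fun i f hf => AddSubgroup.mem_iSup_of_mem i fun j l hl => hf j _ (k.map_mem hl))
      (fun f g hf hg => by rw [map_add]; exact add_mem hf hg)
  map_mem hf i l hl := hf i _ (k.map_mem hl)
  comm f := Subtype.ext (LinearMap.ext fun l => by
    change homD L X f.1 (k.toLin l) = homD K X (f.1 ∘ₗ k.toLin) l
    simp only [homD_apply, LinearMap.comp_apply, k.comm, ← sign_hom])

/-- Currying. -/
def curry {M L X : DGMod 𝒜} (f : tensor M L ⟶ X) : M ⟶ internalHom L X where
  toLin := (TensorProduct.curry f.toLin).codRestrict (homSub L X) fun m =>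
    M.hom_induction (p := fun m => TensorProduct.curry f.toLin m ∈ homSub L X) m (by simp)
      (fun i m hm => AddSubgroup.mem_iSup_of_mem i fun j l hl =>
        f.map_mem (tmul_mem hm hl (add_comm i j)))
      (fun x y hx hy => by rw [map_add]; exact add_mem hx hy)
  map_mem hm j l hl := f.map_mem (tmul_mem hm hl (add_comm _ j))
  comm m := Subtype.ext (LinearMap.ext fun l => by
    change f.toLin (M.d m ⊗ₜ l) =
      X.d (f.toLin (m ⊗ₜ l)) - X.sign (f.toLin (m ⊗ₜ L.sign (L.d l)))
    have h : (tensor M L).sign (m ⊗ₜ[A] L.sign (L.d l)) = M.sign m ⊗ₜ L.d l := by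
      rw [tensor_sign_tmul, sign_sign]
    rw [sign_hom, ← f.comm, h, ← map_sub]
    congr 1
    exact (add_sub_cancel_right (M.d m ⊗ₜ[A] l) (M.sign m ⊗ₜ[A] L.d l)).symm)

/-- Uncurrying. -/
def uncurry {M L X : DGMod 𝒜} (g : M ⟶ internalHom L X) : tensor M L ⟶ X where
  toLin := TensorProduct.lift ((homSub L X).subtype ∘ₗ g.toLin)
  map_mem {k x} hx := by
    refine tensorDeg_induction (p := fun x =>
      TensorProduct.lift ((homSub L X).subtype ∘ₗ g.toLin) x ∈ X.deg k) hx
      (fun i j m hm l hl h => ?_) (by simp) (fun x y hx hy => by rw [map_add]; exact add_mem hx hy)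
    have := g.map_mem hm j l hl
    rw [← h, add_comm]
    exact this
  comm x := by
    change TensorProduct.lift ((homSub L X).subtype ∘ₗ g.toLin) (tensorD M L x) =
      X.d (TensorProduct.lift ((homSub L X).subtype ∘ₗ g.toLin) x)
    induction x using TensorProduct.induction_on with
    | zero => simp
    | add x y hx hy => simp only [map_add, hx, hy]
    | tmul m l =>
      have h1 : (g.toLin (M.d m)).1 l = homD L X (g.toLin m).1 l :=
        congrArg (fun f : homSub L X => f.1 l) (g.comm m)
      have h2 : X.sign ((g.toLin m).1 (L.sign (L.d l))) = (g.toLin (M.sign m)).1 (L.d l) := by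
        refine M.hom_induction (p := fun m => X.sign ((g.toLin m).1 (L.sign (L.d l))) =
          (g.toLin (M.sign m)).1 (L.d l)) m (by simp) (fun i m hm => ?_) (fun x y hx hy => ?_)
        · have hg : (g.toLin m).1 ∈ homDeg L X i := g.map_mem hm
          rw [sign_conj hg, sign_of_mem M hm, map_zsmul]; rfl
        · simp only [map_add]
          exact (map_add X.sign _ _).trans (congrArg₂ (· + ·) hx hy)
      change (g.toLin (M.d m)).1 l + (g.toLin (M.sign m)).1 (L.d l) = X.d ((g.toLin m).1 l)
      rw [h1, homD_apply, h2, sub_add_cancel]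

/-- The functor `Hom(L, -)`. -/
def internalHomFunctor (L : DGMod 𝒜) : DGMod 𝒜 ⥤ DGMod 𝒜 where
  obj X := internalHom L X
  map p := homMapRight L p

/-- The tensor-hom adjunction. -/
def tensorHomAdj (L : DGMod 𝒜) : tensorRight L ⊣ internalHomFunctor L :=
  Adjunction.mkOfHomEquiv
    { homEquiv := fun _ _ =>
        { toFun := fun f => curry f
          invFun := fun g => uncurry g
          left_inv := fun _ => hom_ext (TensorProduct.ext' fun _ _ => rfl)
          right_inv := fun _ => hom_ext (LinearMap.ext fun _ => rfl) }
      homEquiv_naturality_left_symm := fun _ _ => hom_ext (TensorProduct.ext' fun _ _ => rfl)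
      homEquiv_naturality_right := fun _ _ => hom_ext (LinearMap.ext fun _ => rfl) }

instance : MonoidalClosed (DGMod 𝒜) where
  closed L :=
    { rightAdj := internalHomFunctor L
      adj := (tensorHomAdj L).ofNatIsoLeft (BraidedCategory.tensorLeftIsoTensorRight L).symm }

end InternalHom

end DGMod

namespace DGMod

variable {A : Type} [CommRing A] {𝒜 : ℤ → AddSubgroup A} [GradedRing 𝒜] [EvenlyGraded 𝒜]

/-! ### The pushout product axiom -/

section Leibniz

variable {K L X Y : DGMod 𝒜}

/-- The pullback power `Hom(L, X) ⟶ Hom(K, X) ×_{Hom(K, Y)} Hom(L, Y)` of `k : K ⟶ L` and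
`p : X ⟶ Y`. -/
def leibnizHom (k : K ⟶ L) (p : X ⟶ Y) :
    internalHom L X ⟶ pullbackObj (homMapRight K p) (homMapLeft Y k) :=
  pullbackLift (homMapLeft X k) (homMapRight L p) rfl

/-- A map `h : L ⟶ Y` of degree `m` together with a lift `u : L ⟶ X` of its differential to a cycle
is the same as a morphism of degree `0` to the mapping cone of `Σ^{-m} p`. -/
def coneLiftOfHom (p : X ⟶ Y) (m : ℤ) (u : L.carrier →ₗ[A] X.carrier)
    (h : L.carrier →ₗ[A] Y.carrier) (hu : u ∈ homDeg L X (m - 1)) (hh : h ∈ homDeg L Y m)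
    (hdu : homD L X u = 0) (hdh : ∀ l, p.toLin (u l) = homD L Y h l) :
    L ⟶ cone ((shift 𝒜 (-m)).map p) :=
  coneLift (M := (shift 𝒜 (-m)).obj X) (N := (shift 𝒜 (-m)).obj Y) ((shift 𝒜 (-m)).map p)
    (-((m.negOnePow : ℤ) • u)) h
    (fun {i l} hl => neg_mem (zsmul_mem (by
      have := hu i l hl
      rwa [show i + (m - 1) = i - 1 - -m by ring] at this) _))
    (fun {i l} hl => by
      have := hh i l hl
      rwa [← sub_neg_eq_add] at this)
    (fun l => by
      have h0 : X.d (u l) + (m.negOnePow : ℤ) • u (L.d l) = 0 := by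
        have := congrArg (fun f => f l) hdu
        rwa [homD_of_mem hu, negOnePow_pred, neg_smul, sub_neg_eq_add] at this
      change -((m.negOnePow : ℤ) • u (L.d l)) =
        -(((-m).negOnePow : ℤ) • X.d (-((m.negOnePow : ℤ) • u l)))
      rw [Int.negOnePow_neg, map_neg, map_zsmul, smul_neg, negOnePow_smul_smul, neg_neg]
      exact (eq_neg_of_add_eq_zero_left h0).symm)
    (fun l => by
      change h (L.d l) = p.toLin (-((m.negOnePow : ℤ) • u l)) +
        ((-m).negOnePow : ℤ) • Y.d (h l)
      rw [map_neg, map_zsmul, hdh, homD_of_mem hh, Int.negOnePow_neg, smul_sub,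
        negOnePow_smul_smul]
      abel)

/-- The map of degree `m` underlying a morphism to the cone of the identity of `Σ^{-m} X`. -/
theorem cone_id_component {m : ℤ} (w : L ⟶ cone (𝟙 ((shift 𝒜 (-m)).obj X))) :
    ∃ f ∈ homDeg L X m, (∀ l, f l = (w.toLin l).2) ∧
      ∀ l, homD L X f l = -((m.negOnePow : ℤ) • (show X.carrier from (w.toLin l).1)) := by
  let f : L.carrier →ₗ[A] X.carrier :=
    (LinearMap.snd A X.carrier X.carrier) ∘ₗ
      (show L.carrier →ₗ[A] X.carrier × X.carrier from w.toLin)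
  have hf : f ∈ homDeg L X m := fun i l hl => by
    have : f l ∈ X.deg (i - -m) := (w.map_mem hl).2
    rwa [sub_neg_eq_add] at this
  refine ⟨f, hf, fun l => rfl, fun l => ?_⟩
  have h : f (L.d l) = (show X.carrier from (w.toLin l).1) + ((-m).negOnePow : ℤ) • X.d (f l) :=
    congrArg Prod.snd (w.comm l)
  rw [homD_of_mem hf, h, Int.negOnePow_neg, smul_add, negOnePow_smul_smul]
  abel

theorem homD_comp_left (h : L.carrier →ₗ[A] X.carrier) (k : K ⟶ L) :
    homD K X (h ∘ₗ k.toLin) = homD L X h ∘ₗ k.toLin :=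
  LinearMap.ext fun l => by
    simp only [homD_apply, LinearMap.comp_apply, k.comm, ← sign_hom]

/-- The pullback power of `k` and `p` is a surjective quasi-isomorphism as soon as `k` has the left
lifting property with respect to the maps from cones of identities to cones of shifts of `p`. -/
theorem diskLifting_leibnizHom {k : K ⟶ L} {p : X ⟶ Y}
    (h : ∀ m : ℤ, HasLiftingProperty k (coneMap (f := 𝟙 ((shift 𝒜 m).obj X))
      (f' := (shift 𝒜 m).map p) (𝟙 _) ((shift 𝒜 m).map p) rfl)) :
    DiskLifting (leibnizHom k p) := by
  rintro m ⟨⟨⟨g, hg'⟩, ⟨h', hh'⟩⟩, hgh⟩ ⟨hg, hh⟩ ⟨u, hu'⟩ hu hdu huk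
  change g ∈ homDeg K X m at hg
  change h' ∈ homDeg L Y m at hh
  change u ∈ homDeg L X (m - 1) at hu
  replace hdu : homD L X u = 0 := congrArg Subtype.val hdu
  replace hgh : ∀ l, p.toLin (g l) = h' (k.toLin l) := fun l =>
    congrArg (fun f : homSub K Y => f.1 l) hgh
  have hug : ∀ l, u (k.toLin l) = homD K X g l := fun l =>
    congrArg (fun f : pullbackSubmodule (homMapRight K p) (homMapLeft Y k) => f.1.1.1 l) huk
  have huh : ∀ l, p.toLin (u l) = homD L Y h' l := fun l =>
    congrArg (fun f : pullbackSubmodule (homMapRight K p) (homMapLeft Y k) => f.1.2.1 l) huk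
  let top : K ⟶ cone (𝟙 ((shift 𝒜 (-m)).obj X)) :=
    coneLiftOfHom (𝟙 X) m (u ∘ₗ k.toLin) g (homDeg_comp_left hu k) hg
      (by rw [homD_comp_left, hdu, LinearMap.zero_comp]) hug
  let bot : L ⟶ cone ((shift 𝒜 (-m)).map p) := coneLiftOfHom p m u h' hu hh hdu huh
  have sq : CommSq top k (coneMap (f := 𝟙 ((shift 𝒜 (-m)).obj X))
      (f' := (shift 𝒜 (-m)).map p) (𝟙 _) ((shift 𝒜 (-m)).map p) rfl) bot :=
    ⟨hom_ext (LinearMap.ext fun l => Prod.ext rfl (hgh l))⟩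
  have := h (-m)
  obtain ⟨f, hf, hf1, hf2⟩ := cone_id_component sq.lift
  refine ⟨ofHomDeg f hf, hf, Subtype.ext (LinearMap.ext fun l => ?_),
    Subtype.ext (Prod.ext (Subtype.ext (LinearMap.ext fun l => ?_))
      (Subtype.ext (LinearMap.ext fun l => ?_)))⟩
  · have h1 : (show X.carrier from (sq.lift.toLin l).1) = -((m.negOnePow : ℤ) • u l) :=
      congrArg (fun w : L ⟶ cone ((shift 𝒜 (-m)).map p) => (w.toLin l).1) sq.fac_right
    refine (hf2 l).trans ?_
    rw [h1, smul_neg, negOnePow_smul_smul, neg_neg]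
  · exact (hf1 _).trans (congrArg (fun w : K ⟶ cone (𝟙 ((shift 𝒜 (-m)).obj X)) =>
      (w.toLin l).2) sq.fac_left)
  · exact (congrArg p.toLin (hf1 l)).trans (congrArg (fun w : L ⟶ cone ((shift 𝒜 (-m)).map p) =>
      (w.toLin l).2) sq.fac_right)

/-- The pullback power of a cofibration and a surjection is surjective. -/
theorem surjective_leibnizHom {k : K ⟶ L} {p : X ⟶ Y} (hk : (surjections 𝒜 ⊓ quasiIso 𝒜).llp k)
    (hp : Function.Surjective p.toLin) : Function.Surjective (leibnizHom k p).toLin := by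
  intro y
  refine hom_induction (p := fun y => ∃ x, (leibnizHom k p).toLin x = y) y ⟨0, map_zero _⟩ ?_ ?_
  swap
  · rintro _ _ ⟨x, rfl⟩ ⟨y, rfl⟩; exact ⟨x + y, map_add _ _ _⟩
  rintro m ⟨⟨⟨g, hg'⟩, ⟨h', hh'⟩⟩, hgh⟩ ⟨hg, hh⟩
  change g ∈ homDeg K X m at hg
  change h' ∈ homDeg L Y m at hh
  replace hgh : p.toLin ∘ₗ g = h' ∘ₗ k.toLin := congrArg (fun f : homSub K Y => f.1) hgh
  let top : K ⟶ cone (𝟙 ((shift 𝒜 (-m)).obj X)) :=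
    coneLiftOfHom (𝟙 X) m (homD K X g) g (homD_mem_homDeg hg) hg (homD_homD K X g) fun _ => rfl
  let bot : L ⟶ cone (𝟙 ((shift 𝒜 (-m)).obj Y)) :=
    coneLiftOfHom (𝟙 Y) m (homD L Y h') h' (homD_mem_homDeg hh) hh (homD_homD L Y h') fun _ => rfl
  let q : cone (𝟙 ((shift 𝒜 (-m)).obj X)) ⟶ cone (𝟙 ((shift 𝒜 (-m)).obj Y)) :=
    coneMap ((shift 𝒜 (-m)).map p) ((shift 𝒜 (-m)).map p) (Category.comp_id _).symm
  have hd : ∀ l, p.toLin (homD K X g l) = homD L Y h' (k.toLin l) := fun l => by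
    have h1 : homD K Y (p.toLin ∘ₗ g) l = p.toLin (homD K X g l) := by
      simp only [homD_apply, LinearMap.comp_apply, map_sub, sign_hom, p.comm]
    have h2 : homD K Y (h' ∘ₗ k.toLin) l = homD L Y h' (k.toLin l) := by
      rw [homD_comp_left]; rfl
    rw [← h1, hgh, h2]
  have sq : CommSq top k q bot := ⟨hom_ext (LinearMap.ext fun l => Prod.ext (by
      change p.toLin (-((m.negOnePow : ℤ) • homD K X g l)) =
        -((m.negOnePow : ℤ) • homD L Y h' (k.toLin l))
      rw [map_neg, map_zsmul, hd]) (congrArg (fun f => f l) hgh))⟩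
  have := hk q (diskLifting_iff.1 (diskLifting_coneMap_id hp))
  obtain ⟨f, hf, hf1, -⟩ := cone_id_component sq.lift
  refine ⟨ofHomDeg f hf, Subtype.ext (Prod.ext (Subtype.ext (LinearMap.ext fun l => ?_))
      (Subtype.ext (LinearMap.ext fun l => ?_)))⟩
  · exact (hf1 _).trans (congrArg (fun w : K ⟶ cone (𝟙 ((shift 𝒜 (-m)).obj X)) =>
      (w.toLin l).2) sq.fac_left)
  · exact (congrArg p.toLin (hf1 l)).trans (congrArg
      (fun w : L ⟶ cone (𝟙 ((shift 𝒜 (-m)).obj Y)) => (w.toLin l).2) sq.fac_right)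

/-- The tensor-hom adjunction turns lifting problems for the pushout product of `i` and `k` against
`p` into lifting problems for `i` against the pullback power of `k` and `p`. -/
theorem hasLiftingProperty_pushoutProduct {B C P : DGMod 𝒜} {i : B ⟶ C} {k : K ⟶ L} {p : X ⟶ Y}
    {inl : C ⊗ K ⟶ P} {inr : B ⊗ L ⟶ P} (hP : IsPushout (i ▷ K) (B ◁ k) inl inr)
    {q : P ⟶ C ⊗ L} (h1 : inl ≫ q = C ◁ k) (h2 : inr ≫ q = i ▷ L)
    (h : HasLiftingProperty i (leibnizHom k p)) : HasLiftingProperty q p := by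
  refine ⟨fun {u v} sq => ?_⟩
  let a : C ⟶ internalHom K X := curry (inl ≫ u)
  let b : B ⟶ internalHom L X := curry (inr ≫ u)
  let c : C ⟶ internalHom L Y := curry v
  have hu1 : ∀ x y, p.toLin ((inl ≫ u).toLin (x ⊗ₜ[A] y)) = v.toLin (x ⊗ₜ[A] k.toLin y) :=
    fun x y => by
      have : (inl ≫ u) ≫ p = C ◁ k ≫ v := by rw [Category.assoc, sq.w, ← h1, Category.assoc]
      exact congrArg (fun f => Hom.toLin f (x ⊗ₜ[A] y)) this
  have hu2 : ∀ x y, p.toLin ((inr ≫ u).toLin (x ⊗ₜ[A] y)) = v.toLin (i.toLin x ⊗ₜ[A] y) :=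
    fun x y => by
      have : (inr ≫ u) ≫ p = i ▷ L ≫ v := by rw [Category.assoc, sq.w, ← h2, Category.assoc]
      exact congrArg (fun f => Hom.toLin f (x ⊗ₜ[A] y)) this
  have hu3 : ∀ x y, (inl ≫ u).toLin (i.toLin x ⊗ₜ[A] y) =
      (inr ≫ u).toLin (x ⊗ₜ[A] k.toLin y) := fun x y => by
    have : i ▷ K ≫ inl ≫ u = B ◁ k ≫ inr ≫ u := by
      rw [← Category.assoc, hP.w, Category.assoc]
    exact congrArg (fun f => Hom.toLin f (x ⊗ₜ[A] y)) this
  have sq' : CommSq b i (leibnizHom k p) (pullbackLift a c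
      (hom_ext (LinearMap.ext fun x => Subtype.ext (LinearMap.ext fun y => hu1 x y)))) :=
    ⟨hom_ext (LinearMap.ext fun x => Subtype.ext (Prod.ext
      (Subtype.ext (LinearMap.ext fun y => (hu3 x y).symm))
      (Subtype.ext (LinearMap.ext fun y => hu2 x y))))⟩
  let w : C ⊗ L ⟶ X := uncurry sq'.lift
  have hw1 : ∀ x y, w.toLin (x ⊗ₜ[A] k.toLin y) = (inl ≫ u).toLin (x ⊗ₜ[A] y) := fun x y =>
    congrArg (fun f : C ⟶ pullbackObj (homMapRight K p) (homMapLeft Y k) => (f.toLin x).1.1.1 y)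
      sq'.fac_right
  have hw2 : ∀ x y, p.toLin (w.toLin (x ⊗ₜ[A] y)) = v.toLin (x ⊗ₜ[A] y) := fun x y =>
    congrArg (fun f : C ⟶ pullbackObj (homMapRight K p) (homMapLeft Y k) => (f.toLin x).1.2.1 y)
      sq'.fac_right
  have hw3 : ∀ x y, w.toLin (i.toLin x ⊗ₜ[A] y) = (inr ≫ u).toLin (x ⊗ₜ[A] y) := fun x y =>
    congrArg (fun f : B ⟶ internalHom L X => (f.toLin x).1 y) sq'.fac_left
  refine ⟨⟨⟨w, hP.hom_ext ?_ ?_, hom_ext (TensorProduct.ext' hw2)⟩⟩⟩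
  · rw [← Category.assoc, h1]
    exact hom_ext (TensorProduct.ext' hw1)
  · rw [← Category.assoc, h2]
    exact hom_ext (TensorProduct.ext' hw3)

end Leibniz

/-! ### The projective model structure is symmetric monoidal -/

variable (𝒜) in
/-- The cofibrations of the projective model structure. -/
abbrev projCof : MorphismProperty (DGMod 𝒜) := (surjections 𝒜 ⊓ quasiIso 𝒜).llp

/-- The pushout product of two cofibrations is a cofibration. -/
theorem pushoutProduct_cof {B C K L P : DGMod 𝒜} {i : B ⟶ C} {k : K ⟶ L} (hi : projCof 𝒜 i)
    (hk : projCof 𝒜 k) {inl : C ⊗ K ⟶ P} {inr : B ⊗ L ⟶ P}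
    (hP : IsPushout (i ▷ K) (B ◁ k) inl inr) {q : P ⟶ C ⊗ L} (h1 : inl ≫ q = C ◁ k)
    (h2 : inr ≫ q = i ▷ L) : projCof 𝒜 q := fun _ _ _ hp =>
  hasLiftingProperty_pushoutProduct hP h1 h2 (hi _ (diskLifting_iff.1 (diskLifting_leibnizHom
    fun m => hk _ (diskLifting_iff.1 (diskLifting_coneMap
      (diskLifting_shift (diskLifting_iff.2 hp) m))))))

/-- The pushout product of a trivial cofibration and a cofibration is a trivial cofibration. -/
theorem pushoutProduct_trivial_left {B C K L P : DGMod 𝒜} {i : B ⟶ C} {k : K ⟶ L}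
    (hi : (surjections 𝒜).llp i) (hk : projCof 𝒜 k) {inl : C ⊗ K ⟶ P} {inr : B ⊗ L ⟶ P}
    (hP : IsPushout (i ▷ K) (B ◁ k) inl inr) {q : P ⟶ C ⊗ L} (h1 : inl ≫ q = C ◁ k)
    (h2 : inr ≫ q = i ▷ L) : (surjections 𝒜).llp q := fun _ _ _ hp =>
  hasLiftingProperty_pushoutProduct hP h1 h2 (hi _ (surjective_leibnizHom hk hp))

/-- The pushout product of a cofibration and a trivial cofibration is a trivial cofibration. -/
theorem pushoutProduct_trivial_right {B C K L P : DGMod 𝒜} {i : B ⟶ C} {k : K ⟶ L}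
    (hi : projCof 𝒜 i) (hk : (surjections 𝒜).llp k) {inl : C ⊗ K ⟶ P} {inr : B ⊗ L ⟶ P}
    (hP : IsPushout (i ▷ K) (B ◁ k) inl inr) {q : P ⟶ C ⊗ L} (h1 : inl ≫ q = C ◁ k)
    (h2 : inr ≫ q = i ▷ L) : (surjections 𝒜).llp q := fun _ _ _ hp =>
  hasLiftingProperty_pushoutProduct hP h1 h2 (hi _ (diskLifting_iff.1 (diskLifting_leibnizHom
    fun m => hk _ (fun x => by
      obtain ⟨y, hy⟩ := hp x.2
      exact ⟨(x.1, y), Prod.ext rfl hy⟩))))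

end DGMod

namespace DGMod

variable {A : Type} [CommRing A] {𝒜 : ℤ → AddSubgroup A}

theorem cofibrant_iff {X : DGMod 𝒜} : (projective 𝒜).Cofibrant X ↔
    ∀ {W Z : DGMod 𝒜} (p : W ⟶ Z), (surjections 𝒜 ⊓ quasiIso 𝒜) p →
      ∀ v : X ⟶ Z, ∃ w : X ⟶ W, w ≫ p = v := by
  refine ⟨fun h W Z p hp v => ?_, fun h I hI W Z p hp => ⟨fun {u v} sq => ?_⟩⟩
  · have := h (zero 𝒜) (zeroIsInitial 𝒜) p hp
    have sq : CommSq (zeroHom _ W) ((zeroIsInitial 𝒜).to X) p v :=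
      ⟨(zeroIsInitial 𝒜).hom_ext _ _⟩
    exact ⟨sq.lift, sq.fac_right⟩
  · obtain ⟨w, hw⟩ := h p hp v
    exact ⟨⟨⟨w, hI.hom_ext _ _, hw⟩⟩⟩

/-- The inclusion of a summand with cofibrant complement is a cofibration. -/
theorem inl_llp (X : DGMod 𝒜) {Y : DGMod 𝒜} (hY : (projective 𝒜).Cofibrant Y) :
    (surjections 𝒜 ⊓ quasiIso 𝒜).llp (inl X Y) := fun W Z p hp => ⟨fun {u v} sq => by
  obtain ⟨w, hw⟩ := cofibrant_iff.1 hY p hp (inr X Y ≫ v)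
  refine ⟨⟨⟨copair u w, inl_copair u w, prod_hom_ext ?_ ?_⟩⟩⟩
  · rw [← Category.assoc, inl_copair, sq.w]
  · rw [← Category.assoc, inr_copair, hw]⟩

theorem inr_llp {X : DGMod 𝒜} (Y : DGMod 𝒜) (hX : (projective 𝒜).Cofibrant X) :
    (surjections 𝒜 ⊓ quasiIso 𝒜).llp (inr X Y) := fun W Z p hp => ⟨fun {u v} sq => by
  obtain ⟨w, hw⟩ := cofibrant_iff.1 hX p hp (inl X Y ≫ v)
  refine ⟨⟨⟨copair w u, inr_copair w u, prod_hom_ext ?_ ?_⟩⟩⟩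
  · rw [← Category.assoc, inl_copair, hw]
  · rw [← Category.assoc, inr_copair, sq.w]⟩

variable [GradedRing 𝒜]

variable (𝒜) in
/-- The unit of the tensor product is cofibrant. -/
theorem cofibrant_unit : (projective 𝒜).Cofibrant (unit 𝒜) := by
  refine cofibrant_iff.2 fun {W Z} p hp v => ?_
  have h1 : v.toLin (1 : A) ∈ Z.deg 0 := v.map_mem (SetLike.one_mem_graded 𝒜)
  have h2 : Z.d (v.toLin (1 : A)) = 0 := by rw [← v.comm]; exact map_zero _
  obtain ⟨x, hx, hdx, hpx⟩ := diskLifting_iff.2 hp 0 _ h1 0 (zero_mem _) (map_zero _)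
    (by rw [map_zero, h2])
  refine ⟨⟨LinearMap.toSpanSingleton A _ x, fun {i a} ha => ?_, fun a => ?_⟩,
    hom_ext (LinearMap.ext_ring ?_)⟩
  · have := W.smul_mem ha hx
    rwa [add_zero] at this
  · change (0 : A) • x = W.d (a • x)
    rw [map_smul, hdx, zero_smul, smul_zero]
  · change p.toLin ((1 : A) • x) = v.toLin (1 : A)
    rw [one_smul, hpx]

variable [EvenlyGraded 𝒜]

/-- Tensoring with a cofibrant object preserves trivial cofibrations. -/
theorem whiskerRight_llp {B C X : DGMod 𝒜} {i : B ⟶ C} (hi : (surjections 𝒜).llp i)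
    (hX : (projective 𝒜).Cofibrant X) : (surjections 𝒜).llp (i ▷ X) := by
  let k : zero 𝒜 ⟶ X := (zeroIsInitial 𝒜).to X
  have ext : ∀ {M N : DGMod 𝒜} (f g : M ⊗ zero 𝒜 ⟶ N), f = g := fun {M N} f g =>
    hom_ext (TensorProduct.ext' fun m z => by
      rw [show z = 0 from rfl, TensorProduct.tmul_zero, map_zero, map_zero])
  have hP : IsPushout (i ▷ zero 𝒜) (B ◁ k) (zeroHom (C ⊗ zero 𝒜) (B ⊗ X)) (𝟙 (B ⊗ X)) :=
    { w := ext _ _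
      isColimit' := ⟨PushoutCocone.IsColimit.mk _ (fun s => s.inr) (fun _ => ext _ _)
        (fun _ => Category.id_comp _) fun s m _ h => by rw [← h, Category.id_comp]⟩ }
  exact pushoutProduct_trivial_left hi (hX (zero 𝒜) (zeroIsInitial 𝒜)) hP (ext _ _)
    (Category.id_comp _)

/-- Tensoring with a cofibrant object preserves quasi-isomorphisms between cofibrant objects. -/
theorem quasiIso_whiskerRight {Q Q' X : DGMod 𝒜} {q : Q ⟶ Q'} (hq : quasiIso 𝒜 q)
    (hQ : (projective 𝒜).Cofibrant Q) (hQ' : (projective 𝒜).Cofibrant Q')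
    (hX : (projective 𝒜).Cofibrant X) : quasiIso 𝒜 (q ▷ X) := by
  -- both inclusions into a mapping cylinder of `q` are trivial cofibrations
  obtain ⟨⟨Z, i, p, fac, hi, hp⟩⟩ := MorphismProperty.HasFactorization.nonempty_mapFactorizationData
    (W₁ := (surjections 𝒜 ⊓ quasiIso 𝒜).llp) (W₂ := surjections 𝒜 ⊓ quasiIso 𝒜) (copair q (𝟙 Q'))
  have h0 : (inl Q Q' ≫ i) ≫ p = q := by rw [Category.assoc, fac, inl_copair]
  have h1 : (inr Q Q' ≫ i) ≫ p = 𝟙 Q' := by rw [Category.assoc, fac, inr_copair]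
  have key : ∀ {T : DGMod 𝒜} (j : T ⟶ Z), (surjections 𝒜 ⊓ quasiIso 𝒜).llp j →
      quasiIso 𝒜 (j ≫ p) → quasiIso 𝒜 (j ▷ X) := fun j hj hjp =>
    ((trivialCofibration_iff _).2 (whiskerRight_llp ((trivialCofibration_iff j).1
      ⟨hj, (quasiIso 𝒜).of_postcomp j p hp.2 hjp⟩) hX)).2
  have k0 := key (inl Q Q' ≫ i) (MorphismProperty.comp_mem _ _ _ (inl_llp Q hQ') hi)
    (by rwa [h0])
  have k1 := key (inr Q Q' ≫ i) (MorphismProperty.comp_mem _ _ _ (inr_llp Q' hQ) hi)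
    (by rw [h1]; exact MorphismProperty.id_mem _ _)
  have kp : quasiIso 𝒜 (p ▷ X) := (quasiIso 𝒜).of_precomp _ _ k1 (by
    rw [← comp_whiskerRight, h1, id_whiskerRight]; exact MorphismProperty.id_mem _ _)
  rw [← h0, comp_whiskerRight]
  exact MorphismProperty.comp_mem _ _ _ k0 kp

/-- A class of morphisms which respects isomorphisms is insensitive to the side of a whiskering. -/
theorem whiskerLeft_iff_whiskerRight {W : MorphismProperty (DGMod 𝒜)} [W.RespectsIso]
    {Q Q' : DGMod 𝒜} (q : Q ⟶ Q') (X : DGMod 𝒜) : W (X ◁ q) ↔ W (q ▷ X) := by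
  rw [← W.cancel_right_of_respectsIso (X ◁ q) (β_ X Q').hom,
    BraidedCategory.braiding_naturality_right, W.cancel_left_of_respectsIso]

variable (𝒜) in
/-- The projective model structure is symmetric monoidal. -/
theorem projective_isSymmetricMonoidal : (projective 𝒜).IsSymmetricMonoidal where
  isModelCategory := projective_isModelCategory 𝒜
  closed := ⟨inferInstance⟩
  pushout_product {B C K L P} i k hi hk inl inr hP q h1 h2 := by
    refine ⟨pushoutProduct_cof hi hk hP h1 h2, ?_⟩
    rintro (h | h)
    · exact ((trivialCofibration_iff q).2 (pushoutProduct_trivial_left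
        ((trivialCofibration_iff i).1 ⟨hi, h⟩) hk hP h1 h2)).2
    · exact ((trivialCofibration_iff q).2 (pushoutProduct_trivial_right hi
        ((trivialCofibration_iff k).1 ⟨hk, h⟩) hP h1 h2)).2
  unit {Q X} q hQ hq hX := by
    have := quasiIso_whiskerRight hq hQ (cofibrant_unit 𝒜) hX
    exact ⟨this, (whiskerLeft_iff_whiskerRight (W := quasiIso 𝒜) q X).2 this⟩

end DGMod

namespace DGMod

/-! ### Quasi-isomorphisms after localization of scalars -/

section Fractions

variable {A B M : Type} [CommRing A] [CommRing B] [Algebra A B] [AddCommGroup M] [Module A M]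

theorem one_tmul_smul (a : A) (m : M) :
    (1 : B) ⊗ₜ[A] (a • m) = algebraMap A B a • ((1 : B) ⊗ₜ[A] m) := by
  rw [TensorProduct.tmul_smul, algebraMap_smul]

variable (S : Submonoid A) [IsLocalization S B]

include S in
theorem exists_smul_eq_one_tmul (z : B ⊗[A] M) :
    ∃ s ∈ S, ∃ m : M, algebraMap A B s • z = (1 : B) ⊗ₜ[A] m := by
  obtain ⟨⟨m, s⟩, h⟩ := IsLocalizedModule.surj S (TensorProduct.mk A B M 1) z
  refine ⟨s, s.2, m, ?_⟩
  rw [algebraMap_smul]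
  exact h

include S in
theorem exists_smul_eq_zero {m : M} (h : (1 : B) ⊗ₜ[A] m = 0) : ∃ s ∈ S, s • m = 0 := by
  obtain ⟨s, hs⟩ := (IsLocalizedModule.eq_zero_iff S (TensorProduct.mk A B M 1)).1 h
  exact ⟨s, s.2, hs⟩

include S in
theorem exists_smul_eq_smul {m n : M} (h : (1 : B) ⊗ₜ[A] m = (1 : B) ⊗ₜ[A] n) :
    ∃ s ∈ S, s • m = s • n := by
  obtain ⟨s, hs, h'⟩ := exists_smul_eq_zero (B := B) S (m := m - n)
    (by rw [TensorProduct.tmul_sub, h, sub_self])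
  exact ⟨s, hs, by rwa [smul_sub, sub_eq_zero] at h'⟩

include S in
/-- Elements of `S` act invertibly on modules over the localization. -/
theorem exists_smul_eq {K : Type} [AddCommGroup K] [Module B K] {s : A} (hs : s ∈ S) :
    ∃ u : B, ∀ k : K, u • algebraMap A B s • k = k ∧ algebraMap A B s • u • k = k := by
  obtain ⟨u, hu⟩ := IsLocalization.map_units B (⟨s, hs⟩ : S)
  refine ⟨(u⁻¹ : Bˣ), fun k => ?_⟩
  change _ = algebraMap A B s at hu
  rw [← hu, smul_smul, smul_smul, Units.inv_mul, Units.mul_inv, one_smul]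
  exact ⟨rfl, rfl⟩

end Fractions

section Localization

variable {A B : Type} [CommRing A] [CommRing B] [Algebra A B]
  (𝒜 : ℤ → AddSubgroup A) (ℬ : ℤ → AddSubgroup B)
  [GradedRing 𝒜] [EvenlyGraded 𝒜] [GradedRing ℬ] [EvenlyGraded ℬ] [GradedAlgebraMap 𝒜 ℬ]

/-- The morphisms of differential graded `A`-modules which become quasi-isomorphisms after
extension of scalars to `B`. -/
abbrev extendQuasiIso : MorphismProperty (DGMod 𝒜) :=
  (quasiIso ℬ).inverseImage (extendScalars 𝒜 ℬ)

section Torsion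

variable (S : Submonoid A) [IsLocalization S B] {M N : DGMod 𝒜}

variable {𝒜}

/-- When `B` is the localization of `A` at `S`, the maps which become quasi-isomorphisms over `B`
are those which induce an isomorphism on homology up to `S`-torsion. -/
theorem extendQuasiIso_iff {f : M ⟶ N} : extendQuasiIso 𝒜 ℬ f ↔
    (∀ x, M.d x = 0 → ∀ y, f.toLin x = N.d y → ∃ s ∈ S, ∃ x', M.d x' = s • x) ∧
    (∀ y, N.d y = 0 → ∃ s ∈ S, ∃ x, M.d x = 0 ∧ ∃ y', s • y = f.toLin x + N.d y') := by
  have d_tmul : ∀ {M : DGMod 𝒜} (m : M.carrier),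
      (extend 𝒜 ℬ M).d ((1 : B) ⊗ₜ[A] m) = (1 : B) ⊗ₜ[A] M.d m := fun _ => rfl
  let F : extend 𝒜 ℬ M ⟶ extend 𝒜 ℬ N := (extendScalars 𝒜 ℬ).map f
  have f_tmul : ∀ m : M.carrier, F.toLin ((1 : B) ⊗ₜ[A] m) = (1 : B) ⊗ₜ[A] f.toLin m :=
    fun _ => rfl
  -- the action of `A` on `B ⊗ M` is written through `B`
  have st : ∀ {M : DGMod 𝒜} (a : A) (m : M.carrier),
      (1 : B) ⊗ₜ[A] (a • m) = algebraMap A B a • ((1 : B) ⊗ₜ[A] m) :=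
    fun a m => one_tmul_smul a m
  change quasiIso ℬ F ↔ _
  refine quasiIso_iff.trans ⟨?_, ?_⟩
  · rintro ⟨h1, h2⟩
    constructor
    · intro x hx y hy
      obtain ⟨z, hz⟩ := h1 ((1 : B) ⊗ₜ[A] x) (by rw [d_tmul, hx, TensorProduct.tmul_zero])
        ((1 : B) ⊗ₜ[A] y) (by rw [f_tmul, d_tmul, hy])
      obtain ⟨s, hs, x', hx'⟩ := exists_smul_eq_one_tmul S z
      obtain ⟨t, ht, h⟩ := exists_smul_eq_smul (B := B) S (m := M.d x') (n := s • x) (by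
        rw [← d_tmul, ← hx', map_smul, hz, st])
      exact ⟨t * s, mul_mem ht hs, t • x', by rw [map_smul, h, smul_smul]⟩
    · intro y hy
      obtain ⟨z, hz, w, h⟩ := h2 ((1 : B) ⊗ₜ[A] y) (by rw [d_tmul, hy, TensorProduct.tmul_zero])
      obtain ⟨s, hs, x, hx⟩ := exists_smul_eq_one_tmul S z
      obtain ⟨t, ht, y', hy'⟩ := exists_smul_eq_one_tmul S w
      obtain ⟨r, hr, hrx⟩ := exists_smul_eq_zero (B := B) S (m := M.d x) (by
        rw [← d_tmul, ← hx, map_smul, hz, smul_zero])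
      obtain ⟨q, hq, h'⟩ := exists_smul_eq_smul (B := B) S (m := (r * t * s) • y)
        (n := f.toLin ((r * t) • x) + N.d ((r * s) • y')) (by
          rw [st, h, TensorProduct.tmul_add, ← f_tmul, ← d_tmul, st, st, ← hx, ← hy']
          simp only [map_smul, map_mul, smul_smul, smul_add]
          congr 2
          ring)
      refine ⟨q * (r * t * s), mul_mem hq (mul_mem (mul_mem hr ht) hs), (q * r * t) • x, ?_,
        (q * r * s) • y', ?_⟩
      · rw [map_smul, mul_right_comm, mul_smul, hrx, smul_zero]
      · rw [mul_smul, h', smul_add, ← map_smul, ← map_smul, smul_smul, smul_smul, mul_assoc,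
          mul_assoc q]
  · rintro ⟨h1, h2⟩
    constructor
    · intro z hz w hw
      obtain ⟨s, hs, x, hx⟩ := exists_smul_eq_one_tmul S z
      obtain ⟨t, ht, y, hy⟩ := exists_smul_eq_one_tmul S w
      obtain ⟨r, hr, hrx⟩ := exists_smul_eq_zero (B := B) S (m := M.d x) (by
        rw [← d_tmul, ← hx, map_smul, hz, smul_zero])
      obtain ⟨q, hq, h'⟩ := exists_smul_eq_smul (B := B) S (m := f.toLin ((r * t) • x))
        (n := N.d ((r * s) • y)) (by
          rw [← f_tmul, ← d_tmul, st, st, ← hx, ← hy]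
          simp only [map_smul, map_mul, smul_smul, hw]
          congr 1
          ring)
      obtain ⟨p, hp, x', hx'⟩ := h1 ((q * (r * t)) • x)
        (by rw [map_smul, mul_left_comm, mul_comm r, mul_smul, hrx, smul_zero]) ((q * (r * s)) • y)
        (by rw [mul_smul, map_smul, h', ← map_smul, smul_smul])
      obtain ⟨u, hu⟩ := exists_smul_eq (B := B) S (K := B ⊗[A] M.carrier)
        (mul_mem (mul_mem hp (mul_mem hq (mul_mem hr ht))) hs)
      refine ⟨u • ((1 : B) ⊗ₜ[A] x'), ?_⟩
      rw [map_smul, d_tmul, hx', smul_smul, st, ← hx,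
        smul_smul (algebraMap A B (p * (q * (r * t)))), ← map_mul]
      exact (hu z).1
    · intro w hw
      obtain ⟨s, hs, y, hy⟩ := exists_smul_eq_one_tmul S w
      obtain ⟨r, hr, hry⟩ := exists_smul_eq_zero (B := B) S (m := N.d y) (by
        rw [← d_tmul, ← hy, map_smul, hw, smul_zero])
      obtain ⟨p, hp, x, hx, y', h⟩ := h2 (r • y) (by rw [map_smul, hry])
      obtain ⟨u, hu⟩ := exists_smul_eq (B := B) S (K := B ⊗[A] N.carrier)
        (mul_mem (mul_mem hp hr) hs)
      refine ⟨u • ((1 : B) ⊗ₜ[A] x), ?_, u • ((1 : B) ⊗ₜ[A] y'), ?_⟩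
      · rw [map_smul, d_tmul, hx, TensorProduct.tmul_zero, smul_zero]
      · rw [map_smul, map_smul, ← smul_add, f_tmul, d_tmul, ← TensorProduct.tmul_add, ← h, st, st,
          ← hy, smul_smul (algebraMap A B r), smul_smul (algebraMap A B p), ← map_mul, ← map_mul,
          ← mul_assoc]
        exact (hu w).1.symm

include S in
theorem quasiIso_le_extendQuasiIso : quasiIso 𝒜 ≤ extendQuasiIso 𝒜 ℬ := fun M N f hf => by
  obtain ⟨h1, h2⟩ := quasiIso_iff.1 hf
  refine (extendQuasiIso_iff ℬ S).2 ⟨fun x hx y hy => ?_, fun y hy => ?_⟩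
  · obtain ⟨x', h⟩ := h1 x hx y hy
    exact ⟨1, S.one_mem, x', by rw [one_smul, h]⟩
  · obtain ⟨x, hx, y', h⟩ := h2 y hy
    exact ⟨1, S.one_mem, x, hx, y', by rw [one_smul, h]⟩

/-- A map which becomes a quasi-isomorphism over the localization is a quasi-isomorphism if `S`
acts bijectively on the homology of its source and target. -/
theorem quasiIso_of_extendQuasiIso {f : M ⟶ N} (hf : extendQuasiIso 𝒜 ℬ f)
    (hM : ∀ s ∈ S, Function.Bijective fun x : M.homology => s • x)
    (hN : ∀ s ∈ S, Function.Bijective fun x : N.homology => s • x) : quasiIso 𝒜 f := by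
  obtain ⟨h1, h2⟩ := (extendQuasiIso_iff ℬ S).1 hf
  refine quasiIso_iff.2 ⟨fun x hx y hy => ?_, fun y hy => ?_⟩
  · obtain ⟨s, hs, x', hx'⟩ := h1 x hx y hy
    refine homology_mk_eq_zero.1 ((hM s hs).1 (a₁ := Submodule.Quotient.mk ⟨x, hx⟩) (a₂ := 0) ?_)
    change s • (Submodule.Quotient.mk (⟨x, hx⟩ : LinearMap.ker M.d) : M.homology) =
      s • (0 : M.homology)
    rw [smul_zero, ← Submodule.Quotient.mk_smul]
    exact homology_mk_eq_zero.2 ⟨x', hx'⟩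
  · obtain ⟨s, hs, x, hx, y', h⟩ := h2 y hy
    obtain ⟨w, hw⟩ := (hM s hs).2 (Submodule.Quotient.mk ⟨x, hx⟩)
    obtain ⟨⟨w, hw'⟩, rfl⟩ := Submodule.Quotient.mk_surjective _ w
    obtain ⟨v, hv⟩ := (Submodule.Quotient.eq _).1 hw
    change M.d v = s • w - x at hv
    have hz : N.d (y - f.toLin w) = 0 := by
      rw [map_sub, hy, ← f.comm, show M.d w = 0 from hw', map_zero, sub_zero]
    obtain ⟨z, hz'⟩ := homology_mk_eq_zero.1
      ((hN s hs).1 (a₁ := Submodule.Quotient.mk ⟨y - f.toLin w, hz⟩) (a₂ := 0) (by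
        change s • (Submodule.Quotient.mk (⟨_, hz⟩ : LinearMap.ker N.d) : N.homology) =
          s • (0 : N.homology)
        rw [smul_zero, ← Submodule.Quotient.mk_smul]
        refine homology_mk_eq_zero.2 ⟨y' - f.toLin v, ?_⟩
        change _ = s • (y - f.toLin w)
        rw [map_sub, ← f.comm, hv, smul_sub, h, map_sub, map_smul]
        abel))
    exact ⟨w, hw', z, by rw [hz']; exact (add_sub_cancel _ _).symm⟩

variable (𝒜) {ℬ} in
omit [GradedRing 𝒜] [EvenlyGraded 𝒜] [GradedRing ℬ] [EvenlyGraded ℬ] in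
include S in
theorem bijective_smul_homology_restrict (K : DGMod ℬ) {s : A} (hs : s ∈ S) :
    Function.Bijective fun x : (restrict 𝒜 ℬ K).homology => s • x := by
  obtain ⟨u, hu⟩ := exists_smul_eq (B := B) S (K := K.carrier) hs
  refine ⟨(injective_iff_map_eq_zero
    (LinearMap.lsmul A (restrict 𝒜 ℬ K).homology s)).2 fun x hx => ?_, fun x => ?_⟩
  · obtain ⟨⟨x, hx'⟩, rfl⟩ := Submodule.Quotient.mk_surjective _ x
    obtain ⟨y, hy⟩ := homology_mk_eq_zero.1 (((Submodule.Quotient.mk_smul _ s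
      (x := (⟨x, hx'⟩ : LinearMap.ker (restrict 𝒜 ℬ K).d)))).trans hx)
    change K.d y = algebraMap A B s • (x : K.carrier) at hy
    refine homology_mk_eq_zero.2 ⟨u • (show K.carrier from y), ?_⟩
    change K.d (u • (show K.carrier from y)) = x
    rw [map_smul]
    exact (congrArg (u • ·) hy).trans (hu x).1
  · obtain ⟨⟨x, hx'⟩, rfl⟩ := Submodule.Quotient.mk_surjective _ x
    change K.d x = 0 at hx'
    refine ⟨Submodule.Quotient.mk ⟨u • (show K.carrier from x), ?_⟩, ?_⟩
    · change K.d (u • (show K.carrier from x)) = 0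
      rw [map_smul]
      exact (congrArg (u • ·) hx').trans (smul_zero u)
    · refine congrArg Submodule.Quotient.mk (Subtype.ext ?_)
      exact (hu x).2

variable (𝒜) in
omit [GradedRing 𝒜] [EvenlyGraded 𝒜] [GradedRing ℬ] [EvenlyGraded ℬ] in
theorem quasiIso_restrict_iff {K K' : DGMod ℬ} (f : K ⟶ K') :
    quasiIso 𝒜 ((restrictScalars 𝒜 ℬ).map f) ↔ quasiIso ℬ f :=
  (quasiIso_iff (f := (restrictScalars 𝒜 ℬ).map f)).trans (quasiIso_iff (f := f)).symm

variable (𝒜) in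
include S in
theorem extendQuasiIso_restrict_iff {K K' : DGMod ℬ} (f : K ⟶ K') :
    extendQuasiIso 𝒜 ℬ ((restrictScalars 𝒜 ℬ).map f) ↔ quasiIso ℬ f := by
  rw [← quasiIso_restrict_iff 𝒜 ℬ]
  exact ⟨fun h => quasiIso_of_extendQuasiIso ℬ S h
    (fun s hs => bijective_smul_homology_restrict 𝒜 S K hs)
    (fun s hs => bijective_smul_homology_restrict 𝒜 S K' hs),
    fun h => quasiIso_le_extendQuasiIso ℬ S _ h⟩

variable (M) in
include S in
theorem extendQuasiIso_unit : extendQuasiIso 𝒜 ℬ ((extendRestrictAdj 𝒜 ℬ).unit.app M) := by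
  have smul_d : ∀ (a : A) (y : B ⊗[A] M.carrier),
      (extend 𝒜 ℬ M).d (algebraMap A B a • y) = algebraMap A B a • (extend 𝒜 ℬ M).d y :=
    fun a y => map_smul _ _ _
  refine (extendQuasiIso_iff ℬ S (M := M) (N := restrict 𝒜 ℬ (extend 𝒜 ℬ M))
    (f := unitHom 𝒜 ℬ M)).2 ⟨fun x hx y hy => ?_, fun y hy => ?_⟩
  · change B ⊗[A] M.carrier at y
    change (1 : B) ⊗ₜ[A] x = (extend 𝒜 ℬ M).d y at hy
    obtain ⟨s, hs, x', hx'⟩ := exists_smul_eq_one_tmul S y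
    obtain ⟨t, ht, h⟩ := exists_smul_eq_smul (B := B) S (m := M.d x') (n := s • x) (by
      change (extend 𝒜 ℬ M).d ((1 : B) ⊗ₜ[A] x') = _
      rw [← hx', smul_d, one_tmul_smul, hy])
    exact ⟨t * s, mul_mem ht hs, t • x', by rw [map_smul, h, smul_smul]⟩
  · change B ⊗[A] M.carrier at y
    change (extend 𝒜 ℬ M).d y = 0 at hy
    obtain ⟨s, hs, m, hm⟩ := exists_smul_eq_one_tmul S y
    obtain ⟨r, hr, hrm⟩ := exists_smul_eq_zero (B := B) S (m := M.d m) (by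
      change (extend 𝒜 ℬ M).d ((1 : B) ⊗ₜ[A] m) = 0
      rw [← hm, smul_d, hy, smul_zero])
    refine ⟨r * s, mul_mem hr hs, r • m, by rw [map_smul, hrm], 0, ?_⟩
    rw [map_zero, add_zero]
    change algebraMap A B (r * s) • y = (1 : B) ⊗ₜ[A] (r • m)
    rw [one_tmul_smul, ← hm, smul_smul, map_mul]

variable (𝒜) in
include S in
theorem extendQuasiIso_algebraMapHom : extendQuasiIso 𝒜 ℬ (algebraMapHom 𝒜 ℬ) := by
  refine (extendQuasiIso_iff ℬ S).2 ⟨fun x _ y hy => ?_, fun y _ => ?_⟩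
  · change algebraMap A B x = 0 at hy
    obtain ⟨s, hs⟩ := (IsLocalization.map_eq_zero_iff S B x).1 hy
    exact ⟨s, s.2, 0, hs.symm⟩
  · obtain ⟨⟨a, s⟩, h⟩ := IsLocalization.surj S (show B from y)
    refine ⟨s, s.2, a, rfl, 0, ?_⟩
    change (s : A) • (show B from y) = algebraMap A B a + 0
    rw [add_zero, Algebra.smul_def, mul_comm]
    exact h

include S in
theorem extendQuasiIso_shift_iff {f : M ⟶ N} (k : ℤ) :
    extendQuasiIso 𝒜 ℬ ((shift 𝒜 k).map f) ↔ extendQuasiIso 𝒜 ℬ f := by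
  rw [extendQuasiIso_iff ℬ S, extendQuasiIso_iff ℬ S]
  have hd : ∀ (M : DGMod 𝒜) (m : M.carrier),
      ((shift 𝒜 k).obj M).d ((k.negOnePow : ℤ) • m : M.carrier) = M.d m := fun M m => by
    change (k.negOnePow : ℤ) • M.d ((k.negOnePow : ℤ) • m) = M.d m
    rw [map_zsmul, negOnePow_smul_smul]
  have hd' : ∀ (M : DGMod 𝒜) (m : M.carrier),
      ((shift 𝒜 k).obj M).d m = M.d ((k.negOnePow : ℤ) • m) := fun M m => (map_zsmul M.d _ m).symm
  have h0 : ∀ {M : DGMod 𝒜} (m : M.carrier), ((shift 𝒜 k).obj M).d m = 0 ↔ M.d m = 0 :=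
    fun {M} m => by
      change (k.negOnePow : ℤ) • M.d m = 0 ↔ _
      refine ⟨fun h => ?_, fun h => by rw [h, smul_zero]⟩
      rw [← negOnePow_smul_smul k (M.d m), h, smul_zero]
  refine and_congr ⟨fun H x hx y hy => ?_, fun H x hx y hy => ?_⟩
    ⟨fun H y hy => ?_, fun H y hy => ?_⟩
  · obtain ⟨s, hs, x', h⟩ := H x ((h0 x).2 hx) ((k.negOnePow : ℤ) • y : N.carrier)
      (hy.trans (hd N y).symm)
    exact ⟨s, hs, _, (hd' M x').symm.trans h⟩
  · obtain ⟨s, hs, x', h⟩ := H x ((h0 _).1 hx) _ (hy.trans (hd' N y))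
    exact ⟨s, hs, _, (hd M x').trans h⟩
  · obtain ⟨s, hs, x, hx, y', h⟩ := H y ((h0 y).2 hy)
    exact ⟨s, hs, x, (h0 _).1 hx, _, h.trans (congrArg (f.toLin x + ·) (hd' N y'))⟩
  · obtain ⟨s, hs, x, hx, y', h⟩ := H y ((h0 _).1 hy)
    exact ⟨s, hs, x, (h0 _).2 hx, _, h.trans (congrArg (f.toLin x + ·) (hd N y').symm)⟩

include S in
/-- The maps which become quasi-isomorphisms over the localization are stable under base change
along surjections. -/
theorem extendQuasiIso_pullbackSnd {P : DGMod 𝒜} {f : M ⟶ P} {g : N ⟶ P}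
    (hf : extendQuasiIso 𝒜 ℬ f) (hg : Function.Surjective g.toLin) :
    extendQuasiIso 𝒜 ℬ (pullbackSnd f g) := by
  obtain ⟨h1, h2⟩ := (extendQuasiIso_iff ℬ S).1 hf
  refine (extendQuasiIso_iff ℬ S).2 ⟨?_, fun n hn => ?_⟩
  · rintro ⟨⟨y, n⟩, hyn⟩ hx n' (hn' : n = N.d n')
    change f.toLin y = g.toLin n at hyn
    have hy : M.d y = 0 := congrArg (fun z => z.1.1) hx
    obtain ⟨s, hs, y', hy'⟩ := h1 y hy (g.toLin n') (by rw [hyn, hn', g.comm])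
    obtain ⟨t, ht, y'', hy'', z, hz⟩ := h2 (f.toLin y' - s • g.toLin n') (by
      rw [map_sub, map_smul, ← f.comm, ← g.comm, hy', map_smul, hyn, hn', sub_self])
    obtain ⟨w, rfl⟩ := hg z
    refine ⟨t * s, mul_mem ht hs, ⟨(t • y' - y'', (t * s) • n' + N.d w), ?_⟩,
      Subtype.ext (Prod.ext ?_ ?_)⟩
    · change f.toLin (t • y' - y'') = g.toLin ((t * s) • n' + N.d w)
      rw [map_sub, map_add, map_smul, map_smul, g.comm, mul_smul, sub_eq_iff_eq_add, add_assoc,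
        add_comm (P.d _), ← hz, smul_sub, add_sub_cancel]
    · change M.d (t • y' - y'') = (t * s) • y
      rw [map_sub, map_smul, hy', hy'', sub_zero, smul_smul]
    · change N.d ((t * s) • n' + N.d w) = (t * s) • n
      rw [map_add, N.d_d, add_zero, map_smul, hn']
  · obtain ⟨s, hs, y, hy, z, hz⟩ := h2 (g.toLin n) (by rw [← g.comm, hn, map_zero])
    obtain ⟨w, rfl⟩ := hg z
    refine ⟨s, hs, ⟨(y, s • n - N.d w), ?_⟩, Subtype.ext (Prod.ext hy ?_), w, ?_⟩
    · change f.toLin y = g.toLin (s • n - N.d w)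
      rw [map_sub, map_smul, g.comm, hz, add_sub_cancel_right]
    · change N.d (s • n - N.d w) = 0
      rw [map_sub, N.d_d, sub_zero, map_smul, hn, smul_zero]
    · exact (sub_add_cancel _ _).symm

end Torsion
end Localization
end DGMod

namespace DGMod

/-! ### Local objects and local equivalences -/

section Homotopy

variable {A : Type} [CommRing A] {𝒜 : ℤ → AddSubgroup A}

variable (𝒜) in
theorem homologyFunctor_inverts : (quasiIso 𝒜).IsInvertedBy (homologyFunctor 𝒜) :=
  fun _ _ f hf => by rwa [quasiIso_eq] at hf

variable (𝒜) in
/-- Homology, as a functor on the homotopy category. -/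
def derivedHomology : (quasiIso 𝒜).Localization ⥤ ModuleCat.{0} A :=
  Localization.lift (homologyFunctor 𝒜) (homologyFunctor_inverts 𝒜) (quasiIso 𝒜).Q

variable (𝒜) in
/-- On objects and morphisms coming from differential graded modules, `derivedHomology` is
homology. -/
def derivedHomologyIso : (quasiIso 𝒜).Q ⋙ derivedHomology 𝒜 ≅ homologyFunctor 𝒜 :=
  Localization.fac (homologyFunctor 𝒜) (homologyFunctor_inverts 𝒜) (quasiIso 𝒜).Q

/-- The map induced on homology by a morphism in the homotopy category. -/
def homologyOf {X Y : DGMod 𝒜} (φ : (quasiIso 𝒜).Q.obj X ⟶ (quasiIso 𝒜).Q.obj Y) :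
    X.homology →ₗ[A] Y.homology :=
  ((derivedHomologyIso 𝒜).inv.app X ≫ (derivedHomology 𝒜).map φ ≫
    (derivedHomologyIso 𝒜).hom.app Y).hom

theorem homologyOf_comp {X Y Z : DGMod 𝒜} (φ : (quasiIso 𝒜).Q.obj X ⟶ (quasiIso 𝒜).Q.obj Y)
    (ψ : (quasiIso 𝒜).Q.obj Y ⟶ (quasiIso 𝒜).Q.obj Z) :
    homologyOf (φ ≫ ψ) = homologyOf ψ ∘ₗ homologyOf φ := by
  have : (derivedHomologyIso 𝒜).inv.app X ≫ (derivedHomology 𝒜).map (φ ≫ ψ) ≫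
      (derivedHomologyIso 𝒜).hom.app Z = ((derivedHomologyIso 𝒜).inv.app X ≫
        (derivedHomology 𝒜).map φ ≫ (derivedHomologyIso 𝒜).hom.app Y) ≫
      ((derivedHomologyIso 𝒜).inv.app Y ≫ (derivedHomology 𝒜).map ψ ≫
        (derivedHomologyIso 𝒜).hom.app Z) := by
    rw [Category.assoc, Category.assoc, Iso.hom_inv_id_app_assoc, Functor.map_comp,
      Category.assoc]
  exact congrArg ModuleCat.Hom.hom this

theorem homologyOf_Q_map {X Y : DGMod 𝒜} (f : X ⟶ Y) :
    homologyOf ((quasiIso 𝒜).Q.map f) = homologyMap f := by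
  have := (derivedHomologyIso 𝒜).hom.naturality f
  change (derivedHomology 𝒜).map ((quasiIso 𝒜).Q.map f) ≫ _ = _ at this
  rw [homologyOf, this, Iso.inv_hom_id_app_assoc]
  rfl

/-- Only quasi-isomorphisms become invertible in the homotopy category. -/
theorem quasiIso_of_isIso_Q_map {X Y : DGMod 𝒜} (f : X ⟶ Y) [IsIso ((quasiIso 𝒜).Q.map f)] :
    quasiIso 𝒜 f := by
  rw [quasiIso_eq]
  have : IsIso (((quasiIso 𝒜).Q ⋙ derivedHomology 𝒜).map f) :=
    inferInstanceAs (IsIso ((derivedHomology 𝒜).map ((quasiIso 𝒜).Q.map f)))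
  exact (NatIso.isIso_map_iff (derivedHomologyIso 𝒜) f).1 this

theorem isIso_Q_map {X Y : DGMod 𝒜} {f : X ⟶ Y} (hf : quasiIso 𝒜 f) :
    IsIso ((quasiIso 𝒜).Q.map f) :=
  Localization.inverts (quasiIso 𝒜).Q (quasiIso 𝒜) f hf

/-- The projection of the cone of an identity to zero is a quasi-isomorphism. -/
theorem quasiIso_cone_id_zeroHom (F : DGMod 𝒜) :
    quasiIso 𝒜 (zeroHom (cone (𝟙 F)) (zero 𝒜)) := by
  refine quasiIso_iff.2 ⟨?_, fun y _ => ⟨0, map_zero _, 0, rfl⟩⟩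
  rintro ⟨a, b⟩ h _ _
  have h2 : a + F.d b = 0 := congrArg Prod.snd h
  refine ⟨(b, 0), Prod.ext ?_ ?_⟩
  · exact (eq_neg_of_add_eq_zero_left h2).symm
  · change b + F.d 0 = b
    rw [map_zero, add_zero]

/-- A morphism which factors through an acyclic module is zero in the homotopy category. -/
theorem Q_map_eq_zero_of_factors {X Y D : DGMod 𝒜} (hD : quasiIso 𝒜 (zeroHom D (zero 𝒜)))
    (f : X ⟶ D) (g : D ⟶ Y) : (quasiIso 𝒜).Q.map (f ≫ g) = (quasiIso 𝒜).Q.map (zeroHom X Y) := by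
  have := isIso_Q_map hD
  have h : (quasiIso 𝒜).Q.map f = (quasiIso 𝒜).Q.map (zeroHom X D) := by
    rw [← cancel_mono ((quasiIso 𝒜).Q.map (zeroHom D (zero 𝒜))), ← Functor.map_comp,
      ← Functor.map_comp, (zeroIsTerminal 𝒜).hom_ext (f ≫ _)]
  rw [Functor.map_comp, h, ← Functor.map_comp]
  congr 1
  exact hom_ext (LinearMap.ext fun _ => map_zero g.toLin)

variable [GradedRing 𝒜]

/-- The morphism `a ↦ a z` from a sphere determined by a cycle. -/
def ofCycle {Z : DGMod 𝒜} {k : ℤ} {z : Z.carrier} (hz : z ∈ Z.deg k) (hd : Z.d z = 0) :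
    (shift 𝒜 k).obj (unit 𝒜) ⟶ Z where
  toLin := LinearMap.toSpanSingleton A _ z
  map_mem {i a} ha := by
    have := Z.smul_mem (show a ∈ 𝒜 (i - k) from ha) hz
    rwa [sub_add_cancel] at this
  comm a := by
    change ((k.negOnePow : ℤ) • (0 : A)) • z = Z.d ((show A from a) • z)
    rw [map_smul, hd, smul_zero, smul_zero, zero_smul]

/-- The morphism from a sphere determined by a boundary is zero in the homotopy category. -/
theorem Q_map_ofCycle_eq_zero {Z : DGMod 𝒜} {k : ℤ} {z : Z.carrier} (hz : z ∈ Z.deg k)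
    (hd : Z.d z = 0) {y : Z.carrier} (hy : Z.d y = z) :
    (quasiIso 𝒜).Q.map (ofCycle hz hd) = (quasiIso 𝒜).Q.map (zeroHom _ Z) := by
  obtain ⟨y, hyk, hy⟩ := exists_homogeneous_d (i := k + 1) (by rwa [add_sub_cancel_right]) hy
  let F := (shift 𝒜 (-1)).obj Z
  have hF : ∀ m : Z.carrier, F.d m = -Z.d m := fun m => by
    change ((-1 : ℤ).negOnePow : ℤ) • Z.d m = -Z.d m
    simp
  -- the path object of `Z`: pairs `(z, y)` with `d (z, y) = (d z, z - d y)`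
  let g : cone (𝟙 F) ⟶ Z :=
    { toLin := LinearMap.fst A Z.carrier Z.carrier
      map_mem := fun {i m} hm => by
        have : (show Z.carrier from m.1) ∈ Z.deg (i - 1 - -1) := hm.1
        rwa [sub_neg_eq_add, sub_add_cancel] at this
      comm := fun m => by
        change -F.d m.1 = Z.d m.1
        exact (congrArg Neg.neg (hF m.1)).trans (neg_neg _) }
  let f : (shift 𝒜 k).obj (unit 𝒜) ⟶ cone (𝟙 F) :=
    { toLin := (LinearMap.toSpanSingleton A Z.carrier z).prod
        (LinearMap.toSpanSingleton A Z.carrier y)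
      map_mem := fun {i a} ha => by
        have h1 := Z.smul_mem (show a ∈ 𝒜 (i - k) from ha) hz
        have h2 := Z.smul_mem (show a ∈ 𝒜 (i - k) from ha) hyk
        rw [show i - k + k = i - 1 - -1 by ring] at h1
        rw [show i - k + (k + 1) = i - -1 by ring] at h2
        exact ⟨h1, h2⟩
      comm := fun a => by
        change A at a
        have h1 : F.d (a • z : Z.carrier) = (0 : Z.carrier) := by
          rw [hF, map_smul, hd, smul_zero, neg_zero]
        have h2 : F.d (a • y : Z.carrier) = -(a • z) := by rw [hF, map_smul, hy]
        have h3 : ∀ x : Z.carrier, ((k.negOnePow : ℤ) • (0 : A)) • x = 0 := fun x => by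
          rw [smul_zero, zero_smul]
        refine Prod.ext ((h3 z).trans (neg_eq_zero.2 h1).symm) ((h3 y).trans ?_)
        exact ((congrArg (a • z + ·) h2).trans (add_neg_cancel _)).symm }
  have h : ofCycle hz hd = f ≫ g := rfl
  rw [h]
  exact Q_map_eq_zero_of_factors (quasiIso_cone_id_zeroHom F) f g

end Homotopy

section Local

variable {A B : Type} [CommRing A] [CommRing B] [Algebra A B]
  (𝒜 : ℤ → AddSubgroup A) (ℬ : ℤ → AddSubgroup B)
  [GradedRing 𝒜] [GradedRing ℬ] [GradedAlgebraMap 𝒜 ℬ]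

variable {𝒜 ℬ}

theorem bijective_precomp_of_iso {C : Type*} [Category C] {X Y X' Y' Z : C} {f : X ⟶ Y}
    {f' : X' ⟶ Y'} (a : X ≅ X') (b : Y ≅ Y') (w : f ≫ b.hom = a.hom ≫ f')
    (h : Function.Bijective fun g : Y ⟶ Z => f ≫ g) :
    Function.Bijective fun g : Y' ⟶ Z => f' ≫ g := by
  have : (fun g : Y' ⟶ Z => f' ≫ g) = (fun g : X ⟶ Z => a.inv ≫ g) ∘ (fun g : Y ⟶ Z => f ≫ g) ∘
      fun g : Y' ⟶ Z => b.hom ≫ g := by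
    funext g
    simp only [Function.comp_apply]
    rw [← Category.assoc f, w, Category.assoc, Iso.inv_hom_id_assoc]
  rw [this]
  exact (a.homFromEquiv (Z := Z)).bijective.comp (h.comp (b.symm.homFromEquiv (Z := Z)).bijective)

theorem bijective_of_isLocalObject {Z : DGMod 𝒜}
    (hZ : IsLocalObject 𝒜 (shiftsOfAlgebraMap 𝒜 ℬ) Z) (k : ℤ) :
    Function.Bijective fun
      g : (quasiIso 𝒜).Q.obj ((shift 𝒜 k).obj (ofAlgebra 𝒜 ℬ)) ⟶ (quasiIso 𝒜).Q.obj Z =>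
        (quasiIso 𝒜).Q.map ((shift 𝒜 k).map (algebraMapHom 𝒜 ℬ)) ≫ g := by
  let e : ∀ X : DGMod 𝒜, (shift 𝒜 0).obj X ≅ X := fun X =>
    mkIso (LinearEquiv.refl A X.carrier)
      (fun {i m} hm => by rwa [show i = i - 0 by ring]) (fun {i m} hm => by
        rwa [show i = i - 0 by ring] at hm) (fun m => by
          change ((0 : ℤ).negOnePow : ℤ) • X.d m = X.d m
          simp)
  refine bijective_precomp_of_iso ((quasiIso 𝒜).Q.mapIso ((shift 𝒜 k).mapIso (e _)))
    ((quasiIso 𝒜).Q.mapIso ((shift 𝒜 k).mapIso (e _))) ?_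
    (hZ _ (MorphismProperty.ofHoms.mk (0 : ℤ)) k)
  rw [Functor.mapIso_hom, Functor.mapIso_hom, Functor.mapIso_hom, Functor.mapIso_hom,
    ← Functor.map_comp, ← Functor.map_comp, ← Functor.map_comp, ← Functor.map_comp]
  rfl

variable (𝒜 ℬ) in
/-- The homology classes of the shifts of `B`, which have zero differential. -/
def shiftClass (k : ℤ) : B →ₗ[A] ((shift 𝒜 k).obj (ofAlgebra 𝒜 ℬ)).homology where
  toFun b := Submodule.Quotient.mk ⟨b, smul_zero (k.negOnePow : ℤ)⟩
  map_add' _ _ := rfl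
  map_smul' _ _ := rfl

/-- Maps from spheres to a local module extend to shifts of `B`. -/
theorem exists_extension_of_isLocalObject {Z : DGMod 𝒜}
    (hZ : IsLocalObject 𝒜 (shiftsOfAlgebraMap 𝒜 ℬ) Z) {k : ℤ} {z : Z.carrier} (hz : z ∈ Z.deg k)
    (hd : Z.d z = 0) :
    ∃ φ : (quasiIso 𝒜).Q.obj ((shift 𝒜 k).obj (ofAlgebra 𝒜 ℬ)) ⟶ (quasiIso 𝒜).Q.obj Z,
      (quasiIso 𝒜).Q.map ((shift 𝒜 k).map (algebraMapHom 𝒜 ℬ)) ≫ φ =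
        (quasiIso 𝒜).Q.map (ofCycle hz hd) ∧
      ∀ a : A, homologyOf φ (shiftClass 𝒜 ℬ k (algebraMap A B a)) =
        a • (Submodule.Quotient.mk ⟨z, hd⟩ : Z.homology) := by
  obtain ⟨φ, hφ⟩ := (bijective_of_isLocalObject hZ k).2 ((quasiIso 𝒜).Q.map (ofCycle hz hd))
  refine ⟨φ, hφ, fun a => ?_⟩
  have h := congrArg homologyOf hφ
  rw [homologyOf_comp, homologyOf_Q_map, homologyOf_Q_map] at h
  exact congrArg (fun f => f (Submodule.Quotient.mk
    (⟨a, smul_zero (k.negOnePow : ℤ)⟩ : LinearMap.ker ((shift 𝒜 k).obj (unit 𝒜)).d))) h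

/-- If `u` is a fraction `e / c`, then on the homology of a local module every multiple of `e` is
divisible by `c`: extend the map from a sphere to a shift of `B` and evaluate it at `u`. -/
theorem exists_smul_eq_smul_of_isLocalObject {Z : DGMod 𝒜}
    (hZ : IsLocalObject 𝒜 (shiftsOfAlgebraMap 𝒜 ℬ) Z) {c e : A} {u : B}
    (hu : algebraMap A B c * u = algebraMap A B e) (x : Z.homology) :
    ∃ y : Z.homology, c • y = e • x := by
  obtain ⟨⟨z, hz⟩, rfl⟩ := Submodule.Quotient.mk_surjective _ x
  refine (cycle_induction (p := fun z => ∃ hz : z ∈ LinearMap.ker Z.d,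
    ∃ y : Z.homology, c • y = e • (Submodule.Quotient.mk ⟨z, hz⟩ : Z.homology)) z hz
    ⟨zero_mem _, 0, ?_⟩ (fun k z hzk hz' => ⟨hz', ?_⟩) ?_).2
  · rw [smul_zero]
    exact (smul_zero e).symm
  · obtain ⟨φ, -, hφ⟩ := exists_extension_of_isLocalObject hZ hzk hz'
    exact ⟨homologyOf φ (shiftClass 𝒜 ℬ k u), by
      rw [← map_smul, ← map_smul, Algebra.smul_def, hu, hφ]⟩
  · rintro z z' ⟨hz, y, hy⟩ ⟨hz', y', hy'⟩
    exact ⟨add_mem hz hz', y + y', by rw [smul_add, hy, hy', ← smul_add]; rfl⟩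

/-- Multiplication by a homogeneous element, on modules with zero differential. -/
def mulHom (M : DGMod 𝒜) (hM : M.d = 0) {i : ℤ} {c : A} (hc : c ∈ 𝒜 i) (k : ℤ) :
    (shift 𝒜 (i + k)).obj M ⟶ (shift 𝒜 k).obj M where
  toLin := LinearMap.lsmul A M.carrier c
  map_mem {j m} hm := by
    have := M.smul_mem hc (show m ∈ M.deg (j - (i + k)) from hm)
    rwa [show i + (j - (i + k)) = j - k by ring] at this
  comm m := by
    have h : ∀ m : M.carrier, M.d m = 0 := fun m => by rw [hM]; rfl
    change M.carrier at m
    change c • (((i + k).negOnePow : ℤ) • M.d m) = (k.negOnePow : ℤ) • M.d (c • (m : M.carrier))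
    rw [h, h, smul_zero, smul_zero, smul_zero]

/-- If `u` is a fraction `e / c`, then on the homology of a local module the elements killed by `c`
are killed by `e`: the extension to a shift of `B` of the map from a sphere given by such an element
vanishes on multiples of `c`. -/
theorem smul_eq_zero_of_isLocalObject {Z : DGMod 𝒜}
    (hZ : IsLocalObject 𝒜 (shiftsOfAlgebraMap 𝒜 ℬ) Z) {i : ℤ} {c e : A} (hc : c ∈ 𝒜 i) {u : B}
    (hu : algebraMap A B c * u = algebraMap A B e) {x : Z.homology} (hx : c • x = 0) :
    e • x = 0 := by
  have key : ∀ (k : ℤ) (z : Z.carrier), z ∈ Z.deg k → Z.d z = 0 → (∃ y, Z.d y = c • z) →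
      ∃ w, Z.d w = e • z := by
    rintro k z hzk hz ⟨y, hy⟩
    obtain ⟨φ, hφ, hφ'⟩ := exists_extension_of_isLocalObject hZ hzk hz
    have h0 : (quasiIso 𝒜).Q.map (mulHom (ofAlgebra 𝒜 ℬ) rfl hc k) ≫ φ =
        (quasiIso 𝒜).Q.map (zeroHom _ Z) := by
      refine (bijective_of_isLocalObject hZ (i + k)).1 ?_
      have h1 : (shift 𝒜 (i + k)).map (algebraMapHom 𝒜 ℬ) ≫ mulHom (ofAlgebra 𝒜 ℬ) rfl hc k =
          mulHom (unit 𝒜) rfl hc k ≫ (shift 𝒜 k).map (algebraMapHom 𝒜 ℬ) :=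
        hom_ext (LinearMap.ext fun a => ((Algebra.linearMap A B).map_smul c a).symm)
      have h2 : mulHom (unit 𝒜) rfl hc k ≫ ofCycle hzk hz =
          ofCycle (Z.smul_mem hc hzk) (by rw [map_smul, hz, smul_zero]) :=
        hom_ext (LinearMap.ext fun a => by
          change (c * (show A from a)) • z = (show A from a) • c • z
          rw [mul_comm, mul_smul])
      change _ ≫ _ ≫ φ = _ ≫ _
      rw [← Category.assoc, ← Functor.map_comp, h1, Functor.map_comp, Category.assoc, hφ,
        ← Functor.map_comp, h2, Q_map_ofCycle_eq_zero _ _ hy, ← Functor.map_comp]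
      congr 1
    have h3 := congrArg homologyOf h0
    rw [homologyOf_comp, homologyOf_Q_map, homologyOf_Q_map] at h3
    have h4 : homologyOf φ (shiftClass 𝒜 ℬ k (c • u)) = 0 :=
      congrArg (fun f => f (shiftClass 𝒜 ℬ (i + k) u)) h3
    rw [Algebra.smul_def, hu, hφ'] at h4
    exact homology_mk_eq_zero.1 h4
  obtain ⟨⟨z, hz⟩, rfl⟩ := Submodule.Quotient.mk_surjective _ x
  obtain ⟨y, hy⟩ := homology_mk_eq_zero.1 hx
  change Z.d y = c • z at hy
  have h : ∀ k, ∃ w, Z.d w = e • Z.proj k z := fun k =>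
    key k _ (Z.proj_mem k z) (Z.d_proj_eq_zero k hz) ⟨Z.proj (i + k + 1) y, by
      rw [← proj_d, hy, add_sub_cancel_right, proj_smul Z hc]⟩
  choose w hw using h
  obtain ⟨s, hs⟩ := Z.exists_sum_proj z
  refine homology_mk_eq_zero.2 ⟨∑ k ∈ s, w k, ?_⟩
  change _ = e • z
  rw [map_sum, Finset.sum_congr rfl fun k _ => hw k, ← Finset.smul_sum, hs]

/-- On the homology of a local module, `c e + 1 - e` acts bijectively whenever `e` is an idempotent
and `c` is invertible in the factor of `B` cut out by `e`. -/
theorem bijective_smul_of_isLocalObject {Z : DGMod 𝒜}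
    (hZ : IsLocalObject 𝒜 (shiftsOfAlgebraMap 𝒜 ℬ) Z) {i : ℤ} {c e : A} (hc : c ∈ 𝒜 i)
    (he : e * e = e) {u : B} (hu : algebraMap A B c * u = algebraMap A B e) :
    Function.Bijective fun x : Z.homology => (c * e + 1 - e) • x := by
  refine ⟨(injective_iff_map_eq_zero (LinearMap.lsmul A Z.homology (c * e + 1 - e))).2
    fun x hx => ?_, fun x => ?_⟩
  · change (c * e + 1 - e) • x = 0 at hx
    have h1 : c • e • x = 0 := by
      have := congrArg (e • ·) hx
      simp only [smul_smul, smul_zero] at this ⊢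
      rwa [show e * (c * e + 1 - e) = c * e by linear_combination (c - 1) * he] at this
    have h2 : e • x = 0 := by
      rw [← he, mul_smul]
      exact smul_eq_zero_of_isLocalObject hZ hc hu h1
    rwa [sub_smul, add_smul, mul_smul, h2, smul_zero, one_smul, zero_add, sub_zero] at hx
  · obtain ⟨y, hy⟩ := exists_smul_eq_smul_of_isLocalObject hZ hu x
    refine ⟨e • y + (1 - e) • x, ?_⟩
    have h1 : (c * e + 1 - e) * e = e * c := by linear_combination (c - 1) * he
    have h2 : (c * e + 1 - e) * (1 - e) = 1 - e := by linear_combination (1 - c) * he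
    change (c * e + 1 - e) • (e • y + (1 - e) • x) = x
    rw [smul_add, smul_smul, smul_smul, h1, h2, mul_smul, hy, smul_smul, he, ← add_smul,
      add_sub_cancel, one_smul]

variable [EvenlyGraded 𝒜] [EvenlyGraded ℬ]

variable (𝒜 ℬ) in
/-- Extension and restriction of scalars preserve quasi-isomorphisms, so that the adjunction passes
to homotopy categories; there, mapping into a restricted module is the same as extending scalars
first. -/
theorem bijective_restrict_iff (hL : quasiIso 𝒜 ≤ extendQuasiIso 𝒜 ℬ) {X Y : DGMod 𝒜} (f : X ⟶ Y)
    (N : DGMod ℬ) :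
    (Function.Bijective fun
      g : (quasiIso 𝒜).Q.obj Y ⟶ (quasiIso 𝒜).Q.obj ((restrictScalars 𝒜 ℬ).obj N) =>
        (quasiIso 𝒜).Q.map f ≫ g) ↔
    Function.Bijective fun
      g : (quasiIso ℬ).Q.obj ((extendScalars 𝒜 ℬ).obj Y) ⟶ (quasiIso ℬ).Q.obj N =>
        (quasiIso ℬ).Q.map ((extendScalars 𝒜 ℬ).map f) ≫ g := by
  let Φ : LocalizerMorphism (quasiIso 𝒜) (quasiIso ℬ) := ⟨extendScalars 𝒜 ℬ, hL⟩
  let Ψ : LocalizerMorphism (quasiIso ℬ) (quasiIso 𝒜) :=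
    ⟨restrictScalars 𝒜 ℬ, fun _ _ f hf => (quasiIso_restrict_iff 𝒜 ℬ f).2 hf⟩
  let L' := Φ.localizedFunctor (quasiIso 𝒜).Q (quasiIso ℬ).Q
  let R' := Ψ.localizedFunctor (quasiIso ℬ).Q (quasiIso 𝒜).Q
  let iL : CatCommSq (extendScalars 𝒜 ℬ) (quasiIso 𝒜).Q (quasiIso ℬ).Q L' := Φ.catCommSq _ _
  let iR : CatCommSq (restrictScalars 𝒜 ℬ) (quasiIso ℬ).Q (quasiIso 𝒜).Q R' := Ψ.catCommSq _ _
  let adj : L' ⊣ R' := (extendRestrictAdj 𝒜 ℬ).localization (quasiIso 𝒜).Q (quasiIso 𝒜)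
    (quasiIso ℬ).Q (quasiIso ℬ) L' R'
  let eL := iL.iso
  let eR : (quasiIso 𝒜).Q.obj ((restrictScalars 𝒜 ℬ).obj N) ≅ R'.obj ((quasiIso ℬ).Q.obj N) :=
    iR.iso.app N
  -- `Hom(Q X, Q (R N)) ≃ Hom(Q X, R' (Q N)) ≃ Hom(L' (Q X), Q N) ≃ Hom(Q (L X), Q N)`
  let e : ∀ X : DGMod 𝒜, ((quasiIso 𝒜).Q.obj X ⟶
      (quasiIso 𝒜).Q.obj ((restrictScalars 𝒜 ℬ).obj N)) ≃
      ((quasiIso ℬ).Q.obj ((extendScalars 𝒜 ℬ).obj X) ⟶ (quasiIso ℬ).Q.obj N) := fun X =>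
    (eR.homToEquiv).trans ((adj.homEquiv _ _).symm.trans ((eL.app X).symm.homFromEquiv))
  have h : ∀ g, e X ((quasiIso 𝒜).Q.map f ≫ g) =
      (quasiIso ℬ).Q.map ((extendScalars 𝒜 ℬ).map f) ≫ e Y g := fun g => by
    have := eL.hom.naturality f
    simp only [Iso.homToEquiv, Iso.homFromEquiv, Functor.comp_obj, Iso.symm_inv, Iso.app_hom,
      Iso.symm_hom, Iso.app_inv, Equiv.trans_apply, Equiv.coe_fn_mk, Category.assoc,
      adj.homEquiv_naturality_left_symm, e]
    exact ((reassoc_of% this) _).symm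
  have h' : ((fun g : (quasiIso ℬ).Q.obj ((extendScalars 𝒜 ℬ).obj Y) ⟶ (quasiIso ℬ).Q.obj N =>
      (quasiIso ℬ).Q.map ((extendScalars 𝒜 ℬ).map f) ≫ g) ∘ e Y) = e X ∘ fun
        g : (quasiIso 𝒜).Q.obj Y ⟶ (quasiIso 𝒜).Q.obj ((restrictScalars 𝒜 ℬ).obj N) =>
          (quasiIso 𝒜).Q.map f ≫ g := funext fun g => (h g).symm
  rw [← Function.Bijective.of_comp_iff' (e X).bijective, ← h',
    Function.Bijective.of_comp_iff _ (e Y).bijective]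

variable (S : Submonoid A) [IsLocalization S B]

variable (𝒜) in
include S in
/-- Restrictions of differential graded `B`-modules see exactly the maps which become
quasi-isomorphisms over `B`. -/
theorem extendQuasiIso_iff_bijective {X Y : DGMod 𝒜} (f : X ⟶ Y) :
    extendQuasiIso 𝒜 ℬ f ↔ ∀ N : DGMod ℬ, Function.Bijective fun
      g : (quasiIso 𝒜).Q.obj Y ⟶ (quasiIso 𝒜).Q.obj ((restrictScalars 𝒜 ℬ).obj N) =>
        (quasiIso 𝒜).Q.map f ≫ g := by
  simp only [bijective_restrict_iff 𝒜 ℬ (quasiIso_le_extendQuasiIso ℬ S)]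
  refine ⟨fun hf N => ?_, fun h => ?_⟩
  · have := isIso_Q_map hf
    exact ((asIso ((quasiIso ℬ).Q.map ((extendScalars 𝒜 ℬ).map f))).symm.homFromEquiv).bijective
  · have : IsIso ((quasiIso ℬ).Q.map ((extendScalars 𝒜 ℬ).map f)) := by
      obtain ⟨g, hg⟩ := (h ((extendScalars 𝒜 ℬ).obj X)).2 (𝟙 _)
      refine ⟨g, hg, (h ((extendScalars 𝒜 ℬ).obj Y)).1 ?_⟩
      change _ ≫ g = 𝟙 _ at hg
      change _ ≫ g ≫ _ = _ ≫ 𝟙 _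
      rw [← Category.assoc, hg, Category.id_comp, Category.comp_id]
    exact quasiIso_of_isIso_Q_map _

variable (𝒜) in
include S in
theorem inducesIso_restrict {X Y : DGMod 𝒜} {f : X ⟶ Y} (hf : extendQuasiIso 𝒜 ℬ f)
    (N : DGMod ℬ) : InducesIso 𝒜 f ((restrictScalars 𝒜 ℬ).obj N) := fun k =>
  (extendQuasiIso_iff_bijective 𝒜 S _).1 ((extendQuasiIso_shift_iff ℬ S k).2 hf) N

variable (𝒜) in
include S in
theorem isLocalObject_restrict (N : DGMod ℬ) :
    IsLocalObject 𝒜 (shiftsOfAlgebraMap 𝒜 ℬ) ((restrictScalars 𝒜 ℬ).obj N) := by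
  rintro _ _ _ ⟨k⟩
  exact inducesIso_restrict 𝒜 S
    ((extendQuasiIso_shift_iff ℬ S k).2 (extendQuasiIso_algebraMapHom 𝒜 ℬ S)) N

/-- If `S` acts bijectively on the homology of local modules, then the local equivalences are the
maps which become quasi-isomorphisms over the localization of `A` at `S`. -/
theorem localEquivalences_eq (hS : ∀ Z : DGMod 𝒜, IsLocalObject 𝒜 (shiftsOfAlgebraMap 𝒜 ℬ) Z →
      ∀ s ∈ S, Function.Bijective fun x : Z.homology => s • x) :
    localEquivalences 𝒜 (shiftsOfAlgebraMap 𝒜 ℬ) = extendQuasiIso 𝒜 ℬ := by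
  ext X Y f
  refine ⟨fun h => ?_, fun h Z hZ k => ?_⟩
  · exact (extendQuasiIso_shift_iff ℬ S 0).1 ((extendQuasiIso_iff_bijective 𝒜 S _).2 fun N =>
      h _ (isLocalObject_restrict 𝒜 S N) 0)
  · -- a local module is quasi-isomorphic to the restriction of its extension
    have hη : quasiIso 𝒜 ((extendRestrictAdj 𝒜 ℬ).unit.app Z) :=
      quasiIso_of_extendQuasiIso ℬ S (extendQuasiIso_unit ℬ S Z) (hS Z hZ)
        fun s hs => bijective_smul_homology_restrict 𝒜 S _ hs
    have := isIso_Q_map hη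
    let e : (quasiIso 𝒜).Q.obj Z ≅
        (quasiIso 𝒜).Q.obj ((restrictScalars 𝒜 ℬ).obj ((extendScalars 𝒜 ℬ).obj Z)) :=
      asIso ((quasiIso 𝒜).Q.map ((extendRestrictAdj 𝒜 ℬ).unit.app Z))
    have h1 := inducesIso_restrict 𝒜 S h ((extendScalars 𝒜 ℬ).obj Z) k
    have h2 : e.homToEquiv ∘ (fun g : (quasiIso 𝒜).Q.obj ((shift 𝒜 k).obj Y) ⟶
          (quasiIso 𝒜).Q.obj Z => (quasiIso 𝒜).Q.map ((shift 𝒜 k).map f) ≫ g) =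
        (fun g => (quasiIso 𝒜).Q.map ((shift 𝒜 k).map f) ≫ g) ∘ e.homToEquiv :=
      funext fun g => Category.assoc ((quasiIso 𝒜).Q.map ((shift 𝒜 k).map f)) g e.hom
    rw [← Function.Bijective.of_comp_iff' e.homToEquiv.bijective, h2]
    exact h1.comp e.homToEquiv.bijective

end Local
end DGMod

namespace DGMod

/-! ### The localized model structure -/

section Localized

variable {A B : Type} [CommRing A] [CommRing B] [Algebra A B]
  (𝒜 : ℤ → AddSubgroup A) (ℬ : ℤ → AddSubgroup B)
  [GradedRing 𝒜] [EvenlyGraded 𝒜] [GradedRing ℬ] [EvenlyGraded ℬ] [GradedAlgebraMap 𝒜 ℬ]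

/-- The model structure on differential graded `A`-modules with the cofibrations of the projective
model structure whose weak equivalences are the maps which become quasi-isomorphisms over `B`. -/
abbrev extendModel : ModelData (DGMod 𝒜) where
  weq := extendQuasiIso 𝒜 ℬ
  cof := projCof 𝒜
  fib := (projCof 𝒜 ⊓ extendQuasiIso 𝒜 ℬ).rlp

variable {𝒜 ℬ}

/-- Extension of scalars preserves cofibrations. -/
theorem projCof_extend {X Y : DGMod 𝒜} {i : X ⟶ Y} (hi : projCof 𝒜 i) :
    projCof ℬ ((extendScalars 𝒜 ℬ).map i) := fun _ _ p hp =>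
  ((extendRestrictAdj 𝒜 ℬ).hasLiftingProperty_iff i p).2
    (hi _ ⟨hp.1, (quasiIso_restrict_iff 𝒜 ℬ p).2 hp.2⟩)

/-- Extension of scalars preserves cofibrant objects. -/
theorem cofibrant_extend {X : DGMod 𝒜} (hX : (projective 𝒜).Cofibrant X) :
    (projective ℬ).Cofibrant ((extendScalars 𝒜 ℬ).obj X) := by
  refine cofibrant_iff.2 fun {W Z} p hp v => ?_
  obtain ⟨w, hw⟩ := cofibrant_iff.1 hX ((restrictScalars 𝒜 ℬ).map p)
    ⟨hp.1, (quasiIso_restrict_iff 𝒜 ℬ p).2 hp.2⟩ ((extendRestrictAdj 𝒜 ℬ).homEquiv _ _ v)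
  refine ⟨((extendRestrictAdj 𝒜 ℬ).homEquiv _ _).symm w, ?_⟩
  rw [← Adjunction.homEquiv_naturality_right_symm, hw, Equiv.symm_apply_apply]

/-- Restrictions of surjections are fibrations of the localized model structure. -/
theorem extendModel_fib_restrict {M N : DGMod ℬ} {p : M ⟶ N} (hp : surjections ℬ p) :
    (extendModel 𝒜 ℬ).fib ((restrictScalars 𝒜 ℬ).map p) := fun _ _ i hi =>
  ((extendRestrictAdj 𝒜 ℬ).hasLiftingProperty_iff i p).1
    ((trivialCofibration_iff _).1 ⟨projCof_extend hi.1, hi.2⟩ p hp)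

variable (S : Submonoid A) [IsLocalization S B]

variable (𝒜 ℬ) in
include S in
theorem extendModel_fib_inf_weq :
    (extendModel 𝒜 ℬ).fib ⊓ (extendModel 𝒜 ℬ).weq = surjections 𝒜 ⊓ quasiIso 𝒜 := by
  ext X Y p
  refine ⟨fun ⟨hp, hp'⟩ => ?_, fun hp => ⟨fun _ _ i hi => hi.1 p hp,
    quasiIso_le_extendQuasiIso ℬ S _ hp.2⟩⟩
  obtain ⟨⟨Z, i, q, fac, hi, hq⟩⟩ := MorphismProperty.HasFactorization.nonempty_mapFactorizationData
    (W₁ := projCof 𝒜) (W₂ := surjections 𝒜 ⊓ quasiIso 𝒜) p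
  have hi' : extendQuasiIso 𝒜 ℬ i := (extendQuasiIso 𝒜 ℬ).of_postcomp i q
    (quasiIso_le_extendQuasiIso ℬ S _ hq.2) (by rwa [fac])
  have := hp i ⟨hi, hi'⟩
  exact MorphismProperty.of_retract (RetractArrow.ofRightLiftingProperty fac) hq

include S in
/-- Every map is a trivial cofibration of the localized model structure followed by a fibration:
pull back a factorization over `B` along the unit, and replace the resulting map by a
cofibration. -/
theorem exists_factorization_extendModel {X Y : DGMod 𝒜} (f : X ⟶ Y) :
    ∃ (Z : DGMod 𝒜) (i : X ⟶ Z) (p : Z ⟶ Y), (projCof 𝒜 ⊓ extendQuasiIso 𝒜 ℬ) i ∧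
      (extendModel 𝒜 ℬ).fib p ∧ i ≫ p = f := by
  obtain ⟨N, j, q, -, hj, hq, fac⟩ :=
    exists_factorization_surjection ((extendScalars 𝒜 ℬ).map f)
  let η := (extendRestrictAdj 𝒜 ℬ).unit
  let R := restrictScalars 𝒜 ℬ
  let l : X ⟶ pullbackObj (η.app Y) (R.map q) := pullbackLift f (η.app X ≫ R.map j) (by
    rw [Category.assoc, ← R.map_comp, fac]
    exact η.naturality f)
  have hl : extendQuasiIso 𝒜 ℬ l :=
    (extendQuasiIso 𝒜 ℬ).of_postcomp l (pullbackSnd (η.app Y) (R.map q))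
      (extendQuasiIso_pullbackSnd ℬ S (extendQuasiIso_unit ℬ S Y) hq)
      (MorphismProperty.comp_mem (extendQuasiIso 𝒜 ℬ) (η.app X) (R.map j)
        (extendQuasiIso_unit ℬ S X) ((extendQuasiIso_restrict_iff 𝒜 ℬ S j).2 hj))
  obtain ⟨⟨Z, i, p, hip, hi, hp⟩⟩ := MorphismProperty.HasFactorization.nonempty_mapFactorizationData
    (W₁ := projCof 𝒜) (W₂ := surjections 𝒜 ⊓ quasiIso 𝒜) l
  refine ⟨Z, i, p ≫ pullbackFst (η.app Y) (R.map q), ⟨hi, ?_⟩, ?_, ?_⟩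
  · exact (extendQuasiIso 𝒜 ℬ).of_postcomp i p (quasiIso_le_extendQuasiIso ℬ S _ hp.2)
      (by rwa [hip])
  · refine MorphismProperty.comp_mem (MorphismProperty.rlp _) _ _ (fun _ _ i hi => hi.1 p hp) ?_
    exact MorphismProperty.of_isPullback (isPullback_pullbackObj (η.app Y) (R.map q)).flip
      (extendModel_fib_restrict hq)
  · rw [← Category.assoc, hip]
    rfl

variable (𝒜 ℬ) in
include S in
theorem extendModel_isModelCategory : (extendModel 𝒜 ℬ).IsModelCategory := by
  refine .of_isWeakFactorizationSystem _
    (inferInstanceAs (extendQuasiIso 𝒜 ℬ).HasTwoOutOfThreeProperty) ?_ ?_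
  · rw [extendModel_fib_inf_weq 𝒜 ℬ S]
    exact inferInstanceAs (MorphismProperty.IsWeakFactorizationSystem (projective 𝒜).cof
      ((projective 𝒜).fib ⊓ (projective 𝒜).weq))
  · have : MorphismProperty.HasFactorization (projCof 𝒜 ⊓ extendQuasiIso 𝒜 ℬ)
        (projCof 𝒜 ⊓ extendQuasiIso 𝒜 ℬ).rlp :=
      ⟨fun f => by
        obtain ⟨Z, i, p, hi, hp, fac⟩ := exists_factorization_extendModel (ℬ := ℬ) S f
        exact ⟨⟨Z, i, p, fac, hi, hp⟩⟩⟩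
    exact ⟨rfl, MorphismProperty.llp_eq_of_le_llp_of_hasFactorization_of_isStableUnderRetracts
      ((MorphismProperty.le_llp_iff_le_rlp _ _).2 le_rfl), this⟩

/-- Extension of scalars turns a pushout product into the pushout product of the extensions. -/
theorem extendQuasiIso_pushoutProduct {C D K L P : DGMod 𝒜} {i : C ⟶ D} {k : K ⟶ L}
    (hi : projCof 𝒜 i) (hk : projCof 𝒜 k) {inl : D ⊗ K ⟶ P} {inr : C ⊗ L ⟶ P}
    (hP : IsPushout (i ▷ K) (C ◁ k) inl inr) {p : P ⟶ D ⊗ L} (h1 : inl ≫ p = D ◁ k)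
    (h2 : inr ≫ p = i ▷ L) (h : extendQuasiIso 𝒜 ℬ i ∨ extendQuasiIso 𝒜 ℬ k) :
    extendQuasiIso 𝒜 ℬ p := by
  let F := extendScalars 𝒜 ℬ
  have : PreservesColimitsOfSize.{0, 0} F :=
    (extendRestrictAdj 𝒜 ℬ).leftAdjoint_preservesColimits
  let μ := Functor.Monoidal.μIso F
  have hP' : IsPushout (F.map i ▷ F.obj K) (F.obj C ◁ F.map k) ((μ D K).hom ≫ F.map inl)
      ((μ C L).hom ≫ F.map inr) :=
    (hP.map F).of_iso' (μ C K) (μ D K) (μ C L) (Iso.refl _)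
      (Functor.LaxMonoidal.μ_natural_left F i K).symm
      (Functor.LaxMonoidal.μ_natural_right F C k).symm
      (Category.comp_id _).symm (Category.comp_id _).symm
  have h1' : ((μ D K).hom ≫ F.map inl) ≫ F.map p ≫ (μ D L).inv = F.obj D ◁ F.map k := by
    rw [← Category.assoc, Iso.comp_inv_eq, Category.assoc, ← F.map_comp, h1]
    exact (Functor.LaxMonoidal.μ_natural_right F D k).symm
  have h2' : ((μ C L).hom ≫ F.map inr) ≫ F.map p ≫ (μ D L).inv = F.map i ▷ F.obj L := by
    rw [← Category.assoc, Iso.comp_inv_eq, Category.assoc, ← F.map_comp, h2]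
    exact (Functor.LaxMonoidal.μ_natural_left F i L).symm
  have key : quasiIso ℬ (F.map p ≫ (μ D L).inv) := by
    rcases h with h | h
    · exact ((trivialCofibration_iff _).2 (pushoutProduct_trivial_left
        ((trivialCofibration_iff _).1 ⟨projCof_extend hi, h⟩) (projCof_extend hk) hP' h1' h2')).2
    · exact ((trivialCofibration_iff _).2 (pushoutProduct_trivial_right (projCof_extend hi)
        ((trivialCofibration_iff _).1 ⟨projCof_extend hk, h⟩) hP' h1' h2')).2
  exact ((quasiIso ℬ).cancel_right_of_respectsIso (F.map p) (μ D L).inv).1 key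

variable (𝒜 ℬ) in
include S in
/-- The localized model structure is symmetric monoidal. -/
theorem extendModel_isSymmetricMonoidal : (extendModel 𝒜 ℬ).IsSymmetricMonoidal where
  isModelCategory := extendModel_isModelCategory 𝒜 ℬ S
  closed := ⟨inferInstance⟩
  pushout_product i k hi hk inl inr hP p h1 h2 :=
    ⟨pushoutProduct_cof hi hk hP h1 h2, extendQuasiIso_pushoutProduct hi hk hP h1 h2⟩
  unit {Q X} q hQ hq hX := by
    let F := extendScalars 𝒜 ℬ
    have h : quasiIso ℬ (F.map q ▷ F.obj X) := quasiIso_whiskerRight hq (cofibrant_extend hQ)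
      (cofibrant_extend (cofibrant_unit 𝒜)) (cofibrant_extend hX)
    have h' : extendQuasiIso 𝒜 ℬ (q ▷ X) := by
      rw [← (quasiIso ℬ).cancel_right_of_respectsIso _ (Functor.Monoidal.μIso F (𝟙_ _) X).hom] at h
      change quasiIso ℬ (F.map q ▷ F.obj X ≫ Functor.LaxMonoidal.μ F (𝟙_ _) X) at h
      rw [Functor.LaxMonoidal.μ_natural_left] at h
      exact ((quasiIso ℬ).cancel_left_of_respectsIso (Functor.Monoidal.μIso F Q X).hom _).1 h
    exact ⟨h', (whiskerLeft_iff_whiskerRight (W := extendQuasiIso 𝒜 ℬ) q X).2 h'⟩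

variable (𝒜 ℬ) in
include S in
/-- Extension and restriction of scalars form a Quillen equivalence between the localized model
structure and the projective model structure over the localization. -/
theorem extendModel_isQuillenEquivalence :
    ModelData.IsQuillenEquivalence (extendModel 𝒜 ℬ) (projective ℬ) (extendRestrictAdj 𝒜 ℬ) where
  map_cof _ hf := projCof_extend hf
  map_trivial_cof _ _ hf := hf
  weq_iff {X Y} _ _ f := by
    rw [Adjunction.homEquiv_unit]
    exact (extendQuasiIso_restrict_iff 𝒜 ℬ S f).symm.trans
      ⟨fun h => MorphismProperty.comp_mem _ _ _ (extendQuasiIso_unit ℬ S X) h,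
        fun h => MorphismProperty.of_precomp _ _ _ (extendQuasiIso_unit ℬ S X) h⟩

variable (𝒜 ℬ) in
include S in
theorem extendModel_isSymmetricMonoidalQuillenEquivalence :
    ModelData.IsSymmetricMonoidalQuillenEquivalence (extendModel 𝒜 ℬ) (projective ℬ)
      (extendRestrictAdj 𝒜 ℬ) where
  left := extendModel_isSymmetricMonoidal 𝒜 ℬ S
  right := projective_isSymmetricMonoidal ℬ
  quillen := extendModel_isQuillenEquivalence 𝒜 ℬ S
  unit _ _ hq := ((quasiIso ℬ).cancel_right_of_respectsIso _ _).2 hq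

/-- If `S` acts bijectively on the homology of local modules, then extension and restriction of
scalars form a symmetric monoidal Quillen equivalence between the left Bousfield localization at
the shifts of `A → B` and the projective model structure over `B`. -/
theorem leftBousfield_isSymmetricMonoidalQuillenEquivalence
    (hS : ∀ Z : DGMod 𝒜, IsLocalObject 𝒜 (shiftsOfAlgebraMap 𝒜 ℬ) Z →
      ∀ s ∈ S, Function.Bijective fun x : Z.homology => s • x) :
    ModelData.IsSymmetricMonoidalQuillenEquivalence
      (leftBousfield 𝒜 (shiftsOfAlgebraMap 𝒜 ℬ)) (projective ℬ) (extendRestrictAdj 𝒜 ℬ) := by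
  rw [leftBousfield, localEquivalences_eq S hS]
  exact extendModel_isSymmetricMonoidalQuillenEquivalence 𝒜 ℬ S

end Localized
end DGMod

namespace EulerRings

/-! ### The ring `ℰ⁻¹𝒪_ℱ` as a localization -/

open LaurentPolynomial

theorem c_mul_cInv (n : ℕ+) : c * cInv n = C (Pi.single n 1) := by
  rw [c, cInv, mul_left_comm, ← T_add]
  simp

/-- The idempotent of `𝒪_ℱ` which cuts out the factor `n`. -/
def idem (n : ℕ+) : OF := algebraMap R OF (Pi.single n 1)

theorem coe_idem (n : ℕ+) : (idem n : R[T;T⁻¹]) = C (Pi.single n 1) := rfl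

theorem idem_mul_idem (n : ℕ+) : idem n * idem n = idem n := by
  rw [idem, ← map_mul, ← Pi.single_mul, one_mul]

/-- The element `c` of `𝒪_ℱ`. -/
def cOF : OF := ⟨c, Algebra.subset_adjoin rfl⟩

theorem cInv_mem (n : ℕ+) : cInv n ∈ EOF :=
  le_iSup OFInv n (Algebra.subset_adjoin (Or.inr ⟨n, le_refl n, rfl⟩))

/-- The Euler class which is `c_n` in the factor `n` and `1` in the other factors. -/
def euler (n : ℕ+) : OF := cOF * idem n + 1 - idem n

/-- The multiplicative set generated by the Euler classes. -/
def eulerSubmonoid : Submonoid OF := Submonoid.closure (Set.range euler)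

theorem coe_j (f : OF) : ((j f : EOF) : R[T;T⁻¹]) = f :=
  Subalgebra.coe_inclusion (h := OF_le_EOF) f

theorem coe_algebraMap (f : OF) : ((algebraMap OF EOF f : EOF) : R[T;T⁻¹]) = f := by
  rw [show algebraMap OF EOF = j from RingHom.algebraMap_toAlgebra j, coe_j]

theorem algebraMap_injective : Function.Injective (algebraMap OF EOF) := fun f g h =>
  Subtype.ext (by rw [← coe_algebraMap f, h, coe_algebraMap])

theorem coe_euler (n : ℕ+) : (euler n : R[T;T⁻¹]) = c * C (Pi.single n 1) + 1 - C (Pi.single n 1) :=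
  rfl

theorem C_single_mul_self (n : ℕ+) :
    (C (Pi.single n 1) : R[T;T⁻¹]) * C (Pi.single n 1) = C (Pi.single n 1) :=
  congrArg Subtype.val (idem_mul_idem n)

theorem cInv_mul_C_single (n : ℕ+) : cInv n * C (Pi.single n 1) = cInv n := by
  rw [cInv, mul_right_comm, C_single_mul_self]

theorem isUnit_algebraMap_euler (n : ℕ+) : IsUnit (algebraMap OF EOF (euler n)) := by
  refine IsUnit.of_mul_eq_one (⟨cInv n, cInv_mem n⟩ + 1 - algebraMap OF EOF (idem n))
    (Subtype.ext ?_)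
  rw [Subalgebra.coe_mul, Subalgebra.coe_sub, Subalgebra.coe_add, Subalgebra.coe_one,
    coe_algebraMap, coe_algebraMap, coe_euler, coe_idem]
  have h1 := c_mul_cInv n
  have h2 := C_single_mul_self n
  have h3 := cInv_mul_C_single n
  linear_combination (C (Pi.single n 1)) * h1 - h3 + (2 - c) * h2

/-- Every element of `ℰ⁻¹𝒪_ℱ` is a fraction. -/
theorem exists_mul_euler_mem {f : R[T;T⁻¹]} (hf : f ∈ EOF) :
    ∃ s ∈ eulerSubmonoid, f * (s : R[T;T⁻¹]) ∈ OF := by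
  rw [EOF_eq] at hf
  induction hf using Algebra.adjoin_induction with
  | mem x hx =>
    obtain ⟨m, rfl | ⟨n, -, rfl⟩⟩ := Set.mem_iUnion.1 hx
    · exact ⟨1, one_mem _, by rw [Subalgebra.coe_one, mul_one]; exact cOF.2⟩
    · refine ⟨euler n, Submonoid.subset_closure ⟨n, rfl⟩, ?_⟩
      have : cInv n * (euler n : R[T;T⁻¹]) = C (Pi.single n 1) := by
        rw [coe_euler]
        linear_combination (C (Pi.single n 1)) * c_mul_cInv n + C_single_mul_self n -
          cInv_mul_C_single n
      rw [this]
      exact (idem n).2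
  | algebraMap r => exact ⟨1, one_mem _, by
    rw [Subalgebra.coe_one, mul_one]; exact Subalgebra.algebraMap_mem OF r⟩
  | add x y _ _ hx hy =>
    obtain ⟨s, hs, hx⟩ := hx
    obtain ⟨t, ht, hy⟩ := hy
    refine ⟨s * t, mul_mem hs ht, ?_⟩
    have : (x + y) * ((s * t : OF) : R[T;T⁻¹]) = x * s * t + y * t * (s : R[T;T⁻¹]) := by
      rw [Subalgebra.coe_mul]; ring
    rw [this]
    exact add_mem (mul_mem hx t.2) (mul_mem hy s.2)
  | mul x y _ _ hx hy =>
    obtain ⟨s, hs, hx⟩ := hx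
    obtain ⟨t, ht, hy⟩ := hy
    refine ⟨s * t, mul_mem hs ht, ?_⟩
    have : (x * y) * ((s * t : OF) : R[T;T⁻¹]) = x * s * (y * (t : R[T;T⁻¹])) := by
      rw [Subalgebra.coe_mul]; ring
    rw [this]
    exact mul_mem hx hy

instance : IsLocalization eulerSubmonoid EOF where
  map_units := by
    rintro ⟨s, hs⟩
    induction hs using Submonoid.closure_induction with
    | mem x hx =>
      obtain ⟨n, rfl⟩ := hx
      exact isUnit_algebraMap_euler n
    | one => exact (map_one (algebraMap OF EOF)).symm ▸ isUnit_one
    | mul x y _ _ hx hy => exact (map_mul (algebraMap OF EOF) x y).symm ▸ hx.mul hy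
  surj := by
    rintro ⟨f, hf⟩
    obtain ⟨s, hs, h⟩ := exists_mul_euler_mem hf
    exact ⟨(⟨f * s, h⟩, ⟨s, hs⟩), Subtype.ext (by
      rw [Subalgebra.coe_mul, coe_algebraMap, coe_algebraMap])⟩
  exists_of_eq h := ⟨1, by rw [algebraMap_injective h]⟩

theorem cOF_mem : cOF ∈ grading OF (-2) := fun k hk => by
  have : k = 1 := by
    by_contra h
    refine hk ?_
    change (T 1 : R[T;T⁻¹]).coeff k = 0
    rw [T_apply, if_neg (Ne.symm h)]
  rw [this]
  norm_num

/-- The Euler classes act bijectively on the homology of local modules. -/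
theorem bijective_smul {Z : DGMod (grading OF)}
    (hZ : DGMod.IsLocalObject (grading OF) (DGMod.shiftsOfAlgebraMap (grading OF) (grading EOF)) Z)
    {s : OF} (hs : s ∈ eulerSubmonoid) : Function.Bijective fun x : Z.homology => s • x := by
  induction hs using Submonoid.closure_induction with
  | mem x hx =>
    obtain ⟨n, rfl⟩ := hx
    exact DGMod.bijective_smul_of_isLocalObject hZ cOF_mem (idem_mul_idem n)
      (u := ⟨cInv n, cInv_mem n⟩) (Subtype.ext (by
        rw [Subalgebra.coe_mul, coe_algebraMap, coe_algebraMap]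
        exact c_mul_cInv n))
  | one =>
    simp only [one_smul]
    exact Function.bijective_id
  | mul x y _ _ hx hy =>
    simp only [mul_smul]
    exact hx.comp hy

end EulerRings

end

theorem mainTheorem5 :
    (DGMod.projective (EulerRings.grading EulerRings.OF)).IsSymmetricMonoidal ∧
    ModelData.IsSymmetricMonoidalQuillenEquivalence
      (DGMod.leftBousfield (EulerRings.grading EulerRings.OF)
        (DGMod.shiftsOfAlgebraMap (EulerRings.grading EulerRings.OF)
          (EulerRings.grading EulerRings.EOF)))
      (DGMod.projective (EulerRings.grading EulerRings.EOF))
      (DGMod.extendRestrictAdj (EulerRings.grading EulerRings.OF)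
        (EulerRings.grading EulerRings.EOF)) :=
  ⟨DGMod.projective_isSymmetricMonoidal _,
    DGMod.leftBousfield_isSymmetricMonoidalQuillenEquivalence EulerRings.eulerSubmonoid
      fun _ hZ _ hs => EulerRings.bijective_smul hZ hs⟩
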